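/- **Model ($k$-MLSD).** There are $n$ arms and an integer $k<n$. Arm $i$ has a mean payoff function $p_i:\mathbb Z\setminus\{0\}\to[0,1]$ that is monotone non-decreasing and saturates: there are known integers $\tau^{\min}<0<\tau^{\max}$ with $p_i(\tau)=p_i(\tau^{\max})$ for $\tau>\tau^{\max}$ and $p_i(\tau)=p_i(\tau^{\min})$ for $\tau<\tau^{\min}$. Every arm starts round $1$ in state $1$. An arm in state $\tau$ that is played moves to $\tau-1$ if $\tau<0$ and to $-1$ if $\tau>0$; an arm that is not played moves to $1$ if $\tau<0$ and to $\tau+1$ if $\tau>0$. At each round at most $k$ arms are played, and playing arm $i$ in state $\tau$ yields a payoff of mean $p_i(\tau)$. Let $\mathrm{OPT}(T)$ be the optimal expected total payoff in $T$ rounds. **Algorithm.** For $u\ge 1$ and $l\le -1$, the recurrent interval $I(u,l)$ is the cycle of $u-l$ states $1,2,\dots,u,-1,-2,\dots,l$, in which the arm is played exactly in the states $u,-1,\dots,l+1$. Let $q_i(u,l)=p_i(u)+\sum_{\tau=l+1}^{-1}p_i(\tau)$. Given $\epsilon\in(0,1)$, put $\tau^L=-\lceil 1/\epsilon\rceil$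 and compute an optimal solution $x^*$ of the linear program $$\max_{x\ge 0}\ \sum_{i,u,l} q_i(u,l)\,x_{i,u,l}\quad\text{s.t.}\quad \sum_{i,u,l}(-l)\,x_{i,u,l}\le k,\qquad \sum_{u,l}(u-l)\,x_{i,u,l}\le 1\ \ \text{for every arm } i,$$ where $1\le i\le n$, $1\le u\le\tau^{\max}$ and $\tau^L\le l\le -1$. Independently for each arm $i$, sample at most one interval $I_i=I(u_i,l_i)$, where $I(u,l)$ has probability $(u-l)x^*_{i,u,l}$ (and no interval is sampled with the remaining probability; the arm is then never played). If an interval is sampled, draw an offset $r_i$ uniformly from $\{0,\dots,u_i-l_i-1\}$; the virtual state $\nu_i(t)$ of arm $i$ is the state reached from state $1$ after $r_i+t$ moves along the cycle $I_i$. At round $t=1,2,\dots$ the candidates are the arms for which $I_i$ prescribes a play in state $\nu_i(t)$, and the algorithm plays a set $A_t$ of at most $k$ candidates that maximizes $\sum_{i\in A_t}p_i(\nu_i(t))$ (ties are broken arbitrarily). The horizon $T$ is not used. **Theorem.** (a) The algorithm can be implemented in time $\mathrm{poly}(n,\tau^{\max},1/\epsilon)$: there are one fixed program for a randomized real random access machine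 with unit-cost arithmetic (given $n,k,\tau^{\max},\tau^{\min},\epsilon$ and the tables of the values $p_i(\tau)$, $\tau^{\min}\le\tau\le\tau^{\max}$, $\tau\ne0$) and one polynomial such that, for every instance and every $\epsilon\in(0,1)$, the initialization and every single round take at most $\mathrm{poly}(n,\tau^{\max},1/\epsilon)$ steps, and for every $T$ the sets played in the first $T$ rounds have the law of those played by the algorithm, for some optimal $x^*$ and some tie-breaking. (b) There is an absolute constant $C$ such that for every instance, every $\epsilon\in(0,1)$, every choice of the optimal solution $x^*$, every tie-breaking and every $T$, the expected total payoff collected by the algorithm in $T$ rounds is at least $$(1-\epsilon)\left(1-\frac{k^k}{e^k\,k!}\right)\mathrm{OPT}(T)-C\,\bigl(n+\tau^{\max}k\bigr).$$ -/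

import Mathlib

open scoped ENNReal

noncomputable section

/-! ### The bandit model -/

/-- An instance of `k`-MLSD with arm set `Fin n`.  States are the nonzero integers; the value
`payoff i 0` is never used.  `payoff i τ` is the mean of the payoff drawn when arm `i` is played
in state `τ`. -/
structure MLSD (n k : ℕ) where
  k_lt : k < n
  payoff : Fin n → ℤ → ℝ
  payoff_nonneg : ∀ i τ, τ ≠ 0 → 0 ≤ payoff i τ
  payoff_le_one : ∀ i τ, τ ≠ 0 → payoff i τ ≤ 1
  payoff_mono : ∀ i τ₁ τ₂, τ₁ ≠ 0 → τ₂ ≠ 0 → τ₁ < τ₂ → payoff i τ₁ ≤ payoff i τ₂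
  τmin : ℤ
  τmax : ℤ
  τmin_neg : τmin < 0
  τmax_pos : 0 < τmax
  saturation_max : ∀ i τ, τmax < τ → payoff i τ = payoff i τmax
  saturation_min : ∀ i τ, τ < τmin → payoff i τ = payoff i τmin

open Classical in
/-- The state transition of a single arm which is played (`played`) or not (`¬ played`). -/
def nextState (played : Prop) (τ : ℤ) : ℤ :=
  if played then (if τ < 0 then τ - 1 else -1) else (if τ < 0 then 1 else τ + 1)

/-- A schedule of `T` rounds: `A t` is the set of arms played at round `t + 1`. -/
abbrev Schedule (n T : ℕ) : Type := Fin T → Finset (Fin n)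

/-- The state of arm `i` at the beginning of round `t + 1` under the schedule `A`. -/
def armState {n T : ℕ} (A : Schedule n T) (i : Fin n) : ℕ → ℤ
  | 0 => 1
  | t + 1 => nextState (∃ h : t < T, i ∈ A ⟨t, h⟩) (armState A i t)

namespace MLSD

variable {n k : ℕ} (M : MLSD n k)

/-- Total mean payoff collected by a schedule. -/
def total {T : ℕ} (A : Schedule n T) : ℝ :=
  ∑ t : Fin T, ∑ i ∈ A t, M.payoff i (armState A i t)

/-- Expected total payoff of a decision-maker whose (random) schedule has law `μ`. -/
def expectedTotal {T : ℕ} (μ : PMF (Schedule n T)) : ℝ :=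
  ∑ A : Schedule n T, (μ A).toReal * M.total A

/-- `OPT(T)`: the supremum of the expected total payoff over all decision-makers playing at most
`k` arms at each round.  The state transitions are deterministic and a payoff drawn at some round
has mean `payoff i τ` whatever happened before, so a decision-maker (randomized or adaptive) enters
only through the law of the schedule that it produces. -/
def OPT (T : ℕ) : ℝ :=
  ⨆ μ : {μ : PMF (Schedule n T) // ∀ A ∈ μ.support, ∀ t, (A t).card ≤ k}, M.expectedTotal μ.1

/-! ### Recurrent intervals and the linear program -/

/-- Aggregated payoff of the recurrent interval `I(u,l)` for arm `i`. -/
def aggregated (i : Fin n) (u l : ℤ) : ℝ :=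
  M.payoff i u + ∑ τ ∈ Finset.Icc (l + 1) (-1), M.payoff i τ

/-- The pairs `(u,l)` with `1 ≤ u ≤ τmax` and `L ≤ l ≤ -1`. -/
def box (L : ℤ) : Finset (ℤ × ℤ) := Finset.Icc 1 M.τmax ×ˢ Finset.Icc L (-1)

/-- Objective of the linear program. -/
def objective (L : ℤ) (x : Fin n → ℤ × ℤ → ℝ) : ℝ :=
  ∑ i, ∑ I ∈ M.box L, M.aggregated i I.1 I.2 * x i I

/-- Feasibility for the linear program with parameter `L`. -/
structure IsFeasible (L : ℤ) (x : Fin n → ℤ × ℤ → ℝ) : Prop where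
  nonneg : ∀ i, ∀ I ∈ M.box L, 0 ≤ x i I
  plays : ∑ i, ∑ I ∈ M.box L, -(I.2 : ℝ) * x i I ≤ k
  arm : ∀ i, ∑ I ∈ M.box L, ((I.1 : ℝ) - I.2) * x i I ≤ 1

/-- Optimal solutions of the linear program with parameter `L`. -/
def IsOptimal (L : ℤ) (x : Fin n → ℤ × ℤ → ℝ) : Prop :=
  M.IsFeasible L x ∧ ∀ y, M.IsFeasible L y → M.objective L y ≤ M.objective L x

end MLSD

/-- Characteristic trajectory of `I(u,l)`: is the arm played in state `τ`? -/
def isPlay (u l τ : ℤ) : Prop := (l + 1 ≤ τ ∧ τ ≤ -1) ∨ τ = u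

/-- Transition function of `I(u,l)`. -/
def intervalNext (u l τ : ℤ) : ℤ := nextState (isPlay u l τ) τ

/-! ### The algorithm -/

/-- The uniform distribution on `{0, …, m - 1}` (and the point mass at `0` if `m = 0`). -/
def uniformBelow (m : ℕ) : PMF ℕ :=
  if h : 0 < m then PMF.uniformOfFinset (Finset.range m) ⟨0, Finset.mem_range.2 h⟩ else PMF.pure 0

/-- Independent draws from `μ 0, …, μ (n - 1)`. -/
def independent {α : Type} : (n : ℕ) → (Fin n → PMF α) → PMF (Fin n → α)
  | 0, _ => PMF.pure Fin.elim0
  | n + 1, μ => (μ 0).bind fun a => (independent n fun i => μ i.succ).map (Fin.cons a)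

/-- The result of the initialization for all arms: `none` if no recurrent interval is sampled,
`some (I, r)` if the recurrent interval `I = (u,l)` is sampled with offset `r`. -/
abbrev Outcome (n : ℕ) : Type := Fin n → Option ((ℤ × ℤ) × ℕ)

/-- The virtual state at round `t` of an arm with sampled interval `I` and offset `r`: the virtual
state at round `0` is obtained from the state `1` by `r` transitions of the interval. -/
def virtualState (I : ℤ × ℤ) (r t : ℕ) : ℤ :=
  (intervalNext I.1 I.2)^[t] ((intervalNext I.1 I.2)^[r] 1)

open Classical in
/-- The candidate arms of round `t`. -/
def candidates {n : ℕ} (o : Outcome n) (t : ℕ) : Finset (Fin n) :=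
  Finset.univ.filter fun i =>
    ∃ I r, o i = some (I, r) ∧ isPlay I.1 I.2 (virtualState I r t)

namespace MLSD

variable {n k : ℕ} (M : MLSD n k)

/-- Weight of each possible result of the interval sampling of arm `i`. -/
def intervalWeight (L : ℤ) (x : Fin n → ℤ × ℤ → ℝ) (i : Fin n) : Option (ℤ × ℤ) → ℝ
  | none => 1 - ∑ I ∈ M.box L, ((I.1 : ℝ) - I.2) * x i I
  | some I => if I ∈ M.box L then ((I.1 : ℝ) - I.2) * x i I else 0

theorem intervalWeight_sum {L : ℤ} {x : Fin n → ℤ × ℤ → ℝ} (h : M.IsFeasible L x) (i : Fin n) :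
    ∑ a ∈ Finset.insertNone (M.box L), ENNReal.ofReal (M.intervalWeight L x i a) = 1 := by
  have hpos : ∀ a ∈ Finset.insertNone (M.box L), 0 ≤ M.intervalWeight L x i a := by
    intro a _
    cases a with
    | none => exact sub_nonneg.2 (h.arm i)
    | some I =>
      simp only [intervalWeight]
      split_ifs with hI
      · refine mul_nonneg ?_ (h.nonneg i I hI)
        simp only [box, Finset.mem_product, Finset.mem_Icc] at hI
        have h1 : I.2 ≤ I.1 := by omega
        exact sub_nonneg.2 (by exact_mod_cast h1)
      · exact le_rfl
  rw [← ENNReal.ofReal_sum_of_nonneg hpos, Finset.sum_insertNone]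
  have h2 : ∑ I ∈ M.box L, M.intervalWeight L x i (some I)
      = ∑ I ∈ M.box L, ((I.1 : ℝ) - I.2) * x i I :=
    Finset.sum_congr rfl fun I hI => by simp only [intervalWeight, if_pos hI]
  rw [h2]
  simp [intervalWeight]

/-- Sampling of at most one recurrent interval for arm `i`. -/
def intervalLaw {L : ℤ} {x : Fin n → ℤ × ℤ → ℝ} (h : M.IsFeasible L x) (i : Fin n) :
    PMF (Option (ℤ × ℤ)) :=
  PMF.ofFinset (fun a => ENNReal.ofReal (M.intervalWeight L x i a)) (Finset.insertNone (M.box L))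
    (M.intervalWeight_sum h i) (by
      intro a ha
      cases a with
      | none => exact absurd (Finset.none_mem_insertNone) ha
      | some I =>
        have hI : I ∉ M.box L := fun hI => ha (Finset.some_mem_insertNone.2 hI)
        simp [intervalWeight, hI])

/-- Sampling of the recurrent interval of arm `i`, followed by a uniformly random offset. -/
def armLaw {L : ℤ} {x : Fin n → ℤ × ℤ → ℝ} (h : M.IsFeasible L x) (i : Fin n) :
    PMF (Option ((ℤ × ℤ) × ℕ)) :=
  (M.intervalLaw h i).bind fun
    | none => PMF.pure none
    | some I => (uniformBelow (I.1 - I.2).toNat).map fun r => some (I, r)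

/-- Law of the result of the initialization: the arms are independent. -/
def outcomeLaw {L : ℤ} {x : Fin n → ℤ × ℤ → ℝ} (h : M.IsFeasible L x) : PMF (Outcome n) :=
  independent n (M.armLaw h)

/-- Payoff of arm `i` evaluated at its virtual state at round `t`. -/
def virtualPayoff (o : Outcome n) (t : ℕ) (i : Fin n) : ℝ :=
  match o i with
  | none => 0
  | some (I, r) => M.payoff i (virtualState I r t)

/-- `sel o t` is the set of arms played at round `t ≥ 1` after the initialization resulted in `o`:
it maximizes the virtual payoff among all sets of at most `k` candidates.  Ties are broken
arbitrarily. -/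
def IsSelection (sel : Outcome n → ℕ → Finset (Fin n)) : Prop :=
  ∀ o t, 1 ≤ t → sel o t ⊆ candidates o t ∧ (sel o t).card ≤ k ∧
    ∀ S ⊆ candidates o t, S.card ≤ k →
      ∑ i ∈ S, M.virtualPayoff o t i ≤ ∑ i ∈ sel o t, M.virtualPayoff o t i

/-- Law of the schedule that the algorithm plays in the first `T` rounds, for the feasible solution
`x` of the linear program and the selection `sel`. -/
def algorithmLaw {L : ℤ} {x : Fin n → ℤ × ℤ → ℝ} (h : M.IsFeasible L x)
    (sel : Outcome n → ℕ → Finset (Fin n)) (T : ℕ) : PMF (Schedule n T) :=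
  (M.outcomeLaw h).map fun o t => sel o ((t : ℕ) + 1)

end MLSD

/-! ### The machine model: a randomized real random access machine

Programs are finite and work on arrays of natural numbers and arrays of real numbers.  Naturals
admit `+`, truncated `-` and comparison; reals admit `+`, `-`, `*`, `/` and comparison (there is
no rounding, and no real constants other than those obtained from the naturals); a coin of given
bias can be flipped and a uniform element of `{0, …, m - 1}` can be drawn.  Every executed command
and every evaluated test costs one step. -/

/-- Memory: `nat a i j l` is the entry `(i, j, l)` of the natural-number array `a`. -/
structure Mem where
  nat : ℕ → ℕ → ℕ → ℕ → ℕ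
  real : ℕ → ℕ → ℕ → ℕ → ℝ

/-- Expressions for natural numbers. -/
inductive NExpr where
  | const (c : ℕ)
  | get (a : ℕ) (i j l : NExpr)
  | add (e f : NExpr)
  | sub (e f : NExpr)

def NExpr.eval (m : Mem) : NExpr → ℕ
  | const c => c
  | get a i j l => m.nat a (i.eval m) (j.eval m) (l.eval m)
  | add e f => e.eval m + f.eval m
  | sub e f => e.eval m - f.eval m

/-- Expressions for real numbers (a division by zero returns `0`). -/
inductive RExpr where
  | cast (e : NExpr)
  | get (a : ℕ) (i j l : NExpr)
  | add (e f : RExpr)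
  | sub (e f : RExpr)
  | mul (e f : RExpr)
  | div (e f : RExpr)

def RExpr.eval (m : Mem) : RExpr → ℝ
  | cast e => (e.eval m : ℝ)
  | get a i j l => m.real a (i.eval m) (j.eval m) (l.eval m)
  | add e f => e.eval m + f.eval m
  | sub e f => e.eval m - f.eval m
  | mul e f => e.eval m * f.eval m
  | div e f => e.eval m / f.eval m

/-- Tests. -/
inductive Test where
  | nlt (e f : NExpr)
  | rlt (e f : RExpr)
  | not (b : Test)
  | and (b c : Test)

def Test.eval (m : Mem) : Test → Prop
  | nlt e f => e.eval m < f.eval m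
  | rlt e f => e.eval m < f.eval m
  | not b => ¬ b.eval m
  | and b c => b.eval m ∧ c.eval m

/-- Commands. -/
inductive Cmd where
  | skip
  | nset (a : ℕ) (i j l : NExpr) (e : NExpr)
  | rset (a : ℕ) (i j l : NExpr) (e : RExpr)
  | flip (a : ℕ) (i j l : NExpr) (p : RExpr)
  | draw (a : ℕ) (i j l : NExpr) (e : NExpr)
  | seq (c d : Cmd)
  | ite (b : Test) (c d : Cmd)
  | loop (b : Test) (c : Cmd)

/-- Writing an entry of a three-dimensional array. -/
def writeEntry {α : Type} (f : ℕ → ℕ → ℕ → ℕ → α) (a i j l : ℕ) (v : α) : ℕ → ℕ → ℕ → ℕ → α :=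
  fun a' i' j' l' => if a' = a ∧ i' = i ∧ j' = j ∧ l' = l then v else f a' i' j' l'

def Mem.setNat (m : Mem) (a : ℕ) (i j l : NExpr) (v : ℕ) : Mem :=
  { m with nat := writeEntry m.nat a (i.eval m) (j.eval m) (l.eval m) v }

def Mem.setReal (m : Mem) (a : ℕ) (i j l : NExpr) (v : ℝ) : Mem :=
  { m with real := writeEntry m.real a (i.eval m) (j.eval m) (l.eval m) v }

/-- A coin that shows `1` with probability `p` (clamped to `[0,1]`) and `0` otherwise. -/
def coin (p : ℝ) : PMF ℕ :=
  (PMF.ofFintype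
    (fun b : Bool => ENNReal.ofReal (if b then max 0 (min 1 p) else 1 - max 0 (min 1 p))) (by
      rw [Fintype.sum_bool, ← ENNReal.ofReal_add] <;> simp)).map fun b => if b then 1 else 0

/-- A configuration: the commands that remain to be executed, and the memory.  The machine has
halted when no command remains. -/
abbrev Config : Type := List Cmd × Mem

open Classical in
/-- One step of the machine. -/
def step : Config → PMF Config
  | ([], m) => PMF.pure ([], m)
  | (Cmd.skip :: K, m) => PMF.pure (K, m)
  | (Cmd.nset a i j l e :: K, m) => PMF.pure (K, m.setNat a i j l (e.eval m))
  | (Cmd.rset a i j l e :: K, m) => PMF.pure (K, m.setReal a i j l (e.eval m))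
  | (Cmd.flip a i j l p :: K, m) => (coin (p.eval m)).map fun v => (K, m.setNat a i j l v)
  | (Cmd.draw a i j l e :: K, m) => (uniformBelow (e.eval m)).map fun v => (K, m.setNat a i j l v)
  | (Cmd.seq c d :: K, m) => PMF.pure (c :: d :: K, m)
  | (Cmd.ite b c d :: K, m) => PMF.pure (if b.eval m then (c :: K, m) else (d :: K, m))
  | (Cmd.loop b c :: K, m) =>
      PMF.pure (if b.eval m then (c :: Cmd.loop b c :: K, m) else (K, m))

/-- `N` steps of the machine. -/
def runFor : ℕ → Config → PMF Config
  | 0, s => PMF.pure s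
  | N + 1, s => (step s).bind (runFor N)

/-- Whatever the random draws, the command `c` started from `m` halts within `B` steps. -/
def HaltsWithin (B : ℕ) (c : Cmd) (m : Mem) : Prop :=
  ∀ s ∈ (runFor B ([c], m)).support, s.1 = []

/-- The memory after `B` steps of the command `c`; this is the final memory if `c` halts within
`B` steps. -/
def exec (B : ℕ) (c : Cmd) (m : Mem) : PMF Mem := (runFor B ([c], m)).map Prod.snd

/-- An online algorithm: `init` is executed once, and then `round` is executed at every round, on
the memory left by the previous round. -/
structure OnlineProgram where
  init : Cmd
  round : Cmd

/-- The set of arms that is played at the end of the execution of `round`. -/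
def playedSet (n : ℕ) (m : Mem) : Finset (Fin n) :=
  Finset.univ.filter fun i => m.nat 1 i 0 0 ≠ 0

namespace OnlineProgram

variable (P : OnlineProgram)

/-- The memory after the initialization and `t` rounds. -/
def memAfter (B : ℕ) (m : Mem) : ℕ → PMF Mem
  | 0 => exec B P.init m
  | t + 1 => (memAfter B m t).bind (exec B P.round)

/-- The initialization and each single round take at most `B` steps. -/
def RunsWithin (B : ℕ) (m : Mem) : Prop :=
  HaltsWithin B P.init m ∧ ∀ t, ∀ m' ∈ (P.memAfter B m t).support, HaltsWithin B P.round m'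

/-- Law of the sets played in `T` rounds that start from the memory `m`. -/
def roundsLaw (B n : ℕ) : (T : ℕ) → Mem → PMF (Schedule n T)
  | 0, _ => PMF.pure Fin.elim0
  | T + 1, m => (exec B P.round m).bind fun m' =>
      (roundsLaw B n T m').map fun A => Fin.cons (playedSet n m') A

/-- Law of the sets played in the first `T` rounds, when the program is started from `m`. -/
def playLaw (B n T : ℕ) (m : Mem) : PMF (Schedule n T) :=
  (exec B P.init m).bind (P.roundsLaw B n T)

end OnlineProgram

/-- The input: `n`, `k`, `τmax`, `-τmin`, `ε` and the finite tables of the values `payoff i τ` for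
`1 ≤ τ ≤ τmax` and for `τmin ≤ τ ≤ -1`.  All other memory cells contain `0`. -/
def MLSD.input {n k : ℕ} (M : MLSD n k) (ε : ℝ) : Mem where
  nat a i j l :=
    if a = 0 ∧ j = 0 ∧ l = 0 then
      (if i = 0 then n else if i = 1 then k else if i = 2 then M.τmax.toNat
        else if i = 3 then (-M.τmin).toNat else 0)
    else 0
  real a i j l :=
    if a = 0 ∧ i = 0 ∧ j = 0 ∧ l = 0 then ε
    else if h : i < n then
      (if a = 1 ∧ l = 0 ∧ 1 ≤ j ∧ (j : ℤ) ≤ M.τmax then M.payoff ⟨i, h⟩ j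
        else if a = 2 ∧ l = 0 ∧ 1 ≤ j ∧ (j : ℤ) ≤ -M.τmin then M.payoff ⟨i, h⟩ (-j) else 0)
    else 0

end

/-!
The linear program is a fractional multiple-choice knapsack problem.  In terms of the probability
that an arm follows the interval `I(u, l)`, the value of the interval is its payoff per round and
its cost is its number of plays per round, the arm that is never played being a further item; the
budget is `k`.  A Lagrange multiplier `lam` and the maximal reduced values `g i` form a dual
solution.  The smallest multiplier at which the cheapest best items respect the budget is `1` or a
point where the reduced values of two items of an arm cross, and at this multiplier either `lam = 0`
or the most expensive best items use up the budget.  Hence a mixture of the cheapest and of the most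
expensive choice, with a common weight, is primal feasible and attains the dual bound
(`exists_isCritical`, `IsCritical.objective_eq`).

Implementation in polynomial time: trying all crossings finds this multiplier exactly, without
solving a general linear program, and sampling an interval is one coin flip per arm.  At every round
the program moves each arm by one position along its cycle and plays the candidates that are
preceded by fewer than `k` others.  The correctness proof uses a small program logic (`RunsB`,
`Det`) whose bound for the running time, `Cmd.cost`, is read off the text of the program once all
loops are known to have a bounded number of iterations (`lpProgram_implements`).

Upper bound for the optimum (`OPT_le_dual`): a trajectory of an arm consists of cycles `I(u, l)`.  A
dual solution bounds the payoff of each cycle up to the factor `1 - ε`, also if `u > τmax`, by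
saturation, or `l < -⌈1 / ε⌉`, since late plays in a long run pay no more than those of fractional
copies of `I(1, -⌈1 / ε⌉)`, in which the arm is played in all rounds but one.  The dual bound is the
value of every optimal solution, so the choice of the optimal solution does not matter.

Lower bound for the algorithm: the random offset makes the virtual states stationary
(`expect_virtualYield`), so at every round the expected number of candidates is at most `k` and the
expected sum of their payoffs is the value of the linear program.  Playing only the best `k` of the
candidates loses at most the factor `gapFactor k`: cutting the payoffs into levels reduces this to
`E[min k X] ≥ gapFactor k * E[X]` for sums `X` of independent indicators with `E[X] ≤ k`, and for
these `E[min k X]` is at least its value for a Poisson variable of the same mean, which is a concave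
function of the mean (`gapFactor_mul_le_expect`).  Finally, monotonicity of the payoffs implies that
playing fewer times than prescribed only improves the later states, up to a loss of at most `1` for
each arm (`virtual_le_collected`).
-/

noncomputable section

/-! ### A program logic for the machine -/

theorem PMF.bind_congr_support {α β : Type} {μ : PMF α} {f g : α → PMF β}
    (h : ∀ a ∈ μ.support, f a = g a) : μ.bind f = μ.bind g := by
  ext b
  simp only [PMF.bind_apply]
  refine tsum_congr fun a => ?_
  by_cases ha : μ a = 0
  · simp [ha]
  · rw [h a ((PMF.mem_support_iff _ _).2 ha)]

theorem runFor_nil (N : ℕ) (m : Mem) : runFor N ([], m) = PMF.pure ([], m) := by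
  induction N with
  | zero => rfl
  | succ N ih => simp [runFor, step, ih]

/-- The command `c` started from `m` halts within `B` steps, and `μ` is the law of its final
memory.  Phrased through continuations: if the remaining commands `K`, started from any memory `m'`
that `c` can leave, have reached the law `G m'` after `N₀` steps and for ever, then `c :: K` has
reached the law `μ.bind G` after `B + N₀` steps and for ever.  The actual (random) number of steps
of `c` need not be recorded. -/
def RunsB (B : ℕ) (c : Cmd) (m : Mem) (μ : PMF Mem) : Prop :=
  ∀ (K : List Cmd) (G : Mem → PMF Config) (N₀ : ℕ),
    (∀ m' ∈ μ.support, ∀ N, N₀ ≤ N → runFor N (K, m') = G m') →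
      ∀ N, B + N₀ ≤ N → runFor N (c :: K, m) = μ.bind G

theorem RunsB.mono {B B' : ℕ} {c : Cmd} {m : Mem} {μ : PMF Mem} (h : RunsB B c m μ)
    (hB : B ≤ B') : RunsB B' c m μ := fun K G N₀ hG N hN => h K G N₀ hG N (by omega)

theorem RunsB.of_step {c : Cmd} {m : Mem} {μ : PMF Mem}
    (h : ∀ K, step (c :: K, m) = μ.map fun m' => (K, m')) : RunsB 1 c m μ := by
  intro K G N₀ hG N hN
  obtain ⟨N, rfl⟩ : ∃ N', N = N' + 1 := ⟨N - 1, by omega⟩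
  rw [runFor, h, PMF.bind_map]
  exact PMF.bind_congr_support fun m' hm' => hG m' hm' N (by omega)

theorem RunsB.exec {B : ℕ} {c : Cmd} {m : Mem} {μ : PMF Mem} (h : RunsB B c m μ) {B' : ℕ}
    (hB : B ≤ B') : exec B' c m = μ := by
  have := h [] (fun m' => PMF.pure ([], m')) 0 (fun m' _ N _ => runFor_nil N m') B' hB
  rw [_root_.exec, this, PMF.map_bind]
  simp [PMF.pure_map]

theorem RunsB.haltsWithin {B : ℕ} {c : Cmd} {m : Mem} {μ : PMF Mem} (h : RunsB B c m μ) {B' : ℕ}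
    (hB : B ≤ B') : HaltsWithin B' c m := by
  have := h [] (fun m' => PMF.pure ([], m')) 0 (fun m' _ N _ => runFor_nil N m') B' hB
  intro s hs
  rw [this, PMF.mem_support_bind_iff] at hs
  obtain ⟨m', _, hs⟩ := hs
  rw [PMF.support_pure] at hs
  simp at hs
  simp [hs]

/-- The rule for commands whose first step replaces them by `d` followed by `e`. -/
theorem RunsB.of_step_seq {c d e : Cmd} {m : Mem} {B₁ B₂ : ℕ} {μ : PMF Mem} {κ : Mem → PMF Mem}
    (h : ∀ K, step (c :: K, m) = PMF.pure (d :: e :: K, m)) (h₁ : RunsB B₁ d m μ)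
    (h₂ : ∀ m' ∈ μ.support, RunsB B₂ e m' (κ m')) : RunsB (1 + B₁ + B₂) c m (μ.bind κ) := by
  intro K G N₀ hG N hN
  obtain ⟨N, rfl⟩ : ∃ N', N = N' + 1 := ⟨N - 1, by omega⟩
  rw [runFor, h, PMF.pure_bind, PMF.bind_bind]
  refine h₁ (e :: K) (fun m' => (κ m').bind G) (B₂ + N₀) ?_ N (by omega)
  intro m' hm' N' hN'
  refine h₂ m' hm' K G N₀ (fun m'' hm'' => hG m'' ?_) N' hN'
  rw [PMF.mem_support_bind_iff]
  exact ⟨m', hm', hm''⟩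

theorem RunsB.of_step_goto {c d : Cmd} {m : Mem} {B : ℕ} {μ : PMF Mem}
    (h : ∀ K, step (c :: K, m) = PMF.pure (d :: K, m)) (h₁ : RunsB B d m μ) :
    RunsB (1 + B) c m μ := by
  intro K G N₀ hG N hN
  obtain ⟨N, rfl⟩ : ∃ N', N = N' + 1 := ⟨N - 1, by omega⟩
  rw [runFor, h, PMF.pure_bind]
  exact h₁ K G N₀ hG N (by omega)

theorem RunsB.seq {c d : Cmd} {m : Mem} {B₁ B₂ : ℕ} {μ : PMF Mem} {κ : Mem → PMF Mem}
    (h₁ : RunsB B₁ c m μ) (h₂ : ∀ m' ∈ μ.support, RunsB B₂ d m' (κ m')) :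
    RunsB (1 + B₁ + B₂) (.seq c d) m (μ.bind κ) :=
  RunsB.of_step_seq (fun _ => rfl) h₁ h₂

theorem RunsB.loop_true {b : Test} {c : Cmd} {m : Mem} {B₁ B₂ : ℕ} {μ : PMF Mem}
    {κ : Mem → PMF Mem} (hb : b.eval m) (h₁ : RunsB B₁ c m μ)
    (h₂ : ∀ m' ∈ μ.support, RunsB B₂ (.loop b c) m' (κ m')) :
    RunsB (1 + B₁ + B₂) (.loop b c) m (μ.bind κ) :=
  RunsB.of_step_seq (fun K => by simp [step, hb]) h₁ h₂

theorem RunsB.loop_false {b : Test} {c : Cmd} {m : Mem} (hb : ¬ b.eval m) :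
    RunsB 1 (.loop b c) m (PMF.pure m) :=
  RunsB.of_step fun K => by simp [step, hb, PMF.pure_map]

/-- A bound for the running time that reads only the text of the command, provided that no loop
is iterated more than `Z` times. -/
def Cmd.cost (Z : ℕ) : Cmd → ℕ
  | seq c d => 1 + c.cost Z + d.cost Z
  | ite _ c d => 1 + (c.cost Z + d.cost Z)
  | loop _ c => 1 + Z * (1 + c.cost Z)
  | _ => 1

theorem Cmd.cost_le (c : Cmd) : ∃ A d : ℕ, ∀ Z, 1 ≤ Z → c.cost Z ≤ A * Z ^ d := by
  have key : ∀ A d A' d' Z : ℕ, 1 ≤ Z →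
      1 + (A * Z ^ d + A' * Z ^ d') ≤ (1 + A + A') * Z ^ (d + d') := by
    intro A d A' d' Z hZ
    have h1 : Z ^ d ≤ Z ^ (d + d') := Nat.pow_le_pow_right hZ (by omega)
    have h2 : Z ^ d' ≤ Z ^ (d + d') := Nat.pow_le_pow_right hZ (by omega)
    have h3 : 1 ≤ Z ^ (d + d') := Nat.one_le_pow _ _ hZ
    nlinarith [Nat.mul_le_mul_left A h1, Nat.mul_le_mul_left A' h2]
  induction c with
  | seq c d hc hd =>
    obtain ⟨A, e, h⟩ := hc
    obtain ⟨A', e', h'⟩ := hd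
    refine ⟨1 + A + A', e + e', fun Z hZ => le_trans ?_ (key A e A' e' Z hZ)⟩
    have := h Z hZ
    have := h' Z hZ
    simp only [Cmd.cost]; omega
  | ite b c d hc hd =>
    obtain ⟨A, e, h⟩ := hc
    obtain ⟨A', e', h'⟩ := hd
    refine ⟨1 + A + A', e + e', fun Z hZ => le_trans ?_ (key A e A' e' Z hZ)⟩
    have := h Z hZ
    have := h' Z hZ
    simp only [Cmd.cost]; omega
  | loop b c hc =>
    obtain ⟨A, e, h⟩ := hc
    refine ⟨2 + A, e + 1, fun Z hZ => ?_⟩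
    have h1 := h Z hZ
    have h3 : 1 ≤ Z ^ e := Nat.one_le_pow _ _ hZ
    simp only [Cmd.cost]
    have : Z * (1 + c.cost Z) ≤ Z * ((1 + A) * Z ^ e) := Nat.mul_le_mul_left _ (by nlinarith)
    calc 1 + Z * (1 + c.cost Z) ≤ Z * Z ^ e + Z * ((1 + A) * Z ^ e) := by nlinarith
      _ = (2 + A) * Z ^ (e + 1) := by ring
  | _ => exact ⟨1, 0, fun Z _ => by simp [Cmd.cost]⟩

/-- The arrays of naturals that a command may write. -/
def Cmd.natWrites : Cmd → List ℕ
  | nset a _ _ _ _ => [a]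
  | flip a _ _ _ _ => [a]
  | draw a _ _ _ _ => [a]
  | seq c d => c.natWrites ++ d.natWrites
  | ite _ c d => c.natWrites ++ d.natWrites
  | loop _ c => c.natWrites
  | _ => []

/-- The arrays of reals that a command may write. -/
def Cmd.realWrites : Cmd → List ℕ
  | rset a _ _ _ _ => [a]
  | seq c d => c.realWrites ++ d.realWrites
  | ite _ c d => c.realWrites ++ d.realWrites
  | loop _ c => c.realWrites
  | _ => []

/-- The memories `m` and `m'` agree off the arrays listed in `W` and `R`. -/
structure Agree (W R : List ℕ) (m m' : Mem) : Prop where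
  nat : ∀ a, a ∉ W → m'.nat a = m.nat a
  real : ∀ a, a ∉ R → m'.real a = m.real a

theorem Agree.refl (W R : List ℕ) (m : Mem) : Agree W R m m := ⟨fun _ _ => rfl, fun _ _ => rfl⟩

theorem Agree.trans {W R : List ℕ} {m m' m'' : Mem} (h : Agree W R m m') (h' : Agree W R m' m'') :
    Agree W R m m'' :=
  ⟨fun a ha => (h'.nat a ha).trans (h.nat a ha), fun a ha => (h'.real a ha).trans (h.real a ha)⟩

theorem Agree.mono {W R W' R' : List ℕ} {m m' : Mem} (h : Agree W R m m') (hW : W ⊆ W')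
    (hR : R ⊆ R') : Agree W' R' m m' :=
  ⟨fun a ha => h.nat a fun h' => ha (hW h'), fun a ha => h.real a fun h' => ha (hR h')⟩

theorem setNat_nat_of_ne {m : Mem} {a a' : ℕ} (i j l : NExpr) (v : ℕ) (h : a' ≠ a) :
    (m.setNat a i j l v).nat a' = m.nat a' := by
  funext i' j' l'; simp [Mem.setNat, writeEntry, h]

theorem setNat_nat_self (m : Mem) (a : ℕ) (i j l : NExpr) (v i' j' l' : ℕ) :
    (m.setNat a i j l v).nat a i' j' l' =
      if i' = i.eval m ∧ j' = j.eval m ∧ l' = l.eval m then v else m.nat a i' j' l' := by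
  simp [Mem.setNat, writeEntry]

@[simp] theorem setNat_real (m : Mem) (a : ℕ) (i j l : NExpr) (v : ℕ) :
    (m.setNat a i j l v).real = m.real := rfl

theorem setReal_real_of_ne {m : Mem} {a a' : ℕ} (i j l : NExpr) (v : ℝ) (h : a' ≠ a) :
    (m.setReal a i j l v).real a' = m.real a' := by
  funext i' j' l'; simp [Mem.setReal, writeEntry, h]

theorem setReal_real_self (m : Mem) (a : ℕ) (i j l : NExpr) (v : ℝ) (i' j' l' : ℕ) :
    (m.setReal a i j l v).real a i' j' l' =
      if i' = i.eval m ∧ j' = j.eval m ∧ l' = l.eval m then v else m.real a i' j' l' := by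
  simp [Mem.setReal, writeEntry]

@[simp] theorem setReal_nat (m : Mem) (a : ℕ) (i j l : NExpr) (v : ℝ) :
    (m.setReal a i j l v).nat = m.nat := rfl

theorem agree_setNat (m : Mem) (a : ℕ) (i j l : NExpr) (v : ℕ) {W R : List ℕ} (h : a ∈ W) :
    Agree W R m (m.setNat a i j l v) :=
  ⟨fun a' h' => setNat_nat_of_ne _ _ _ _ (by rintro rfl; exact h' h), fun _ _ => rfl⟩

theorem agree_setReal (m : Mem) (a : ℕ) (i j l : NExpr) (v : ℝ) {W R : List ℕ} (h : a ∈ R) :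
    Agree W R m (m.setReal a i j l v) :=
  ⟨fun _ _ => rfl, fun a' h' => setReal_real_of_ne _ _ _ _ (by rintro rfl; exact h' h)⟩

theorem step_agree (K : List Cmd) (m : Mem) {W R : List ℕ} (hW : ∀ c ∈ K, c.natWrites ⊆ W)
    (hR : ∀ c ∈ K, c.realWrites ⊆ R) : ∀ s ∈ (step (K, m)).support,
      (∀ c ∈ s.1, c.natWrites ⊆ W) ∧ (∀ c ∈ s.1, c.realWrites ⊆ R) ∧ Agree W R m s.2 := by
  cases K with
  | nil => intro s hs; simp [step] at hs; subst hs; exact ⟨by simp, by simp, Agree.refl _ _ _⟩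
  | cons c K =>
    simp only [List.mem_cons, forall_eq_or_imp] at hW hR
    obtain ⟨hcW, hKW⟩ := hW
    obtain ⟨hcR, hKR⟩ := hR
    intro s hs
    cases c with
    | skip => simp [step] at hs; subst hs; exact ⟨hKW, hKR, Agree.refl _ _ _⟩
    | nset a i j l e =>
      simp [step] at hs; subst hs
      exact ⟨hKW, hKR, agree_setNat _ _ _ _ _ _ (hcW (by simp [Cmd.natWrites]))⟩
    | rset a i j l e =>
      simp [step] at hs; subst hs
      exact ⟨hKW, hKR, agree_setReal _ _ _ _ _ _ (hcR (by simp [Cmd.realWrites]))⟩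
    | flip a i j l p =>
      simp only [step, PMF.support_map, Set.mem_image] at hs
      obtain ⟨v, _, rfl⟩ := hs
      exact ⟨hKW, hKR, agree_setNat _ _ _ _ _ _ (hcW (by simp [Cmd.natWrites]))⟩
    | draw a i j l p =>
      simp only [step, PMF.support_map, Set.mem_image] at hs
      obtain ⟨v, _, rfl⟩ := hs
      exact ⟨hKW, hKR, agree_setNat _ _ _ _ _ _ (hcW (by simp [Cmd.natWrites]))⟩
    | seq c d =>
      simp [step] at hs; subst hs
      simp only [Cmd.natWrites, Cmd.realWrites, List.append_subset] at hcW hcR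
      refine ⟨?_, ?_, Agree.refl _ _ _⟩
      · simpa using ⟨hcW.1, hcW.2, hKW⟩
      · simpa using ⟨hcR.1, hcR.2, hKR⟩
    | ite b c d =>
      simp only [Cmd.natWrites, Cmd.realWrites, List.append_subset] at hcW hcR
      by_cases hb : b.eval m
      · simp [step, hb] at hs; subst hs
        refine ⟨?_, ?_, Agree.refl _ _ _⟩
        · simpa using ⟨hcW.1, hKW⟩
        · simpa using ⟨hcR.1, hKR⟩
      · simp [step, hb] at hs; subst hs
        refine ⟨?_, ?_, Agree.refl _ _ _⟩
        · simpa using ⟨hcW.2, hKW⟩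
        · simpa using ⟨hcR.2, hKR⟩
    | loop b c =>
      simp only [Cmd.natWrites, Cmd.realWrites] at hcW hcR
      by_cases hb : b.eval m
      · simp [step, hb] at hs; subst hs
        refine ⟨?_, ?_, Agree.refl _ _ _⟩
        · simpa [Cmd.natWrites] using ⟨hcW, hKW⟩
        · simpa [Cmd.realWrites] using ⟨hcR, hKR⟩
      · simp [step, hb] at hs; subst hs
        exact ⟨hKW, hKR, Agree.refl _ _ _⟩

theorem runFor_agree (N : ℕ) : ∀ (s₀ : Config) {W R : List ℕ}, (∀ c ∈ s₀.1, c.natWrites ⊆ W) →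
    (∀ c ∈ s₀.1, c.realWrites ⊆ R) → ∀ s ∈ (runFor N s₀).support, Agree W R s₀.2 s.2 := by
  induction N with
  | zero =>
    intro s₀ W R _ _ s hs
    simp [runFor] at hs; subst hs; exact Agree.refl _ _ _
  | succ N ih =>
    intro s₀ W R hW hR s hs
    rw [runFor, PMF.mem_support_bind_iff] at hs
    obtain ⟨s₁, h₁, hs⟩ := hs
    obtain ⟨a, b, c⟩ := step_agree s₀.1 s₀.2 hW hR s₁ h₁
    exact c.trans (ih s₁ a b s hs)

/-- The frame rule: arrays that do not occur as a target of an assignment keep their contents. -/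
theorem RunsB.agree {B : ℕ} {c : Cmd} {m : Mem} {μ : PMF Mem} (h : RunsB B c m μ) :
    ∀ m' ∈ μ.support, Agree c.natWrites c.realWrites m m' := by
  intro m' hm'
  have := h [] (fun m' => PMF.pure ([], m')) 0 (fun m' _ N _ => runFor_nil N m') B le_rfl
  refine runFor_agree B ([c], m) (by simp) (by simp) ([], m') ?_
  rw [this, PMF.mem_support_bind_iff]
  exact ⟨m', hm', by simp⟩

/-- The command `c` started from `m` has a certain final memory, which satisfies `Q`; the
running time is at most `c.cost Z`. -/
def Det (Z : ℕ) (c : Cmd) (m : Mem) (Q : Mem → Prop) : Prop :=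
  ∃ m', Q m' ∧ RunsB (c.cost Z) c m (PMF.pure m')

namespace Det

variable {Z : ℕ} {c d : Cmd} {m : Mem} {Q R : Mem → Prop}

theorem weaken (h : Det Z c m R) (hQ : ∀ m', Agree c.natWrites c.realWrites m m' → R m' → Q m') :
    Det Z c m Q :=
  let ⟨m', hR, hr⟩ := h
  ⟨m', hQ m' (hr.agree m' (by simp)) hR, hr⟩

theorem skip (h : Q m) : Det Z .skip m Q :=
  ⟨m, h, RunsB.of_step fun K => by simp [step, PMF.pure_map]⟩

theorem nset {a : ℕ} {i j l e : NExpr} (h : Q (m.setNat a i j l (e.eval m))) :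
    Det Z (.nset a i j l e) m Q :=
  ⟨_, h, RunsB.of_step fun K => by simp [step, PMF.pure_map]⟩

theorem rset {a : ℕ} {i j l : NExpr} {e : RExpr} (h : Q (m.setReal a i j l (e.eval m))) :
    Det Z (.rset a i j l e) m Q :=
  ⟨_, h, RunsB.of_step fun K => by simp [step, PMF.pure_map]⟩

theorem seq (h : Det Z c m R)
    (h' : ∀ m', Agree c.natWrites c.realWrites m m' → R m' → Det Z d m' Q) :
    Det Z (.seq c d) m Q := by
  obtain ⟨m', hR, hr⟩ := h
  obtain ⟨m'', hQ, hr'⟩ := h' m' (hr.agree m' (by simp)) hR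
  refine ⟨m'', hQ, ?_⟩
  have := RunsB.seq (κ := fun _ => PMF.pure m'') hr (fun x hx => by
    simp at hx; subst hx; exact hr')
  simpa [Cmd.cost] using this

theorem nset_seq {a : ℕ} {i j l e : NExpr} (h : Det Z c (m.setNat a i j l (e.eval m)) Q) :
    Det Z (.seq (.nset a i j l e) c) m Q :=
  seq (R := fun m' => m' = m.setNat a i j l (e.eval m)) (nset rfl) fun _ _ h' => h' ▸ h

theorem rset_seq {a : ℕ} {i j l : NExpr} {e : RExpr}
    (h : Det Z c (m.setReal a i j l (e.eval m)) Q) :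
    Det Z (.seq (.rset a i j l e) c) m Q :=
  seq (R := fun m' => m' = m.setReal a i j l (e.eval m)) (rset rfl) fun _ _ h' => h' ▸ h

theorem ite {b : Test} (h : b.eval m → Det Z c m Q) (h' : ¬ b.eval m → Det Z d m Q) :
    Det Z (.ite b c d) m Q := by
  by_cases hb : b.eval m
  · obtain ⟨m', hQ, hr⟩ := h hb
    refine ⟨m', hQ, RunsB.mono (RunsB.of_step_goto (fun K => by simp [step, hb]) hr) ?_⟩
    simp only [Cmd.cost]; omega
  · obtain ⟨m', hQ, hr⟩ := h' hb
    refine ⟨m', hQ, RunsB.mono (RunsB.of_step_goto (fun K => by simp [step, hb]) hr) ?_⟩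
    simp only [Cmd.cost]; omega

/-- The rule for a loop with exactly `N` iterations; `Inv i` holds after `i` of them. -/
theorem loop {b : Test} {N : ℕ} (hN : N ≤ Z) (Inv : ℕ → Mem → Prop) (h0 : Inv 0 m)
    (hstep : ∀ i < N, ∀ m', Agree c.natWrites c.realWrites m m' → Inv i m' →
      b.eval m' ∧ Det Z c m' (Inv (i + 1)))
    (hend : ∀ m', Agree c.natWrites c.realWrites m m' → Inv N m' → ¬ b.eval m' ∧ Q m') :
    Det Z (.loop b c) m Q := by
  have key : ∀ s ≤ N, ∀ m', Agree c.natWrites c.realWrites m m' → Inv (N - s) m' →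
      ∃ m'', Q m'' ∧ RunsB (1 + s * (1 + c.cost Z)) (.loop b c) m' (PMF.pure m'') := by
    intro s
    induction s with
    | zero =>
      intro _ m' ha hi
      obtain ⟨h1, h2⟩ := hend m' ha hi
      exact ⟨m', h2, by simpa using RunsB.loop_false h1⟩
    | succ s ih =>
      intro hs m' ha hi
      obtain ⟨h1, m₁, h2, h3⟩ := hstep (N - (s + 1)) (by omega) m' ha hi
      rw [show N - (s + 1) + 1 = N - s by omega] at h2
      obtain ⟨m'', hQ, h4⟩ := ih (by omega) m₁ (ha.trans (h3.agree m₁ (by simp))) h2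
      refine ⟨m'', hQ, ?_⟩
      have := RunsB.loop_true (κ := fun _ => PMF.pure m'') h1 h3 (fun x hx => by
        simp at hx; subst hx; exact h4)
      rw [PMF.pure_bind] at this
      exact this.mono (by ring_nf; omega)
  obtain ⟨m'', hQ, h⟩ := key N le_rfl m (Agree.refl _ _ _) (by simpa using h0)
  exact ⟨m'', hQ, h.mono (by simp only [Cmd.cost]; gcongr)⟩

end Det

/-- The scalar variable stored in the array `a` of naturals. -/
abbrev nv (a : ℕ) : NExpr := .get a (.const 0) (.const 0) (.const 0)

/-- The scalar variable stored in the array `a` of reals. -/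
abbrev rv (a : ℕ) : RExpr := .get a (.const 0) (.const 0) (.const 0)

/-- Assignment to a scalar variable. -/
abbrev nassign (a : ℕ) (e : NExpr) : Cmd := .nset a (.const 0) (.const 0) (.const 0) e

/-- Assignment to a scalar variable. -/
abbrev rassign (a : ℕ) (e : RExpr) : Cmd := .rset a (.const 0) (.const 0) (.const 0) e

/-- `for a = 0, …, e - 1 do c`. -/
def forUp (a : ℕ) (e : NExpr) (c : Cmd) : Cmd :=
  .seq (nassign a (.const 0))
    (.loop (.nlt (nv a) e) (.seq c (nassign a (.add (nv a) (.const 1)))))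

/-- Setting a scalar variable. -/
def Mem.setVar (m : Mem) (a v : ℕ) : Mem := m.setNat a (.const 0) (.const 0) (.const 0) v

theorem setVar_nat_of_ne {m : Mem} {a a' : ℕ} (v : ℕ) (h : a' ≠ a) :
    (m.setVar a v).nat a' = m.nat a' := setNat_nat_of_ne _ _ _ _ h

@[simp] theorem setVar_nat_self (m : Mem) (a v : ℕ) : (m.setVar a v).nat a 0 0 0 = v := by
  simp [Mem.setVar, setNat_nat_self, NExpr.eval]

@[simp] theorem setVar_real (m : Mem) (a v : ℕ) : (m.setVar a v).real = m.real := rfl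

/-- The rule for counting loops.  The body has access to the fact that only the arrays it writes
have changed since the loop was entered. -/
theorem Det.forUp {Z a N : ℕ} {e : NExpr} {c : Cmd} {m : Mem} {Q : Mem → Prop}
    (Inv : ℕ → Mem → Prop) (hN : N ≤ Z) (hac : a ∉ c.natWrites)
    (he : ∀ m', Agree (a :: c.natWrites) c.realWrites m m' → e.eval m' = N)
    (h0 : Inv 0 (m.setVar a 0))
    (hbody : ∀ i < N, ∀ m', Agree (a :: c.natWrites) c.realWrites m m' → m'.nat a 0 0 0 = i →
      Inv i m' → Det Z c m' fun m'' => Inv (i + 1) (m''.setVar a (i + 1)))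
    (hQ : ∀ m', Agree (a :: c.natWrites) c.realWrites m m' → Inv N m' → Q m') :
    Det Z (_root_.forUp a e c) m Q := by
  refine Det.nset_seq ?_
  have hag : ∀ m', Agree ((Cmd.seq c (nassign a ((nv a).add (NExpr.const 1)))).natWrites)
      (Cmd.seq c (nassign a ((nv a).add (NExpr.const 1)))).realWrites (m.setVar a 0) m' →
      Agree (a :: c.natWrites) c.realWrites m m' := by
    intro m' h
    refine Agree.trans (agree_setNat (W := a :: c.natWrites) m a (.const 0) (.const 0) (.const 0) 0
      (by simp)) (h.mono ?_ ?_)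
    · intro x; simp [Cmd.natWrites]; tauto
    · simp [Cmd.realWrites]
  refine Det.loop hN (fun i m' => m'.nat a 0 0 0 = i ∧ Inv i m') ⟨?_, h0⟩ ?_ ?_
  · exact setVar_nat_self m a 0
  · intro i hi m' ha ⟨h1, h2⟩
    have ha' := hag m' ha
    refine ⟨by simpa [Test.eval, NExpr.eval, h1, he m' ha'] using hi, ?_⟩
    refine Det.seq (hbody i hi m' ha' h1 h2) fun m'' ha'' h3 => Det.nset ?_
    have h4 : m''.nat a 0 0 0 = i := by rw [ha''.nat a hac, h1]
    have h5 : m''.setNat a (.const 0) (.const 0) (.const 0)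
        (((nv a).add (NExpr.const 1)).eval m'') = m''.setVar a (i + 1) := by
      simp [Mem.setVar, NExpr.eval, h4]
    rw [h5]
    exact ⟨by simp, h3⟩
  · intro m' ha ⟨h1, h2⟩
    have ha' := hag m' ha
    exact ⟨by simp [Test.eval, NExpr.eval, h1, he m' ha'], hQ m' ha' h2⟩

/-! ### Fractional multiple-choice knapsack -/

section Knapsack

variable {α ι : Type}

/-- `b` is a best item of `J` for the reduced value `v - lam * c`; among the items of maximal
reduced value it minimizes `σ * c` (so it is a cheapest one for `σ = 1`, a most expensive one for
`σ = -1`). -/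
structure IsBest (σ : ℝ) (v c : ι → ℝ) (J : Finset ι) (lam : ℝ) (b : ι) : Prop where
  mem : b ∈ J
  le : ∀ j ∈ J, v j - lam * c j < v b - lam * c b ∨
    (v j - lam * c j = v b - lam * c b ∧ σ * c b ≤ σ * c j)

theorem IsBest.value_le {σ : ℝ} {v c : ι → ℝ} {J : Finset ι} {lam : ℝ} {b : ι}
    (h : IsBest σ v c J lam b) {j : ι} (hj : j ∈ J) : v j - lam * c j ≤ v b - lam * c b := by
  rcases h.le j hj with h | h
  · exact h.le
  · exact h.1.le

theorem exists_isBest (σ : ℝ) (v c : ι → ℝ) {J : Finset ι} (hJ : J.Nonempty) (lam : ℝ) :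
    ∃ b, IsBest σ v c J lam b := by
  obtain ⟨b, hb, h⟩ := J.exists_max_image (fun j => toLex (v j - lam * c j, -(σ * c j))) hJ
  refine ⟨b, hb, fun j hj => ?_⟩
  have := h j hj
  rw [Prod.Lex.le_iff] at this
  simpa using this

/-- If `b` is best and `j` has maximal reduced value, then `b` is at least as good as `j` in the
second criterion. -/
theorem IsBest.tie {σ : ℝ} {v c : ι → ℝ} {J : Finset ι} {lam : ℝ} {b j : ι}
    (h : IsBest σ v c J lam b) (hj : j ∈ J)
    (hm : v b - lam * c b ≤ v j - lam * c j) : σ * c b ≤ σ * c j := by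
  rcases h.le j hj with h' | h'
  · exact absurd hm (not_le.2 h')
  · exact h'.2

variable [Fintype α] (v c : α → ι → ℝ) (J : Finset ι) (k : ℝ)

/-- With multiplier `lam` the cheapest optimal choice of items respects the budget `k`. -/
def WithinBudget (lam : ℝ) : Prop :=
  ∃ b : α → ι, (∀ i, IsBest 1 (v i) (c i) J lam (b i)) ∧ ∑ i, c i (b i) ≤ k

variable {v c J k}

theorem WithinBudget.of_isBest {lam : ℝ} (h : WithinBudget v c J k lam) {b : α → ι}
    (hb : ∀ i, IsBest 1 (v i) (c i) J lam (b i)) : ∑ i, c i (b i) ≤ k := by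
  obtain ⟨b', hb', hk⟩ := h
  refine le_trans (Finset.sum_le_sum fun i _ => ?_) hk
  have := (hb i).tie (hb' i).mem ((hb' i).value_le (hb i).mem)
  linarith

/-- At the smallest multiplier (among `0`, and the crossing points of the reduced values of two
items of an arm) which respects the budget, the most expensive optimal choice exhausts the budget,
because no two reduced values cross between this multiplier and the previous one. -/
theorem le_sum_of_minimal {z : ι} (hz : z ∈ J) [Nonempty α] {la : ℝ} (hla : 0 < la)
    (hmin : ∀ i, ∀ a ∈ J, ∀ b ∈ J, 0 ≤ (v i a - v i b) / (c i a - c i b) →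
      WithinBudget v c J k ((v i a - v i b) / (c i a - c i b)) →
        la ≤ (v i a - v i b) / (c i a - c i b))
    {hi : α → ι} (hhi : ∀ i, IsBest (-1) (v i) (c i) J la (hi i)) : k ≤ ∑ i, c i (hi i) := by
  classical
  set f : α × ι × ι → ℝ := fun p => (v p.1 p.2.1 - v p.1 p.2.2) / (c p.1 p.2.1 - c p.1 p.2.2)
  set S : Finset ℝ := ((Finset.univ ×ˢ J ×ˢ J).image f).filter fun x => 0 ≤ x ∧ x < la with hS
  have hmemS : ∀ i, ∀ a ∈ J, ∀ b ∈ J, 0 ≤ f (i, a, b) → f (i, a, b) < la → f (i, a, b) ∈ S := by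
    intro i a ha b hb h1 h2
    rw [hS, Finset.mem_filter]
    exact ⟨Finset.mem_image_of_mem _ (by simp [ha, hb]), h1, h2⟩
  have h0 : (0 : ℝ) ∈ S := by
    have := hmemS (Classical.arbitrary α) z hz z hz
    simpa [f, hla] using this
  obtain ⟨la', hla'S, hmax⟩ := S.exists_max_image id ⟨0, h0⟩
  have hla' := hla'S
  rw [hS, Finset.mem_filter, Finset.mem_image] at hla'
  obtain ⟨⟨⟨i₀, a₀, b₀⟩, hp, hf⟩, h0', hlt⟩ := hla'
  have hnot : ¬ WithinBudget v c J k la' := by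
    intro h
    simp only [Finset.mem_product, Finset.mem_univ, true_and] at hp
    have := hmin i₀ a₀ hp.1 b₀ hp.2
    rw [show (v i₀ a₀ - v i₀ b₀) / (c i₀ a₀ - c i₀ b₀) = la' from hf] at this
    linarith [this h0' h]
  choose mid hmid using fun i => exists_isBest 1 (v i) (c i) ⟨z, hz⟩ ((la' + la) / 2)
  choose lo hlo using fun i => exists_isBest 1 (v i) (c i) ⟨z, hz⟩ la'
  have hk : k < ∑ i, c i (lo i) := by
    by_contra hle
    exact hnot ⟨lo, hlo, not_lt.1 hle⟩
  refine hk.le.trans (Finset.sum_le_sum fun i _ => ?_)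
  have hmJ := (hmid i).mem
  -- A crossing strictly between `la'` and `la` contradicts the maximality of `la'`.
  have hno : ∀ j ∈ J, ¬ (la' < f (i, j, mid i) ∧ f (i, j, mid i) < la) := by
    rintro j hj ⟨h1, h2⟩
    have := hmax _ (hmemS i j hj _ hmJ (by linarith) h2)
    simp only [id] at this
    linarith
  have hat : ∀ j ∈ J, v i j - la' * c i j ≤ v i (mid i) - la' * c i (mid i) := by
    intro j hj
    by_contra hlt'
    have h1 := (hmid i).value_le hj
    have hd : 0 < c i j - c i (mid i) := by nlinarith
    refine hno j hj ⟨?_, ?_⟩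
    · simp only [f]; rw [lt_div_iff₀ hd]; linarith
    · simp only [f]; rw [div_lt_iff₀ hd]; nlinarith
  have hat' : ∀ j ∈ J, v i j - la * c i j ≤ v i (mid i) - la * c i (mid i) := by
    intro j hj
    by_contra hlt'
    have h1 := (hmid i).value_le hj
    have hd : c i j - c i (mid i) < 0 := by nlinarith
    refine hno j hj ⟨?_, ?_⟩
    · simp only [f]; rw [lt_div_iff_of_neg hd]; nlinarith
    · simp only [f]; rw [div_lt_iff_of_neg hd]; linarith
  have h1 := (hlo i).tie hmJ (hat _ (hlo i).mem)
  have h2 := (hhi i).tie hmJ (hat' _ (hhi i).mem)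
  linarith

end Knapsack

/-- The weight of the expensive choice for which a mixture of a cheap choice of cost `s` and an
expensive choice of cost `t` has cost `k`. -/
def mixWeight (k s t : ℝ) : ℝ := max 0 (min 1 ((k - s) / (t - s)))

theorem mixWeight_nonneg (k s t : ℝ) : 0 ≤ mixWeight k s t := le_max_left _ _

theorem mixWeight_le_one (k s t : ℝ) : mixWeight k s t ≤ 1 := by simp [mixWeight]

theorem mix_le {k s t : ℝ} (hs : s ≤ k) (hst : s ≤ t) :
    (1 - mixWeight k s t) * s + mixWeight k s t * t ≤ k := by
  rcases hst.eq_or_lt with rfl | h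
  · linarith
  · have h0 : 0 ≤ (k - s) / (t - s) := div_nonneg (by linarith) (by linarith)
    have hle : mixWeight k s t ≤ (k - s) / (t - s) := by
      rw [mixWeight, max_eq_right (le_min zero_le_one h0)]; exact min_le_right _ _
    have : mixWeight k s t * (t - s) ≤ k - s := by
      rwa [le_div_iff₀ (by linarith)] at hle
    linarith

theorem mix_eq {k s t : ℝ} (hs : s ≤ k) (ht : k ≤ t) :
    (1 - mixWeight k s t) * s + mixWeight k s t * t = k := by
  rcases (hs.trans ht).eq_or_lt with rfl | h
  · linarith
  · have h0 : 0 ≤ (k - s) / (t - s) := div_nonneg (by linarith) (by linarith)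
    have h1 : (k - s) / (t - s) ≤ 1 := by rw [div_le_one (by linarith)]; linarith
    have : mixWeight k s t = (k - s) / (t - s) := by
      rw [mixWeight, min_eq_right h1, max_eq_right h0]
    rw [this]
    field_simp [show t - s ≠ 0 by linarith]
    ring

/-! ### The linear program as a knapsack problem -/

/-- The recurrent interval encoded by a pair of naturals: `(u, j)` with `u ≠ 0` stands for
`I(u, -(j + 1))`, and `(0, j)` stands for the arm that is never played. -/
def toInterval (p : ℕ × ℕ) : Option (ℤ × ℤ) :=
  if p.1 = 0 then none else some ((p.1 : ℤ), -((p.2 : ℤ) + 1))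

/-- The fraction of rounds of the encoded interval in which the arm is played. -/
def playRate (p : ℕ × ℕ) : ℝ := if p.1 = 0 then 0 else ((p.2 : ℝ) + 1) / (p.1 + p.2 + 1)

theorem playRate_nonneg (p : ℕ × ℕ) : 0 ≤ playRate p := by
  unfold playRate; split_ifs <;> positivity

namespace MLSD

variable {n k : ℕ} (M : MLSD n k)

/-- The payoff per round of the encoded interval. -/
def density (i : Fin n) (p : ℕ × ℕ) : ℝ :=
  if p.1 = 0 then 0 else M.aggregated i p.1 (-((p.2 : ℤ) + 1)) / (p.1 + p.2 + 1)

/-- The codes of the intervals of the linear program, and of the arm that is never played. -/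
def items (L : ℕ) : Finset (ℕ × ℕ) := Finset.range (M.τmax.toNat + 1) ×ˢ Finset.range L

theorem mem_items {L : ℕ} {p : ℕ × ℕ} : p ∈ M.items L ↔ p.1 < M.τmax.toNat + 1 ∧ p.2 < L := by
  simp [items]

theorem toInterval_mem_box {L : ℕ} {p : ℕ × ℕ} (hp : p ∈ M.items L) {I : ℤ × ℤ}
    (h : toInterval p = some I) : I ∈ M.box (-L) := by
  rw [mem_items] at hp
  have := M.τmax_pos
  simp only [toInterval] at h
  split_ifs at h with h0
  simp only [Option.some.injEq] at h
  subst h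
  simp only [box, Finset.mem_product, Finset.mem_Icc]
  omega

theorem exists_item {L : ℕ} {I : ℤ × ℤ} (h : I ∈ M.box (-L)) :
    ∃ p ∈ M.items L, toInterval p = some I ∧ p.1 ≠ 0 ∧ (p.1 : ℤ) = I.1 ∧ (p.2 : ℤ) + 1 = -I.2 := by
  simp only [box, Finset.mem_product, Finset.mem_Icc] at h
  refine ⟨(I.1.toNat, (-I.2 - 1).toNat), ?_, ?_, ?_, ?_, ?_⟩
  · rw [mem_items]; simp only; omega
  · simp only [toInterval]
    rw [if_neg (by omega)]
    congr 1
    ext <;> simp only <;> omega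
  · simp only; omega
  · simp only; omega
  · simp only; omega

theorem aggregated_le (i : Fin n) {u l : ℤ} (hu : 1 ≤ u) (hl : l ≤ -1) :
    M.aggregated i u l ≤ -l := by
  have h1 : ∑ τ ∈ Finset.Icc (l + 1) (-1), M.payoff i τ ≤ ∑ τ ∈ Finset.Icc (l + 1) (-1), 1 :=
    Finset.sum_le_sum fun τ hτ => M.payoff_le_one i τ (by simp at hτ; omega)
  have h2 : (((-1 + 1 - (l + 1)).toNat : ℤ) : ℝ) = -l - 1 := by
    rw [Int.toNat_of_nonneg (by omega)]; push_cast; ring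
  simp only [Finset.sum_const, Int.card_Icc, nsmul_eq_mul, mul_one] at h1
  rw [← Int.cast_natCast, h2] at h1
  have := M.payoff_le_one i u (by omega)
  simp only [aggregated]
  linarith

theorem density_le_playRate (i : Fin n) (p : ℕ × ℕ) : M.density i p ≤ playRate p := by
  unfold density playRate
  split_ifs with h
  · exact le_rfl
  · have := M.aggregated_le i (u := p.1) (l := -((p.2 : ℤ) + 1)) (by omega) (by omega)
    push_cast at this
    gcongr
    linarith

/-- The solution of the linear program in which arm `i` follows the interval encoded by `lo i` with
probability `1 - θ` and the one encoded by `hi i` with probability `θ`. -/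
def mixture (θ : ℝ) (lo hi : Fin n → ℕ × ℕ) (i : Fin n) (I : ℤ × ℤ) : ℝ :=
  ((1 - θ) * (if toInterval (lo i) = some I then 1 else 0)
    + θ * (if toInterval (hi i) = some I then 1 else 0)) / ((I.1 : ℝ) - I.2)

/-- The value of a linear functional `w` on the unit mass of the encoded interval. -/
def perRound (w : ℤ × ℤ → ℝ) (p : ℕ × ℕ) : ℝ :=
  (toInterval p).elim 0 fun I => w I / ((I.1 : ℝ) - I.2)

variable {M} in
theorem sum_mixture {L : ℕ} {θ : ℝ} {lo hi : Fin n → ℕ × ℕ} (hlo : ∀ i, lo i ∈ M.items L)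
    (hhi : ∀ i, hi i ∈ M.items L) (w : ℤ × ℤ → ℝ) (i : Fin n) :
    ∑ I ∈ M.box (-L), w I * mixture θ lo hi i I
      = (1 - θ) * perRound w (lo i) + θ * perRound w (hi i) := by
  have key : ∀ p ∈ M.items L, ∑ I ∈ M.box (-L),
      w I / ((I.1 : ℝ) - I.2) * (if toInterval p = some I then 1 else 0) = perRound w p := by
    intro p hp
    unfold perRound
    cases h : toInterval p with
    | none => simp
    | some I₀ =>
      simp only [Option.some.injEq, mul_ite, mul_one, mul_zero, Option.elim]
      rw [Finset.sum_ite_eq, if_pos (M.toInterval_mem_box hp h)]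
  rw [← key _ (hlo i), ← key _ (hhi i), Finset.mul_sum, Finset.mul_sum, ← Finset.sum_add_distrib]
  refine Finset.sum_congr rfl fun I _ => ?_
  unfold mixture
  ring

theorem perRound_aggregated (i : Fin n) (p : ℕ × ℕ) :
    perRound (fun I => M.aggregated i I.1 I.2) p = M.density i p := by
  unfold perRound toInterval density
  split_ifs with h
  · rfl
  · simp only [Option.elim]; congr 1; push_cast; ring

theorem perRound_plays (p : ℕ × ℕ) : perRound (fun I => -(I.2 : ℝ)) p = playRate p := by
  unfold perRound toInterval playRate
  split_ifs with h
  · rfl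
  · simp only [Option.elim]; push_cast; congr 1 <;> ring

theorem perRound_length (p : ℕ × ℕ) :
    perRound (fun I => (I.1 : ℝ) - I.2) p = if toInterval p = none then 0 else 1 := by
  unfold perRound
  cases h : toInterval p with
  | none => simp
  | some I =>
    simp only [toInterval] at h
    split_ifs at h with h0
    simp only [Option.some.injEq] at h
    subst h
    simp only [Option.elim, reduceCtorEq, if_false]
    refine div_self ?_
    push_cast
    rw [sub_neg_eq_add]
    positivity

/-- Weak duality for the linear program. -/
theorem objective_le_dual {L : ℕ} {lam : ℝ} {g : Fin n → ℝ} (hlam : 0 ≤ lam) (hg : ∀ i, 0 ≤ g i)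
    (hdual : ∀ i, ∀ I ∈ M.box (-L),
      M.aggregated i I.1 I.2 ≤ lam * -(I.2 : ℝ) + g i * ((I.1 : ℝ) - I.2))
    {y : Fin n → ℤ × ℤ → ℝ} (hy : M.IsFeasible (-L) y) :
    M.objective (-L) y ≤ k * lam + ∑ i, g i := by
  calc M.objective (-L) y
      ≤ ∑ i, ∑ I ∈ M.box (-L), (lam * -(I.2 : ℝ) + g i * ((I.1 : ℝ) - I.2)) * y i I :=
        Finset.sum_le_sum fun i _ => Finset.sum_le_sum fun I hI =>
          mul_le_mul_of_nonneg_right (hdual i I hI) (hy.nonneg i I hI)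
    _ = lam * ∑ i, ∑ I ∈ M.box (-L), -(I.2 : ℝ) * y i I
          + ∑ i, g i * ∑ I ∈ M.box (-L), ((I.1 : ℝ) - I.2) * y i I := by
        simp only [Finset.mul_sum, ← Finset.sum_add_distrib]
        refine Finset.sum_congr rfl fun i _ => Finset.sum_congr rfl fun I _ => by ring
    _ ≤ lam * k + ∑ i, g i * 1 := by
        gcongr with i
        · exact hy.plays
        · exact hg i
        · exact hy.arm i
    _ = k * lam + ∑ i, g i := by simp [mul_comm]

/-- The multiplier `lam` together with the choices `lo` and `hi` of items solves the knapsack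
problem: `lo` and `hi` maximize the reduced density, and the budget `k` lies between the numbers of
plays per round of `lo` and `hi` (only the former is required if `lam = 0`). -/
structure IsCritical (L : ℕ) (lam : ℝ) (lo hi : Fin n → ℕ × ℕ) : Prop where
  nonneg : 0 ≤ lam
  lo_best : ∀ i, IsBest 1 (M.density i) playRate (M.items L) lam (lo i)
  hi_best : ∀ i, IsBest (-1) (M.density i) playRate (M.items L) lam (hi i)
  lo_le : ∑ i, playRate (lo i) ≤ k
  le_hi : 0 < lam → (k : ℝ) ≤ ∑ i, playRate (hi i)

/-- The mixing weight for which the mixture of `lo` and `hi` exhausts the budget. -/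
def criticalWeight (k : ℕ) (lo hi : Fin n → ℕ × ℕ) : ℝ :=
  mixWeight k (∑ i, playRate (lo i)) (∑ i, playRate (hi i))

variable {M} {L : ℕ} {lam : ℝ} {lo hi : Fin n → ℕ × ℕ}

/-- The multiplier and the reduced densities of the best items form a dual solution of the linear
program. -/
theorem IsCritical.dual_feasible (h : M.IsCritical L lam lo hi) (i : Fin n) {I : ℤ × ℤ}
    (hI : I ∈ M.box (-L)) : M.aggregated i I.1 I.2 ≤ lam * -(I.2 : ℝ)
      + (M.density i (lo i) - lam * playRate (lo i)) * ((I.1 : ℝ) - I.2) := by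
  obtain ⟨p, hp, hpI, h0, h1, h2⟩ := M.exists_item hI
  have := (h.lo_best i).value_le hp
  set g := M.density i (lo i) - lam * playRate (lo i)
  simp only [density, playRate, if_neg h0] at this
  have e1 : (I.1 : ℝ) = p.1 := by rw [← h1]; simp
  have e2 : -(I.2 : ℝ) = (p.2 : ℝ) + 1 := by
    have : ((-I.2 : ℤ) : ℝ) = (((p.2 : ℤ) + 1 : ℤ) : ℝ) := by rw [h2]
    push_cast at this; exact this
  have e3 : (I.1 : ℝ) - I.2 = p.1 + p.2 + 1 := by linarith
  have hpos : (0 : ℝ) < p.1 + p.2 + 1 := by positivity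
  rw [h1, h2, neg_neg, sub_le_iff_le_add, ← mul_div_assoc, ← sub_le_iff_le_add, ← sub_div,
    div_le_iff₀ hpos] at this
  rw [e2, e3]
  linarith

theorem IsCritical.dual_nonneg (h : M.IsCritical L lam lo hi) (hL : 1 ≤ L) (i : Fin n) :
    0 ≤ M.density i (lo i) - lam * playRate (lo i) := by
  have := (h.lo_best i).value_le (j := (0, 0)) (by rw [mem_items]; simp; omega)
  simpa [density, playRate] using this

theorem IsCritical.sum_rate_le (h : M.IsCritical L lam lo hi) :
    ∑ i, playRate (lo i) ≤ ∑ i, playRate (hi i) :=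
  Finset.sum_le_sum fun i _ => by
    have := (h.lo_best i).tie (h.hi_best i).mem ((h.hi_best i).value_le (h.lo_best i).mem)
    linarith

theorem IsCritical.isFeasible (h : M.IsCritical L lam lo hi) :
    M.IsFeasible (-L) (mixture (criticalWeight k lo hi) lo hi) := by
  have h0 := mixWeight_nonneg k (∑ i, playRate (lo i)) (∑ i, playRate (hi i))
  have h1 := mixWeight_le_one k (∑ i, playRate (lo i)) (∑ i, playRate (hi i))
  have hl := fun i => (h.lo_best i).mem
  have hh := fun i => (h.hi_best i).mem
  refine ⟨?_, ?_, ?_⟩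
  · intro i I hI
    simp only [box, Finset.mem_product, Finset.mem_Icc] at hI
    have h3 : (0 : ℝ) ≤ (I.1 : ℝ) - I.2 := by
      have : I.2 ≤ I.1 := by omega
      exact sub_nonneg.2 (by exact_mod_cast this)
    unfold mixture criticalWeight
    refine div_nonneg (add_nonneg (mul_nonneg (by linarith) ?_) (mul_nonneg h0 ?_)) h3 <;>
      split_ifs <;> norm_num
  · rw [Finset.sum_congr rfl fun i _ => sum_mixture hl hh (fun I => -(I.2 : ℝ)) i]
    simp only [perRound_plays, Finset.sum_add_distrib, ← Finset.mul_sum]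
    exact mix_le h.lo_le h.sum_rate_le
  · intro i
    rw [sum_mixture hl hh (fun I => (I.1 : ℝ) - I.2) i]
    simp only [perRound_length]
    unfold criticalWeight
    split_ifs <;> linarith

/-- The mixture attains the dual bound: if `lam = 0` the budget constraint is not charged, and
otherwise the mixture exhausts the budget. -/
theorem IsCritical.objective_eq (h : M.IsCritical L lam lo hi) :
    M.objective (-L) (mixture (criticalWeight k lo hi) lo hi)
      = k * lam + ∑ i, (M.density i (lo i) - lam * playRate (lo i)) := by
  have hl := fun i => (h.lo_best i).mem
  have hh := fun i => (h.hi_best i).mem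
  have heq : ∀ i, M.density i (hi i) - lam * playRate (hi i)
      = M.density i (lo i) - lam * playRate (lo i) := fun i =>
    le_antisymm ((h.lo_best i).value_le (hh i)) ((h.hi_best i).value_le (hl i))
  unfold objective
  rw [Finset.sum_congr rfl fun i _ => sum_mixture hl hh (fun I => M.aggregated i I.1 I.2) i]
  simp only [perRound_aggregated]
  set θ := criticalWeight k lo hi with hθ
  have hcost : lam * ((1 - θ) * ∑ i, playRate (lo i) + θ * ∑ i, playRate (hi i)) = lam * k := by
    rcases h.nonneg.eq_or_lt with h0 | h0
    · simp [← h0]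
    · rw [hθ, criticalWeight, mix_eq h.lo_le (h.le_hi h0)]
  calc ∑ i, ((1 - θ) * M.density i (lo i) + θ * M.density i (hi i))
      = ∑ i, ((M.density i (lo i) - lam * playRate (lo i))
          + lam * ((1 - θ) * playRate (lo i) + θ * playRate (hi i))) :=
        Finset.sum_congr rfl fun i _ => by linear_combination θ * heq i
    _ = ∑ i, (M.density i (lo i) - lam * playRate (lo i))
          + lam * ((1 - θ) * ∑ i, playRate (lo i) + θ * ∑ i, playRate (hi i)) := by
        simp only [Finset.sum_add_distrib, Finset.mul_sum, mul_add]
    _ = _ := by rw [hcost]; ring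

theorem IsCritical.isOptimal (h : M.IsCritical L lam lo hi) (hL : 1 ≤ L) :
    M.IsOptimal (-L) (mixture (criticalWeight k lo hi) lo hi) :=
  ⟨h.isFeasible, fun _ hy => h.objective_eq ▸
    M.objective_le_dual h.nonneg (h.dual_nonneg hL) (fun i _ hI => h.dual_feasible i hI) hy⟩

variable (M)

/-- The multiplier at which the reduced densities of the items `a` and `b` of arm `i` agree. -/
def crossing (i : Fin n) (a b : ℕ × ℕ) : ℝ :=
  (M.density i a - M.density i b) / (playRate a - playRate b)

/-- `lam` is the smallest of the multipliers that respect the budget, among `1` and the nonnegative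
crossings. -/
structure IsLeastMultiplier (L : ℕ) (lam : ℝ) : Prop where
  nonneg : 0 ≤ lam
  within : WithinBudget M.density (fun _ => playRate) (M.items L) k lam
  le : ∀ i, ∀ a ∈ M.items L, ∀ b ∈ M.items L, 0 ≤ M.crossing i a b →
    WithinBudget M.density (fun _ => playRate) (M.items L) k (M.crossing i a b) →
      lam ≤ M.crossing i a b

/-- At the multiplier `1` no item is better than never playing, because payoffs are at most `1`. -/
theorem withinBudget_one (hL : 1 ≤ L) :
    WithinBudget M.density (fun _ => playRate) (M.items L) k 1 := by
  refine ⟨fun _ => (0, 0), fun i => ⟨by rw [mem_items]; simp; omega, fun j hj => ?_⟩,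
    by simp [playRate]⟩
  have h1 := M.density_le_playRate i j
  have h2 := playRate_nonneg j
  have h3 : playRate (0, 0) = 0 := by simp [playRate]
  have h4 : M.density i (0, 0) = 0 := by simp [density]
  beta_reduce
  rw [h3, h4]
  rcases h1.lt_or_eq with h | h
  · left; linarith
  · right; constructor <;> linarith

theorem IsLeastMultiplier.isCritical (hL : 1 ≤ L) (h : M.IsLeastMultiplier L lam)
    (hlo : ∀ i, IsBest 1 (M.density i) playRate (M.items L) lam (lo i))
    (hhi : ∀ i, IsBest (-1) (M.density i) playRate (M.items L) lam (hi i)) :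
    M.IsCritical L lam lo hi where
  nonneg := h.nonneg
  lo_best := hlo
  hi_best := hhi
  lo_le := h.within.of_isBest hlo
  le_hi := fun h0 => by
    have : Nonempty (Fin n) := ⟨⟨0, by have := M.k_lt; omega⟩⟩
    exact le_sum_of_minimal (z := (0, 0)) (by rw [mem_items]; simp; omega) h0 h.le hhi

theorem exists_isCritical (hL : 1 ≤ L) : ∃ lam lo hi, M.IsCritical L lam lo hi := by
  classical
  set S : Finset ℝ := (insert 1 ((Finset.univ ×ˢ M.items L ×ˢ M.items L).image
    fun p => M.crossing p.1 p.2.1 p.2.2)).filter fun x => 0 ≤ x ∧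
      WithinBudget M.density (fun _ => playRate) (M.items L) k x with hS
  have h1 : (1 : ℝ) ∈ S := by
    rw [hS, Finset.mem_filter]; exact ⟨by simp, zero_le_one, M.withinBudget_one hL⟩
  obtain ⟨lam, hlam, hmin⟩ := S.exists_min_image id ⟨1, h1⟩
  have hlam' := (Finset.mem_filter.1 hlam).2
  have hne : (M.items L).Nonempty := ⟨(0, 0), by rw [mem_items]; simp; omega⟩
  choose lo hlo using fun i => exists_isBest 1 (M.density i) playRate hne lam
  choose hi hhi using fun i => exists_isBest (-1) (M.density i) playRate hne lam
  refine ⟨lam, lo, hi, IsLeastMultiplier.isCritical M hL ⟨hlam'.1, hlam'.2, ?_⟩ hlo hhi⟩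
  intro i a ha b hb h0 hw
  refine hmin _ (Finset.mem_filter.2 ⟨?_, h0, hw⟩)
  refine Finset.mem_insert_of_mem (Finset.mem_image.2 ⟨(i, a, b), ?_, rfl⟩)
  simp [ha, hb]

end MLSD

/-! ### Tables of densities -/

/-! Scalar variables are the entries `(0, 0, 0)` of arrays. The arrays of naturals are used as
follows: `0` input, `1` the set of arms played, `2` the number `⌈1 / ε⌉`, `3` current arm, `4` to
`7` two current items, `8` to `10` arm and item being scanned, `11` and `12` best item found by a
scan, `13` to `16` cheap and expensive best items of all arms, `17` coin, `18` to `20` sampled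
item and offset of each arm, `21` position of each arm on its cycle, `22` marks of the
candidates, `23` and `24` rank and counter. The arrays of reals: `0` the number `ε`, `1` and `2`
payoffs in positive and in negative states, `3` densities, `4` rates of play, `5` sums of payoffs
in negative states, `6` multiplier being tested, `7` least multiplier found, `8` and `9` reduced
density and rate of the best item found by a scan, `10` and `11` total rates of the cheap and of
the expensive choice, `13` payoffs of the candidates, `14` and `15` rate and reduced density of
the item being scanned. -/

/-- The number of arms. -/
abbrev inN : NExpr := .get 0 (.const 0) (.const 0) (.const 0)
/-- The number of plays allowed per round. -/
abbrev inK : NExpr := .get 0 (.const 1) (.const 0) (.const 0)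
/-- The input `τmax`. -/
abbrev inTauMax : NExpr := .get 0 (.const 2) (.const 0) (.const 0)
/-- The input `-τmin`. -/
abbrev inTauMin : NExpr := .get 0 (.const 3) (.const 0) (.const 0)

/-- The payoff of arm `i` in the state `u > 0`. -/
abbrev posPayoff (i u : NExpr) : RExpr := .get 1 i u (.const 0)

/-- The payoff of arm `i` in the state `-j < 0`; the table is read at `min j (-τmin)`. -/
abbrev negPayoff (i j : NExpr) : RExpr := .get 2 i (.sub j (.sub j inTauMin)) (.const 0)

/-- The input is present in memory. -/
structure HasInput {n k : ℕ} (M : MLSD n k) (ε : ℝ) (m : Mem) : Prop where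
  nat0 : m.nat 0 = (M.input ε).nat 0
  real0 : m.real 0 = (M.input ε).real 0
  real1 : m.real 1 = (M.input ε).real 1
  real2 : m.real 2 = (M.input ε).real 2

namespace HasInput

variable {n k : ℕ} {M : MLSD n k} {ε : ℝ} {m : Mem}

theorem of_agree (h : HasInput M ε m) {m' : Mem} {W R : List ℕ} (ha : Agree W R m m')
    (hW : 0 ∉ W) (h0 : 0 ∉ R) (h1 : 1 ∉ R) (h2 : 2 ∉ R) : HasInput M ε m' :=
  ⟨(ha.nat 0 hW).trans h.nat0, (ha.real 0 h0).trans h.real0, (ha.real 1 h1).trans h.real1,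
    (ha.real 2 h2).trans h.real2⟩

theorem eval_inN (h : HasInput M ε m) : inN.eval m = n := by
  simp [NExpr.eval, h.nat0, MLSD.input]

theorem eval_inK (h : HasInput M ε m) : inK.eval m = k := by
  simp [NExpr.eval, h.nat0, MLSD.input]

theorem eval_inTauMax (h : HasInput M ε m) : inTauMax.eval m = M.τmax.toNat := by
  simp [NExpr.eval, h.nat0, MLSD.input]

theorem eval_inTauMin (h : HasInput M ε m) : inTauMin.eval m = (-M.τmin).toNat := by
  simp [NExpr.eval, h.nat0, MLSD.input]

theorem eval_eps (h : HasInput M ε m) : (rv 0).eval m = ε := by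
  simp [RExpr.eval, NExpr.eval, h.real0, MLSD.input]

theorem eval_posPayoff (h : HasInput M ε m) {ei eu : NExpr} {i : Fin n} {u : ℕ}
    (hi : ei.eval m = i) (hu : eu.eval m = u) (h1 : 1 ≤ u) (h2 : (u : ℤ) ≤ M.τmax) :
    (posPayoff ei eu).eval m = M.payoff i u := by
  simp [RExpr.eval, NExpr.eval, h.real1, MLSD.input, hi, hu, h1, h2]

theorem eval_negPayoff (h : HasInput M ε m) {ei ej : NExpr} {i : Fin n} {j : ℕ}
    (hi : ei.eval m = i) (hj : ej.eval m = j) (h1 : 1 ≤ j) :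
    (negPayoff ei ej).eval m = M.payoff i (-j) := by
  have hneg := M.τmin_neg
  have hT := h.eval_inTauMin
  simp only [RExpr.eval, NExpr.eval, h.real2, hi, hj] at hT ⊢
  rw [hT]
  obtain ⟨t, ht⟩ : ∃ t : ℕ, (t : ℤ) = -M.τmin := ⟨(-M.τmin).toNat, by omega⟩
  have ht' : (-M.τmin).toNat = t := by omega
  rw [ht']
  have hmin : j - (j - t) = min j t := by omega
  have h3 : 1 ≤ min j t := by omega
  have h4 : ((min j t : ℕ) : ℤ) ≤ -M.τmin := by omega
  rw [hmin]
  have : (M.input ε).real 2 i (min j t) 0 = M.payoff i (-((min j t : ℕ) : ℤ)) := by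
    simp only [MLSD.input, h3, h4]
    simp
  rw [this]
  rcases le_total j t with hjt | hjt
  · rw [min_eq_left hjt]
  · rw [min_eq_right hjt, ht, neg_neg]
    rcases (show M.τmin = -(j : ℤ) ∨ -(j : ℤ) < M.τmin by omega) with h5 | h5
    · rw [h5]
    · rw [M.saturation_min i _ h5]

end HasInput

/-- Computes `⌈1 / ε⌉`. -/
def ceilCmd : Cmd :=
  .seq (nassign 2 (.const 0))
    (.loop (.rlt (.cast (nv 2)) (.div (.cast (.const 1)) (rv 0)))
      (nassign 2 (.add (nv 2) (.const 1))))

/-- Computes the sums of the payoffs in the states `-1, …, -j`. -/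
def prefixCmd : Cmd :=
  forUp 3 inN (.seq (.rset 5 (nv 3) (.const 0) (.const 0) (.cast (.const 0)))
    (forUp 5 (nv 2) (.rset 5 (nv 3) (.add (nv 5) (.const 1)) (.const 0)
      (.add (.get 5 (nv 3) (nv 5) (.const 0)) (negPayoff (nv 3) (.add (nv 5) (.const 1)))))))

/-- The value `0` if `u = 0` and `1` otherwise. -/
abbrev signExpr (u : NExpr) : RExpr := .cast (.sub (.const 1) (.sub (.const 1) u))

/-- The expression `u + l + 1`. -/
abbrev lengthExpr (u l : NExpr) : RExpr := .cast (.add (.add u l) (.const 1))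

/-- Computes the tables of densities and of rates of play. -/
def tableCmd : Cmd :=
  forUp 3 inN (forUp 4 (.add inTauMax (.const 1)) (forUp 5 (nv 2)
    (.seq
      (.rset 3 (nv 3) (nv 4) (nv 5) (.div (.mul (signExpr (nv 4))
        (.add (posPayoff (nv 3) (nv 4)) (.get 5 (nv 3) (nv 5) (.const 0))))
          (lengthExpr (nv 4) (nv 5))))
      (.rset 4 (nv 3) (nv 4) (nv 5)
        (.div (.mul (signExpr (nv 4)) (.cast (.add (nv 5) (.const 1))))
          (lengthExpr (nv 4) (nv 5)))))))

section Tables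

variable {n k : ℕ} {M : MLSD n k} {ε : ℝ} {Z : ℕ} {m : Mem}

theorem det_ceilCmd (hm : HasInput M ε m) (hZ : ⌈1 / ε⌉₊ ≤ Z) :
    Det Z ceilCmd m fun m' => m'.nat 2 0 0 0 = ⌈1 / ε⌉₊ := by
  refine Det.nset_seq ?_
  refine Det.loop hZ (fun i m' => m'.nat 2 0 0 0 = i) (by simp [setNat_nat_self, NExpr.eval])
    ?_ ?_
  · intro i hi m' ha h
    have hin : HasInput M ε m' :=
      (hm.of_agree (agree_setNat (W := [2]) (R := []) _ _ _ _ _ _ (by simp)) (by simp) (by simp)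
        (by simp) (by simp)).of_agree ha (by decide) (by decide) (by decide) (by decide)
    refine ⟨?_, Det.nset ?_⟩
    · have := hin.eval_eps
      have h2 := Nat.lt_ceil.1 hi
      simp only [Test.eval, RExpr.eval, NExpr.eval, h] at this ⊢
      rw [this]
      simpa using h2
    · simp [setNat_nat_self, NExpr.eval, h]
  · intro m' ha h
    have hin : HasInput M ε m' :=
      (hm.of_agree (agree_setNat (W := [2]) (R := []) _ _ _ _ _ _ (by simp)) (by simp) (by simp)
        (by simp) (by simp)).of_agree ha (by decide) (by decide) (by decide) (by decide)
    refine ⟨?_, h⟩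
    have := hin.eval_eps
    have h2 := Nat.le_ceil (1 / ε)
    simp only [Test.eval, RExpr.eval, NExpr.eval, h] at this ⊢
    rw [this]
    simpa using h2

/-- Total payoff of arm `i` in the states `-1, …, -j`. -/
def MLSD.negSum (M : MLSD n k) (i : Fin n) (j : ℕ) : ℝ :=
  ∑ s ∈ Finset.range j, M.payoff i (-((s : ℤ) + 1))

theorem sum_Icc_neg (p : ℤ → ℝ) (j : ℕ) :
    ∑ τ ∈ Finset.Icc (-(j : ℤ)) (-1), p τ = ∑ s ∈ Finset.range j, p (-((s : ℤ) + 1)) := by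
  refine Finset.sum_nbij' (fun τ => (-τ - 1).toNat) (fun s => -((s : ℤ) + 1)) ?_ ?_ ?_ ?_ ?_
  · intro τ hτ; simp at hτ ⊢; omega
  · intro s hs; simp at hs ⊢; omega
  · intro τ hτ; simp at hτ ⊢; omega
  · intro s hs; simp
  · intro τ hτ; simp at hτ ⊢; congr 1; omega

theorem MLSD.aggregated_eq (M : MLSD n k) (i : Fin n) (u : ℤ) (j : ℕ) :
    M.aggregated i u (-((j : ℤ) + 1)) = M.payoff i u + M.negSum i j := by
  rw [MLSD.aggregated, MLSD.negSum, ← sum_Icc_neg]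
  congr 3
  ring

theorem det_prefixCmd (hm : HasInput M ε m) (hnZ : n ≤ Z) {L : ℕ} (hL : m.nat 2 0 0 0 = L)
    (hLZ : L ≤ Z) : Det Z prefixCmd m fun m' =>
      ∀ i : Fin n, ∀ j ≤ L, m'.real 5 i j 0 = M.negSum i j := by
  refine Det.forUp (N := n) (fun t m' => ∀ i : Fin n, (i : ℕ) < t → ∀ j ≤ L,
    m'.real 5 i j 0 = M.negSum i j) hnZ (by decide) ?_ ?_ ?_ ?_
  · intro m' ha
    exact (hm.of_agree ha (by decide) (by decide) (by decide) (by decide)).eval_inN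
  · intro i hi; omega
  · intro t ht m' ha hc hI
    have hin := hm.of_agree ha (by decide) (by decide) (by decide) (by decide)
    refine Det.rset_seq ?_
    refine Det.forUp (N := L) (fun s m' => (∀ i : Fin n, (i : ℕ) < t → ∀ j ≤ L,
      m'.real 5 i j 0 = M.negSum i j) ∧ ∀ j ≤ s, m'.real 5 t j 0 = M.negSum ⟨t, ht⟩ j)
      hLZ (by decide) ?_ ?_ ?_ ?_
    · intro m'' ha'
      simp only [NExpr.eval]
      rw [ha'.nat 2 (by decide), setReal_nat, ha.nat 2 (by decide), hL]
    · refine ⟨fun i hi j hj => ?_, fun j hj => ?_⟩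
      · simp only [setVar_real, setReal_real_self, NExpr.eval, hc]
        rw [if_neg (by omega)]; exact hI i hi j hj
      · obtain rfl : j = 0 := by omega
        simp [setReal_real_self, NExpr.eval, hc, RExpr.eval, MLSD.negSum]
    · intro s hs m'' ha' hc' hI'
      have hc3 : m''.nat 3 0 0 0 = t := by rw [ha'.nat 3 (by decide), setReal_nat, hc]
      have hin' : HasInput M ε m'' :=
        (hin.of_agree (agree_setReal (W := []) (R := [5]) _ _ _ _ _ _ (by simp)) (by simp) (by simp)
          (by simp) (by simp)).of_agree ha' (by decide) (by decide) (by decide) (by decide)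
      refine Det.rset ⟨fun i hi j hj => ?_, fun j hj => ?_⟩
      · simp only [setVar_real, setReal_real_self, NExpr.eval, hc3]
        rw [if_neg (by omega)]; exact hI'.1 i hi j hj
      · have hneg := hin'.eval_negPayoff (ei := nv 3) (ej := .add (nv 5) (.const 1))
          (i := ⟨t, ht⟩) (j := s + 1) (by simp [NExpr.eval, hc3]) (by simp [NExpr.eval, hc'])
          (by omega)
        simp only [setVar_real, setReal_real_self, NExpr.eval, hc3, hc', RExpr.eval] at hneg ⊢
        rw [hneg, hI'.2 s le_rfl]
        split_ifs with h
        · obtain rfl : j = s + 1 := by omega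
          simp [MLSD.negSum, Finset.sum_range_succ]
        · refine hI'.2 j ?_
          by_contra h2
          exact h ⟨by simp, by omega, trivial⟩
    · intro m'' ha' hI' i hi j hj
      rw [setVar_real]
      rcases (show (i : ℕ) < t ∨ (i : ℕ) = t by omega) with h | h
      · exact hI'.1 i h j hj
      · obtain rfl : i = ⟨t, ht⟩ := Fin.ext h
        exact hI'.2 j hj
  · intro m' ha hI i j hj
    exact hI i i.2 j hj

/-- The input, `⌈1 / ε⌉` and the two tables are present in memory. -/
structure HasTables (M : MLSD n k) (ε : ℝ) (L : ℕ) (m : Mem) : Prop where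
  input : HasInput M ε m
  ceil : m.nat 2 0 0 0 = L
  density : ∀ i : Fin n, ∀ p ∈ M.items L, m.real 3 i p.1 p.2 = M.density i p
  rate : ∀ i : Fin n, ∀ p ∈ M.items L, m.real 4 i p.1 p.2 = playRate p

theorem HasTables.of_agree {L : ℕ} (h : HasTables M ε L m) {m' : Mem} {W R : List ℕ}
    (ha : Agree W R m m') (h0 : 0 ∉ W) (h2 : 2 ∉ W) (hR : ∀ a < 5, a ∉ R) :
    HasTables M ε L m' where
  input := h.input.of_agree ha h0 (hR 0 (by simp)) (hR 1 (by simp)) (hR 2 (by simp))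
  ceil := by rw [ha.nat 2 h2, h.ceil]
  density := by rw [ha.real 3 (hR 3 (by simp))]; exact h.density
  rate := by rw [ha.real 4 (hR 4 (by simp))]; exact h.rate

theorem det_tableCmd (hm : HasInput M ε m) {L : ℕ} (hL : m.nat 2 0 0 0 = L) (hnZ : n ≤ Z)
    (hHZ : M.τmax.toNat + 1 ≤ Z) (hLZ : L ≤ Z)
    (hs : ∀ i : Fin n, ∀ j ≤ L, m.real 5 i j 0 = M.negSum i j) :
    Det Z tableCmd m fun m' => HasTables M ε L m' := by
  -- The entries written before entry `(t, s, r)`, in the order of the three loops.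
  set Done : ℕ → ℕ → ℕ → Mem → Prop := fun t s r m' => ∀ i : Fin n, ∀ p ∈ M.items L,
    ((i : ℕ) < t ∨ ((i : ℕ) = t ∧ (p.1 < s ∨ (p.1 = s ∧ p.2 < r)))) →
      m'.real 3 i p.1 p.2 = M.density i p ∧ m'.real 4 i p.1 p.2 = playRate p with hDone
  refine Det.forUp (N := n) (fun t m' => Done t 0 0 m') hnZ (by decide) ?_ ?_ ?_ ?_
  · intro m' ha
    exact (hm.of_agree ha (by decide) (by decide) (by decide) (by decide)).eval_inN
  · intro i p _ h; omega
  · intro t ht m₁ ha₁ hc₁ hI₁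
    have hin₁ := hm.of_agree ha₁ (by decide) (by decide) (by decide) (by decide)
    refine Det.forUp (N := M.τmax.toNat + 1) (fun s m' => Done t s 0 m') hHZ (by decide)
      ?_ hI₁ ?_ ?_
    · intro m' ha
      have := (hin₁.of_agree ha (by decide) (by decide) (by decide) (by decide)).eval_inTauMax
      simp only [NExpr.eval] at this ⊢
      rw [this]
    · intro s hs' m₂ ha₂ hc₂ hI₂
      have hin₂ := hin₁.of_agree ha₂ (by decide) (by decide) (by decide) (by decide)
      refine Det.forUp (N := L) (fun r m' => Done t s r m') hLZ (by decide) ?_ hI₂ ?_ ?_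
      · intro m' ha
        simp only [NExpr.eval]
        rw [ha.nat 2 (by decide), ha₂.nat 2 (by decide), ha₁.nat 2 (by decide), hL]
      · intro r hr m₃ ha₃ hc₃ hI₃
        have hin₃ := hin₂.of_agree ha₃ (by decide) (by decide) (by decide) (by decide)
        have e3 : m₃.nat 3 0 0 0 = t := by
          rw [ha₃.nat 3 (by decide), ha₂.nat 3 (by decide), hc₁]
        have e4 : m₃.nat 4 0 0 0 = s := by rw [ha₃.nat 4 (by decide), hc₂]
        have e5 : m₃.real 5 t r 0 = M.negSum ⟨t, ht⟩ r := by
          rw [ha₃.real 5 (by decide), ha₂.real 5 (by decide), ha₁.real 5 (by decide)]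
          exact hs ⟨t, ht⟩ r hr.le
        refine Det.rset_seq (Det.rset ?_)
        intro i p hp hlt
        simp only [setVar_real]
        rw [setReal_real_of_ne _ _ _ _ (by decide : (3 : ℕ) ≠ 4)]
        simp only [setReal_real_self, setReal_nat, NExpr.eval, e3, e4, hc₃]
        split_ifs with h
        · obtain ⟨h1, h2, h3⟩ := h
          obtain rfl : i = ⟨t, ht⟩ := Fin.ext h1
          obtain rfl : p = (s, r) := Prod.ext h2 h3
          simp only [RExpr.eval, NExpr.eval, e3, e4, hc₃, setReal_nat, e5]
          rcases Nat.eq_zero_or_pos s with h0 | h0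
          · simp [h0, MLSD.density, playRate]
          · have hpos := hin₃.eval_posPayoff (ei := nv 3) (eu := nv 4) (i := ⟨t, ht⟩) (u := s)
              (by simp [NExpr.eval, e3]) (by simp [NExpr.eval, e4]) h0
              (by have := M.τmax_pos; omega)
            simp only [RExpr.eval, NExpr.eval, e3, e4] at hpos
            rw [hpos]
            have h1' : 1 - (1 - s) = 1 := by omega
            simp only [MLSD.density, playRate, h0.ne', if_false, h1', M.aggregated_eq]
            push_cast
            simp
        · rw [setReal_real_of_ne _ _ _ _ (by decide : (4 : ℕ) ≠ 3)]
          refine hI₃ i p hp ?_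
          by_contra h'
          apply h
          omega
      · intro m' _ hI i p hp hlt
        have := M.mem_items.1 hp
        exact hI i p hp (by omega)
    · intro m' _ hI i p hp hlt
      have := M.mem_items.1 hp
      exact hI i p hp (by omega)
  · intro m' ha hI
    exact ⟨hm.of_agree ha (by decide) (by decide) (by decide) (by decide),
      by rw [ha.nat 2 (by decide), hL], fun i p hp => (hI i p hp (Or.inl i.2)).1,
      fun i p hp => (hI i p hp (Or.inl i.2)).2⟩

end Tables

/-! ### Search for the multiplier -/

/-- The disjunction of two tests. -/
abbrev Test.or (b c : Test) : Test := .not (.and (.not b) (.not c))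

/-- Scans the items of the arm in variable `8`, at the multiplier in variable `6`, for a best item;
the second criterion has sign `sg`. -/
def scanCmd (sg : RExpr) : Cmd :=
  .seq (nassign 11 (.const 0)) (.seq (nassign 12 (.const 0))
    (.seq (rassign 8 (.cast (.const 0))) (.seq (rassign 9 (.cast (.const 0)))
      (forUp 9 (.add inTauMax (.const 1)) (forUp 10 (nv 2)
        (.seq (rassign 14 (.get 4 (nv 8) (nv 9) (nv 10)))
        (.seq (rassign 15 (.sub (.get 3 (nv 8) (nv 9) (nv 10)) (.mul (rv 6) (rv 14))))
          (.ite (Test.or (.rlt (rv 8) (rv 15))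
              (.and (.not (.rlt (rv 15) (rv 8))) (.rlt (.mul sg (rv 14)) (.mul sg (rv 9)))))
            (.seq (nassign 11 (nv 9)) (.seq (nassign 12 (nv 10))
              (.seq (rassign 8 (rv 15)) (rassign 9 (rv 14)))))
            .skip))))))))

/-- Stores a best item for each arm in the arrays `a`, `b`, and their total rate of play in the
variable `s`. -/
def scanAllCmd (sg : RExpr) (a b s : ℕ) : Cmd :=
  .seq (rassign s (.cast (.const 0))) (forUp 8 inN (.seq (scanCmd sg)
    (.seq (.nset a (nv 8) (.const 0) (.const 0) (nv 11))
      (.seq (.nset b (nv 8) (.const 0) (.const 0) (nv 12)) (rassign s (.add (rv s) (rv 9)))))))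

/-- Stores the cheap choice of items. -/
def scanLoCmd : Cmd := scanAllCmd (.cast (.const 1)) 13 14 10

/-- Stores the expensive choice of items. -/
def scanHiCmd : Cmd := scanAllCmd (.sub (.cast (.const 0)) (.cast (.const 1))) 15 16 11

/-- Tests the crossing of two items and updates the smallest multiplier known to respect the
budget, in variable `7`. -/
def tryCmd : Cmd :=
  .seq (rassign 6 (.div (.sub (.get 3 (nv 3) (nv 4) (nv 5)) (.get 3 (nv 3) (nv 6) (nv 7)))
      (.sub (.get 4 (nv 3) (nv 4) (nv 5)) (.get 4 (nv 3) (nv 6) (nv 7)))))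
    (.seq scanLoCmd
      (.ite (.and (.and (.not (.rlt (.cast inK) (rv 10))) (.not (.rlt (rv 6) (.cast (.const 0)))))
          (.rlt (rv 6) (rv 7)))
        (rassign 7 (rv 6)) .skip))

/-- Finds the smallest multiplier that respects the budget, starting from the multiplier `1`, which
always does. -/
def searchCmd : Cmd :=
  .seq (rassign 7 (.cast (.const 1)))
    (forUp 3 inN (forUp 4 (.add inTauMax (.const 1)) (forUp 5 (nv 2)
      (forUp 6 (.add inTauMax (.const 1)) (forUp 7 (nv 2) tryCmd)))))

theorem IsBest.mono_insert {ι : Type} [DecidableEq ι] {σ lam : ℝ} {v c : ι → ℝ} {J : Finset ι}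
    {b j : ι} (h : IsBest σ v c J lam b)
    (hj : v j - lam * c j < v b - lam * c b ∨
      (v j - lam * c j = v b - lam * c b ∧ σ * c b ≤ σ * c j)) :
    IsBest σ v c (insert j J) lam b :=
  ⟨Finset.mem_insert_of_mem h.mem, fun x hx => by
    rcases Finset.mem_insert.1 hx with rfl | hx
    · exact hj
    · exact h.le x hx⟩

theorem IsBest.insert_of_better {ι : Type} [DecidableEq ι] {σ lam : ℝ} {v c : ι → ℝ}
    {J : Finset ι} {b j : ι} (h : IsBest σ v c J lam b)
    (hj : v b - lam * c b < v j - lam * c j ∨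
      (v b - lam * c b = v j - lam * c j ∧ σ * c j ≤ σ * c b)) :
    IsBest σ v c (insert j J) lam j :=
  ⟨Finset.mem_insert_self _ _, fun x hx => by
    rcases Finset.mem_insert.1 hx with rfl | hx
    · exact Or.inr ⟨rfl, le_rfl⟩
    · rcases h.le x hx with h1 | ⟨h1, h1'⟩ <;> rcases hj with h2 | ⟨h2, h2'⟩
      · left; linarith
      · left; linarith
      · left; linarith
      · right; exact ⟨by linarith, by linarith⟩⟩

section Search

variable {n k : ℕ} {M : MLSD n k} {ε : ℝ} {Z L : ℕ} {m : Mem}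

/-- The items scanned before the item `(s, r)`, together with the null item. -/
def scanned (L s r : ℕ) : Finset (ℕ × ℕ) :=
  insert (0, 0) ((Finset.range s ×ˢ Finset.range L) ∪ ({s} ×ˢ Finset.range r))

theorem scanned_succ_row (L s : ℕ) : scanned L s L = scanned L (s + 1) 0 := by
  ext ⟨a, b⟩
  simp [scanned]
  omega

theorem scanned_succ (L s r : ℕ) : scanned L s (r + 1) = insert (s, r) (scanned L s r) := by
  ext ⟨a, b⟩
  simp [scanned]
  omega

/-- The registers of the scan hold a best item of `J`. -/
structure ScanState (M : MLSD n k) (σ lam : ℝ) (i : Fin n) (J : Finset (ℕ × ℕ)) (m : Mem) :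
    Prop where
  best : IsBest σ (M.density i) playRate J lam (m.nat 11 0 0 0, m.nat 12 0 0 0)
  value : m.real 8 0 0 0 = M.density i (m.nat 11 0 0 0, m.nat 12 0 0 0)
    - lam * playRate (m.nat 11 0 0 0, m.nat 12 0 0 0)
  rate : m.real 9 0 0 0 = playRate (m.nat 11 0 0 0, m.nat 12 0 0 0)

theorem ScanState.of_eq {σ lam : ℝ} {i : Fin n} {J : Finset (ℕ × ℕ)} (h : ScanState M σ lam i J m)
    {m' : Mem} (h11 : m'.nat 11 = m.nat 11) (h12 : m'.nat 12 = m.nat 12)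
    (h8 : m'.real 8 = m.real 8) (h9 : m'.real 9 = m.real 9) : ScanState M σ lam i J m' := by
  constructor
  · rw [h11, h12]; exact h.best
  · rw [h11, h12, h8]; exact h.value
  · rw [h11, h12, h9]; exact h.rate

theorem det_scanCmd (hm : HasTables M ε L m) (hHZ : M.τmax.toNat + 1 ≤ Z) (hLZ : L ≤ Z)
    (hL : 1 ≤ L) {sg : RExpr} {σ lam : ℝ} (hsg : ∀ m, sg.eval m = σ) {i : Fin n}
    (hi : m.nat 8 0 0 0 = i) (hlam : m.real 6 0 0 0 = lam) :
    Det Z (scanCmd sg) m (ScanState M σ lam i (M.items L)) := by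
  refine Det.nset_seq (Det.nset_seq (Det.rset_seq (Det.rset_seq ?_)))
  set m₀ := ((((m.setNat 11 _ _ _ _).setNat 12 _ _ _ _).setReal 8 _ _ _ _).setReal 9 _ _ _ _)
    with hm₀
  have hag : Agree [11, 12] [8, 9] m m₀ :=
    (((agree_setNat m _ _ _ _ _ (by simp)).trans (agree_setNat _ _ _ _ _ _ (by simp))).trans
      (agree_setReal _ _ _ _ _ _ (by simp))).trans (agree_setReal _ _ _ _ _ _ (by simp))
  have hm0 := hm.of_agree hag (by decide) (by decide) (by decide)
  have z11 : m₀.nat 11 0 0 0 = 0 := by simp [hm₀, Mem.setNat, Mem.setReal, writeEntry, NExpr.eval]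
  have z12 : m₀.nat 12 0 0 0 = 0 := by simp [hm₀, Mem.setNat, Mem.setReal, writeEntry, NExpr.eval]
  have z8 : m₀.real 8 0 0 0 = 0 := by
    simp [hm₀, Mem.setNat, Mem.setReal, writeEntry, NExpr.eval, RExpr.eval]
  have z9 : m₀.real 9 0 0 0 = 0 := by
    simp [hm₀, Mem.setNat, Mem.setReal, writeEntry, NExpr.eval, RExpr.eval]
  have hi0 : m₀.nat 8 0 0 0 = i := by rw [hag.nat 8 (by decide), hi]
  have hlam0 : m₀.real 6 0 0 0 = lam := by rw [hag.real 6 (by decide), hlam]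
  clear_value m₀
  refine Det.forUp (N := M.τmax.toNat + 1)
    (fun s m' => ScanState M σ lam i (scanned L s 0) m') hHZ
    (by simp [forUp, Cmd.natWrites]) ?_ ?_ ?_ ?_
  · intro m' ha
    have := (hm0.of_agree ha (by simp [forUp, Cmd.natWrites]) (by simp [forUp, Cmd.natWrites])
      (by simp [forUp, Cmd.realWrites]; omega)).input.eval_inTauMax
    simp only [NExpr.eval] at this ⊢
    rw [this]
  · have h1 : M.density i (0, 0) = 0 := by simp [MLSD.density]
    have h2 : playRate (0, 0) = 0 := by simp [playRate]
    refine ScanState.of_eq (m := m₀) ⟨?_, ?_, ?_⟩ (setVar_nat_of_ne _ (by decide))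
      (setVar_nat_of_ne _ (by decide)) rfl rfl
    · rw [z11, z12]
      refine ⟨by simp [scanned], fun j hj => Or.inr ?_⟩
      obtain rfl : j = (0, 0) := by simpa [scanned] using hj
      exact ⟨rfl, le_rfl⟩
    · rw [z11, z12, z8, h1, h2]; ring
    · rw [z11, z12, z9, h2]
  · intro s hs m₁ ha₁ hc₁ hI₁
    have hm1 := hm0.of_agree ha₁ (by simp [forUp, Cmd.natWrites]) (by simp [forUp, Cmd.natWrites])
      (by simp [forUp, Cmd.realWrites]; omega)
    refine Det.forUp (N := L) (fun r m' => ScanState M σ lam i (scanned L s r) m') hLZ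
      (by simp [Cmd.natWrites]) ?_ ?_ ?_ ?_
    · intro m' ha
      exact (hm1.of_agree ha (by simp [Cmd.natWrites]) (by simp [Cmd.natWrites])
        (by simp [Cmd.realWrites]; omega)).ceil
    · exact hI₁.of_eq (setVar_nat_of_ne _ (by decide)) (setVar_nat_of_ne _ (by decide)) rfl rfl
    · intro r hr m₂ ha₂ hc₂ hI₂
      have hm2 := hm1.of_agree ha₂ (by simp [Cmd.natWrites]) (by simp [Cmd.natWrites])
        (by simp [Cmd.realWrites]; omega)
      have e8 : m₂.nat 8 0 0 0 = i := by
        rw [ha₂.nat 8 (by simp [Cmd.natWrites]), ha₁.nat 8 (by simp [forUp, Cmd.natWrites]), hi0]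
      have e9 : m₂.nat 9 0 0 0 = s := by rw [ha₂.nat 9 (by simp [Cmd.natWrites]), hc₁]
      have e6 : m₂.real 6 0 0 0 = lam := by
        rw [ha₂.real 6 (by simp [Cmd.realWrites]), ha₁.real 6 (by simp [forUp, Cmd.realWrites]),
          hlam0]
      have hp : (s, r) ∈ M.items L := by rw [M.mem_items]; exact ⟨hs, hr⟩
      have ed := hm2.density i _ hp
      have er := hm2.rate i _ hp
      refine Det.rset_seq (Det.rset_seq ?_)
      set m₃ := (m₂.setReal 14 _ _ _ _).setReal 15 _ _ _ _ with hm₃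
      have hag3 : Agree [] [14, 15] m₂ m₃ :=
        (agree_setReal _ _ _ _ _ _ (by simp)).trans (agree_setReal _ _ _ _ _ _ (by simp))
      have e14 : m₃.real 14 0 0 0 = playRate (s, r) := by
        simp [hm₃, Mem.setReal, writeEntry, NExpr.eval, RExpr.eval, e8, e9, hc₂, er]
      have e15 : m₃.real 15 0 0 0 = M.density i (s, r) - lam * playRate (s, r) := by
        simp [hm₃, Mem.setReal, writeEntry, NExpr.eval, RExpr.eval, e8, e9, hc₂, er, ed, e6]
      have hI₃ : ScanState M σ lam i (scanned L s r) m₃ :=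
        hI₂.of_eq (hag3.nat _ (by simp)) (hag3.nat _ (by simp)) (hag3.real _ (by simp))
          (hag3.real _ (by simp))
      have f9 : m₃.nat 9 0 0 0 = s := by rw [hag3.nat 9 (by simp), e9]
      have f10 : m₃.nat 10 0 0 0 = r := by rw [hag3.nat 10 (by simp), hc₂]
      clear_value m₃
      refine Det.ite (fun hb => ?_) (fun hb => ?_)
      · refine Det.nset_seq (Det.nset_seq (Det.rset_seq (Det.rset ?_)))
        refine ScanState.of_eq (m := ((((m₃.setNat 11 (.const 0) (.const 0) (.const 0) s).setNat 12
          (.const 0) (.const 0) (.const 0) r).setReal 8 (.const 0) (.const 0) (.const 0)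
          (M.density i (s, r) - lam * playRate (s, r))).setReal 9 (.const 0) (.const 0) (.const 0)
          (playRate (s, r)))) ⟨?_, ?_, ?_⟩ ?_ ?_ ?_ ?_
        · simp only [Mem.setNat, Mem.setReal, writeEntry, NExpr.eval]
          simp only [and_self, if_true]
          rw [scanned_succ]
          refine hI₃.best.insert_of_better ?_
          simp only [Test.eval, RExpr.eval, NExpr.eval, hsg, e14, e15, hI₃.value, hI₃.rate] at hb
          by_contra hcon
          apply hb
          push Not at hcon ⊢
          refine ⟨hcon.1, fun h => ?_⟩
          exact (hcon.2 (le_antisymm h hcon.1)).le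
        · simp [Mem.setNat, Mem.setReal, writeEntry, NExpr.eval]
        · simp [Mem.setNat, Mem.setReal, writeEntry, NExpr.eval]
        · rw [setVar_nat_of_ne _ (by decide)]
          funext x y z
          simp [Mem.setNat, Mem.setReal, writeEntry, NExpr.eval, f9]
        · rw [setVar_nat_of_ne _ (by decide)]
          funext x y z
          simp [Mem.setNat, Mem.setReal, writeEntry, NExpr.eval, f10]
        · funext x y z
          simp [Mem.setNat, Mem.setReal, writeEntry, NExpr.eval, RExpr.eval, e15]
        · funext x y z
          simp [Mem.setNat, Mem.setReal, writeEntry, NExpr.eval, RExpr.eval, e14]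
      · refine Det.skip (ScanState.of_eq (m := m₃) ⟨?_, hI₃.value, hI₃.rate⟩
          (setVar_nat_of_ne _ (by decide)) (setVar_nat_of_ne _ (by decide)) rfl rfl)
        rw [scanned_succ]
        refine hI₃.best.mono_insert ?_
        simp only [Test.eval, RExpr.eval, NExpr.eval, hsg, e14, e15, hI₃.value, hI₃.rate] at hb
        push Not at hb
        rcases hb.1.lt_or_eq with h | h
        · exact Or.inl h
        · exact Or.inr ⟨h, hb.2 h.ge⟩
    · intro m' _ hI
      rw [scanned_succ_row] at hI
      exact hI.of_eq (setVar_nat_of_ne _ (by decide)) (setVar_nat_of_ne _ (by decide)) rfl rfl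
  · intro m' _ hI
    have : scanned L (M.τmax.toNat + 1) 0 = M.items L := by
      ext ⟨a, b⟩
      simp [scanned, M.mem_items]
      omega
    rwa [this] at hI

/-- The arrays `a`, `b` hold best items of all arms, and the variable `s` their total rate. -/
structure ScanAllState (M : MLSD n k) (L : ℕ) (σ lam : ℝ) (a b s : ℕ) (m : Mem) : Prop where
  best : ∀ i : Fin n, IsBest σ (M.density i) playRate (M.items L) lam (m.nat a i 0 0, m.nat b i 0 0)
  sum : m.real s 0 0 0 = ∑ i : Fin n, playRate (m.nat a i 0 0, m.nat b i 0 0)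

theorem det_scanAllCmd (hm : HasTables M ε L m) (hnZ : n ≤ Z) (hHZ : M.τmax.toNat + 1 ≤ Z)
    (hLZ : L ≤ Z) (hL : 1 ≤ L) {sg : RExpr} {σ lam : ℝ} (hsg : ∀ m, sg.eval m = σ)
    (hlam : m.real 6 0 0 0 = lam) {a b s : ℕ} (ha12 : 12 < a) (hb12 : 12 < b) (hab : a ≠ b)
    (hs9 : 9 < s) (hs14 : s < 14) :
    Det Z (scanAllCmd sg a b s) m (ScanAllState M L σ lam a b s) := by
  refine Det.rset_seq ?_
  set m₀ := m.setReal s _ _ _ _ with hm₀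
  have hag : Agree [] [s] m m₀ := agree_setReal _ _ _ _ _ _ (by simp)
  have hm0 := hm.of_agree hag (by simp) (by simp) (by simp; omega)
  have hs0 : m₀.real s 0 0 0 = 0 := by simp [hm₀, setReal_real_self, NExpr.eval, RExpr.eval]
  have hlam0 : m₀.real 6 0 0 0 = lam := by rw [hag.real 6 (by simp; omega), hlam]
  clear_value m₀
  refine Det.forUp (N := n) (fun t m' =>
    (∀ i : Fin n, (i : ℕ) < t → IsBest σ (M.density i) playRate (M.items L) lam
      (m'.nat a i 0 0, m'.nat b i 0 0)) ∧
    m'.real s 0 0 0 = ∑ i ∈ Finset.range t, playRate (m'.nat a i 0 0, m'.nat b i 0 0)) hnZ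
    (by simp [scanCmd, forUp, Cmd.natWrites]; omega) ?_ ?_ ?_ ?_
  · intro m' h
    exact (hm0.of_agree h (by simp [scanCmd, forUp, Cmd.natWrites]; omega)
      (by simp [scanCmd, forUp, Cmd.natWrites]; omega)
      (by simp [scanCmd, forUp, Cmd.realWrites]; omega)).input.eval_inN
  · exact ⟨fun i hi => by omega, by simpa using hs0⟩
  · intro t ht m₁ ha₁ hc₁ ⟨hI₁, hI₁'⟩
    have hm1 := hm0.of_agree ha₁ (by simp [scanCmd, forUp, Cmd.natWrites]; omega)
      (by simp [scanCmd, forUp, Cmd.natWrites]; omega)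
      (by simp [scanCmd, forUp, Cmd.realWrites]; omega)
    have hlam1 : m₁.real 6 0 0 0 = lam := by
      rw [ha₁.real 6 (by simp [scanCmd, forUp, Cmd.realWrites]; omega), hlam0]
    refine Det.seq (det_scanCmd hm1 hHZ hLZ hL hsg (i := ⟨t, ht⟩) hc₁ hlam1) fun m₂ ha₂ hsc => ?_
    refine Det.nset_seq (Det.nset_seq (Det.rset ?_))
    have ea : m₂.nat a = m₁.nat a :=
      ha₂.nat a (by simp [scanCmd, forUp, Cmd.natWrites]; omega)
    have eb : m₂.nat b = m₁.nat b :=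
      ha₂.nat b (by simp [scanCmd, forUp, Cmd.natWrites]; omega)
    have e8 : m₂.nat 8 0 0 0 = t := by
      rw [ha₂.nat 8 (by simp [scanCmd, forUp, Cmd.natWrites]), hc₁]
    have es : m₂.real s = m₁.real s :=
      ha₂.real s (by simp [scanCmd, forUp, Cmd.realWrites]; omega)
    have a8 : a ≠ 8 := by omega
    have b8 : b ≠ 8 := by omega
    have a12 : ¬ 12 = a := by omega
    have a8' : ¬ 8 = a := by omega
    have b8' : ¬ 8 = b := by omega
    set m₃ := Mem.setVar _ _ _ with hm₃
    have ga : ∀ x, m₃.nat a x 0 0 = if x = t then m₂.nat 11 0 0 0 else m₁.nat a x 0 0 := by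
      intro x
      rw [hm₃, setVar_nat_of_ne _ a8]
      simp [Mem.setNat, Mem.setReal, writeEntry, NExpr.eval, e8, hab, ea]
    have gb : ∀ x, m₃.nat b x 0 0 = if x = t then m₂.nat 12 0 0 0 else m₁.nat b x 0 0 := by
      intro x
      rw [hm₃, setVar_nat_of_ne _ b8]
      simp [Mem.setNat, Mem.setReal, writeEntry, NExpr.eval, e8, hab.symm, eb, a12, a8']
    have gs : m₃.real s 0 0 0 = m₁.real s 0 0 0 + m₂.real 9 0 0 0 := by
      rw [hm₃, setVar_real]
      simp [Mem.setNat, Mem.setReal, writeEntry, NExpr.eval, RExpr.eval, es]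
    clear_value m₃
    refine ⟨fun i hi => ?_, ?_⟩
    · rw [ga, gb]
      split_ifs with h
      · obtain rfl : i = ⟨t, ht⟩ := Fin.ext h
        exact hsc.best
      · exact hI₁ i (by omega)
    · rw [Finset.sum_range_succ, gs, hI₁', ga t, gb t, if_pos rfl, if_pos rfl, hsc.rate]
      congr 1
      refine Finset.sum_congr rfl fun x hx => ?_
      have : x ≠ t := by simp at hx; omega
      rw [ga, gb, if_neg this, if_neg this]
  · intro m' _ ⟨h1, h2⟩
    exact ⟨fun i => h1 i i.2, by rw [h2, Finset.sum_range]⟩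

/-- Variable `7` holds a multiplier that respects the budget and does not exceed those of the
crossings in `D` which respect the budget. -/
structure SearchState (M : MLSD n k) (L : ℕ) (D : Fin n → ℕ × ℕ → ℕ × ℕ → Prop) (m : Mem) :
    Prop where
  nonneg : 0 ≤ m.real 7 0 0 0
  within : WithinBudget M.density (fun _ => playRate) (M.items L) k (m.real 7 0 0 0)
  le : ∀ i, ∀ a ∈ M.items L, ∀ b ∈ M.items L, D i a b → 0 ≤ M.crossing i a b →
    WithinBudget M.density (fun _ => playRate) (M.items L) k (M.crossing i a b) →
      m.real 7 0 0 0 ≤ M.crossing i a b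

theorem det_tryCmd (hm : HasTables M ε L m) (hnZ : n ≤ Z) (hHZ : M.τmax.toNat + 1 ≤ Z)
    (hLZ : L ≤ Z) (hL : 1 ≤ L) {i : Fin n} {a b : ℕ × ℕ} (ha : a ∈ M.items L) (hb : b ∈ M.items L)
    (h3 : m.nat 3 0 0 0 = i) (h4 : m.nat 4 0 0 0 = a.1) (h5 : m.nat 5 0 0 0 = a.2)
    (h6 : m.nat 6 0 0 0 = b.1) (h7 : m.nat 7 0 0 0 = b.2) {D D' : Fin n → ℕ × ℕ → ℕ × ℕ → Prop}
    (hS : SearchState M L D m)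
    (hD : ∀ i', ∀ a' ∈ M.items L, ∀ b' ∈ M.items L, D' i' a' b' →
      D i' a' b' ∨ (i' = i ∧ a' = a ∧ b' = b)) :
    Det Z tryCmd m (SearchState M L D') := by
  refine Det.rset_seq ?_
  set m₁ := m.setReal 6 _ _ _ _ with hm₁
  have hag : Agree [] [6] m m₁ := agree_setReal _ _ _ _ _ _ (by simp)
  have hm1 := hm.of_agree hag (by simp) (by simp) (by simp; omega)
  have e6 : m₁.real 6 0 0 0 = M.crossing i a b := by
    simp only [hm₁, setReal_real_self, NExpr.eval, RExpr.eval, h3, h4, h5, h6, h7,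
      hm.density i a ha, hm.density i b hb, hm.rate i a ha, hm.rate i b hb]
    simp [MLSD.crossing]
  have hS1 : SearchState M L D m₁ := by
    have e7 : m₁.real 7 = m.real 7 := hag.real 7 (by simp)
    exact ⟨e7 ▸ hS.nonneg, e7 ▸ hS.within, e7 ▸ hS.le⟩
  clear_value m₁
  refine Det.seq (det_scanAllCmd hm1 hnZ hHZ hLZ hL (σ := 1)
    (fun m => by simp [RExpr.eval, NExpr.eval]) e6 (by omega) (by omega) (by omega) (by omega)
    (by omega)) fun m₂ ha₂ hsc => ?_
  have hm2 := hm1.of_agree ha₂ (by decide) (by decide) (by decide)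
  have hwithin : WithinBudget M.density (fun _ => playRate) (M.items L) k (M.crossing i a b) ↔
      m₂.real 10 0 0 0 ≤ k := by
    rw [hsc.sum]
    exact ⟨fun h => h.of_isBest hsc.best, fun h => ⟨_, hsc.best, h⟩⟩
  have e6' : m₂.real 6 0 0 0 = M.crossing i a b := by rw [ha₂.real 6 (by decide), e6]
  have hS2 : SearchState M L D m₂ := by
    have e7 : m₂.real 7 = m₁.real 7 := ha₂.real 7 (by decide)
    exact ⟨e7 ▸ hS1.nonneg, e7 ▸ hS1.within, e7 ▸ hS1.le⟩
  have hk := hm2.input.eval_inK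
  refine Det.ite (fun h => Det.rset ?_) (fun h => Det.skip ?_)
  · simp only [Test.eval, RExpr.eval] at h
    rw [hk] at h
    simp only [NExpr.eval, e6', not_lt, Nat.cast_zero] at h
    have e7 : (m₂.setReal 7 (.const 0) (.const 0) (.const 0) ((rv 6).eval m₂)).real 7 0 0 0
        = M.crossing i a b := by
      simp [setReal_real_self, NExpr.eval, RExpr.eval, e6']
    refine ⟨by rw [e7]; exact h.1.2, by rw [e7]; exact hwithin.2 h.1.1, ?_⟩
    intro i' a' ha' b' hb' hD' h0 hw
    rw [e7]
    rcases hD i' a' ha' b' hb' hD' with hD' | ⟨rfl, rfl, rfl⟩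
    · exact h.2.le.trans (hS2.le i' a' ha' b' hb' hD' h0 hw)
    · exact le_rfl
  · refine ⟨hS2.nonneg, hS2.within, ?_⟩
    intro i' a' ha' b' hb' hD' h0 hw
    rcases hD i' a' ha' b' hb' hD' with hD' | ⟨rfl, rfl, rfl⟩
    · exact hS2.le i' a' ha' b' hb' hD' h0 hw
    · simp only [Test.eval, RExpr.eval] at h
      rw [hk] at h
      simp only [NExpr.eval, e6', not_lt, Nat.cast_zero] at h
      by_contra hlt
      exact h ⟨⟨hwithin.1 hw, h0⟩, not_le.1 hlt⟩

/-- The crossings tested by the five nested loops before the counters reach the given values. -/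
def tested (t s r s' r' : ℕ) (i : Fin n) (a b : ℕ × ℕ) : Prop :=
  (i : ℕ) < t ∨ ((i : ℕ) = t ∧ (a.1 < s ∨ (a.1 = s ∧ (a.2 < r ∨ (a.2 = r ∧
    (b.1 < s' ∨ (b.1 = s' ∧ b.2 < r')))))))

theorem SearchState.mono {D D' : Fin n → ℕ × ℕ → ℕ × ℕ → Prop} (h : SearchState M L D m)
    (hD : ∀ i', ∀ a' ∈ M.items L, ∀ b' ∈ M.items L, D' i' a' b' → D i' a' b') :
    SearchState M L D' m :=
  ⟨h.nonneg, h.within, fun i a ha b hb hd => h.le i a ha b hb (hD i a ha b hb hd)⟩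

theorem SearchState.setVar {D : Fin n → ℕ × ℕ → ℕ × ℕ → Prop} (h : SearchState M L D m)
    (a v : ℕ) : SearchState M L D (m.setVar a v) :=
  ⟨h.nonneg, h.within, h.le⟩

theorem det_searchCmd (hm : HasTables M ε L m) (hnZ : n ≤ Z) (hHZ : M.τmax.toNat + 1 ≤ Z)
    (hLZ : L ≤ Z) (hL : 1 ≤ L) :
    Det Z searchCmd m fun m' => M.IsLeastMultiplier L (m'.real 7 0 0 0) := by
  refine Det.rset_seq ?_
  set m₀ := m.setReal 7 _ _ _ _ with hm₀
  have hag : Agree [] [7] m m₀ := agree_setReal _ _ _ _ _ _ (by simp)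
  have hm0 := hm.of_agree hag (by simp) (by simp) (by simp; omega)
  have e7 : m₀.real 7 0 0 0 = 1 := by simp [hm₀, setReal_real_self, NExpr.eval, RExpr.eval]
  have hS0 : SearchState M L (tested 0 0 0 0 0) m₀ :=
    ⟨by rw [e7]; exact zero_le_one, by rw [e7]; exact M.withinBudget_one hL,
      fun i a _ b _ h => by simp [tested] at h⟩
  clear_value m₀
  have tauMax : ∀ {m'}, HasTables M ε L m' →
      (NExpr.add inTauMax (.const 1)).eval m' = M.τmax.toNat + 1 := by
    intro m' h
    have := h.input.eval_inTauMax
    simp only [NExpr.eval] at this ⊢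
    rw [this]
  refine Det.forUp (N := n) (fun t m' => SearchState M L (tested t 0 0 0 0) m') hnZ (by decide)
    (fun m' h => (hm0.of_agree h (by decide) (by decide) (by decide)).input.eval_inN)
    (hS0.setVar _ _) ?_ ?_
  · intro t ht m₁ ha₁ hc₁ hI₁
    have hm1 := hm0.of_agree ha₁ (by decide) (by decide) (by decide)
    refine Det.forUp (N := M.τmax.toNat + 1)
      (fun s m' => SearchState M L (tested t s 0 0 0) m') hHZ (by decide)
      (fun m' h => tauMax (hm1.of_agree h (by decide) (by decide) (by decide)))
      (hI₁.setVar _ _) ?_ ?_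
    · intro s hs m₂ ha₂ hc₂ hI₂
      have hm2 := hm1.of_agree ha₂ (by decide) (by decide) (by decide)
      refine Det.forUp (N := L)
        (fun r m' => SearchState M L (tested t s r 0 0) m') hLZ (by decide)
        (fun m' h => (hm2.of_agree h (by decide) (by decide) (by decide)).ceil)
        (hI₂.setVar _ _) ?_ ?_
      · intro r hr m₃ ha₃ hc₃ hI₃
        have hm3 := hm2.of_agree ha₃ (by decide) (by decide) (by decide)
        refine Det.forUp (N := M.τmax.toNat + 1)
          (fun s' m' => SearchState M L (tested t s r s' 0) m') hHZ (by decide)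
          (fun m' h => tauMax (hm3.of_agree h (by decide) (by decide) (by decide)))
          (hI₃.setVar _ _) ?_ ?_
        · intro s' hs' m₄ ha₄ hc₄ hI₄
          have hm4 := hm3.of_agree ha₄ (by decide) (by decide) (by decide)
          refine Det.forUp (N := L)
            (fun r' m' => SearchState M L (tested t s r s' r') m') hLZ (by decide)
            (fun m' h => (hm4.of_agree h (by decide) (by decide) (by decide)).ceil)
            (hI₄.setVar _ _) ?_ ?_
          · intro r' hr' m₅ ha₅ hc₅ hI₅
            have hm5 := hm4.of_agree ha₅ (by decide) (by decide) (by decide)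
            refine (det_tryCmd hm5 hnZ hHZ hLZ hL (i := ⟨t, ht⟩) (a := (s, r)) (b := (s', r'))
              (M.mem_items.2 ⟨hs, hr⟩) (M.mem_items.2 ⟨hs', hr'⟩) ?_ ?_ ?_ ?_ hc₅ hI₅
              (D' := tested t s r s' (r' + 1)) ?_).weaken fun m' _ h => h.setVar _ _
            · rw [ha₅.nat 3 (by decide), ha₄.nat 3 (by decide), ha₃.nat 3 (by decide),
                ha₂.nat 3 (by decide), hc₁]
            · rw [ha₅.nat 4 (by decide), ha₄.nat 4 (by decide), ha₃.nat 4 (by decide), hc₂]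
            · rw [ha₅.nat 5 (by decide), ha₄.nat 5 (by decide), hc₃]
            · rw [ha₅.nat 6 (by decide), hc₄]
            · rintro i ⟨a, a'⟩ _ ⟨b, b'⟩ _ h
              simp only [tested, Prod.mk.injEq, Fin.ext_iff] at h ⊢
              omega
          · intro m' _ h
            refine (h.setVar _ _).mono ?_
            rintro i a ha b hb h'
            have := M.mem_items.1 hb
            simp only [tested] at h' ⊢
            omega
        · intro m' _ h
          refine (h.setVar _ _).mono ?_
          rintro i a ha b hb h'
          have := M.mem_items.1 hb
          simp only [tested] at h' ⊢
          omega
      · intro m' _ h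
        refine (h.setVar _ _).mono ?_
        rintro i a ha b hb h'
        have := M.mem_items.1 ha
        simp only [tested] at h' ⊢
        omega
    · intro m' _ h
      refine (h.setVar _ _).mono ?_
      rintro i a ha b hb h'
      have := M.mem_items.1 ha
      simp only [tested] at h' ⊢
      omega
  · intro m' _ h
    exact ⟨h.nonneg, h.within, fun i a ha b hb => h.le i a ha b hb (Or.inl i.2)⟩

end Search

/-! ### Sampling of the intervals and offsets -/

/-- The deterministic part of the initialization: the two optimal choices of items between which
the arms are randomized. -/
def prepareCmd : Cmd :=
  .seq ceilCmd (.seq prefixCmd (.seq tableCmd (.seq searchCmd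
    (.seq (rassign 6 (rv 7)) (.seq scanLoCmd scanHiCmd)))))

/-- Stores the item of the arm in variable `3` that the coin in variable `17` selects. -/
def storeItemCmd : Cmd :=
  .ite (.nlt (.const 0) (nv 17))
    (.seq (.nset 18 (nv 3) (.const 0) (.const 0) (.get 15 (nv 3) (.const 0) (.const 0)))
      (.nset 19 (nv 3) (.const 0) (.const 0) (.get 16 (nv 3) (.const 0) (.const 0))))
    (.seq (.nset 18 (nv 3) (.const 0) (.const 0) (.get 13 (nv 3) (.const 0) (.const 0)))
      (.nset 19 (nv 3) (.const 0) (.const 0) (.get 14 (nv 3) (.const 0) (.const 0))))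

/-- Draws the offset of the arm in variable `3`, which is also its first position on the cycle. -/
def drawOffsetCmd : Cmd :=
  .seq (.draw 20 (nv 3) (.const 0) (.const 0)
      (.add (.add (.get 18 (nv 3) (.const 0) (.const 0)) (.get 19 (nv 3) (.const 0) (.const 0)))
        (.const 1)))
    (.nset 21 (nv 3) (.const 0) (.const 0) (.get 20 (nv 3) (.const 0) (.const 0)))

/-- Samples the interval and the offset of the arm in variable `3`.  The bias of the coin is the
mixing weight for which the budget is exhausted on average; the clamping of biases to `[0, 1]` and
the convention for division by `0`, which occurs if both choices have the same rate, agree with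
those in `mixWeight`. -/
def sampleArmCmd : Cmd :=
  .seq (.flip 17 (.const 0) (.const 0) (.const 0)
      (.div (.sub (.cast inK) (rv 10)) (.sub (rv 11) (rv 10)))) (.seq storeItemCmd drawOffsetCmd)

/-- The initialization: the two choices of items are computed, and then every arm flips its own
coin. -/
def initCmd : Cmd := .seq prepareCmd (forUp 3 inN sampleArmCmd)

/-- The interval and offset of an arm that are stored in memory. -/
def storedOutcome (m : Mem) (i : ℕ) : Option ((ℤ × ℤ) × ℕ) :=
  (toInterval (m.nat 18 i 0 0, m.nat 19 i 0 0)).map fun I => (I, m.nat 20 i 0 0)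

section Sampling

variable {n k : ℕ} {M : MLSD n k} {ε : ℝ} {Z L : ℕ} {m : Mem}

/-- The memory after the deterministic part of the initialization. -/
structure IsPrepared (M : MLSD n k) (ε : ℝ) (lo hi : Fin n → ℕ × ℕ) (m : Mem) : Prop where
  input : HasInput M ε m
  lo_eq : ∀ i : Fin n, (m.nat 13 i 0 0, m.nat 14 i 0 0) = lo i
  hi_eq : ∀ i : Fin n, (m.nat 15 i 0 0, m.nat 16 i 0 0) = hi i
  lo_sum : m.real 10 0 0 0 = ∑ i, playRate (lo i)
  hi_sum : m.real 11 0 0 0 = ∑ i, playRate (hi i)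

theorem det_prepareCmd (hm : HasInput M ε m) (hε : 0 < ε) (hnZ : n ≤ Z)
    (hHZ : M.τmax.toNat + 1 ≤ Z) (hLZ : ⌈1 / ε⌉₊ ≤ Z) :
    Det Z prepareCmd m fun m' =>
      ∃ lam lo hi, M.IsCritical ⌈1 / ε⌉₊ lam lo hi ∧ IsPrepared M ε lo hi m' := by
  have hL : 1 ≤ ⌈1 / ε⌉₊ := Nat.one_le_ceil_iff.2 (by positivity)
  refine Det.seq (det_ceilCmd hm hLZ) fun m₁ ha₁ h₁ => ?_
  have hm₁ := hm.of_agree ha₁ (by decide) (by decide) (by decide) (by decide)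
  refine Det.seq (det_prefixCmd hm₁ hnZ h₁ hLZ) fun m₂ ha₂ h₂ => ?_
  have hm₂ := hm₁.of_agree ha₂ (by decide) (by decide) (by decide) (by decide)
  have e₂ : m₂.nat 2 0 0 0 = ⌈1 / ε⌉₊ := by rw [ha₂.nat 2 (by decide), h₁]
  refine Det.seq (det_tableCmd hm₂ e₂ hnZ hHZ hLZ h₂) fun m₃ _ h₃ => ?_
  refine Det.seq (det_searchCmd h₃ hnZ hHZ hLZ hL) fun m₄ ha₄ h₄ => ?_
  have h₃' := h₃.of_agree ha₄ (by decide) (by decide) (by decide)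
  refine Det.rset_seq ?_
  have h₅ := h₃'.of_agree (agree_setReal (W := []) (R := [6]) m₄ 6 (.const 0) (.const 0) (.const 0)
    ((rv 7).eval m₄) (by simp)) (by simp) (by simp) (by simp; omega)
  have e₅ : (m₄.setReal 6 (.const 0) (.const 0) (.const 0) ((rv 7).eval m₄)).real 6 0 0 0
      = m₄.real 7 0 0 0 := by simp [setReal_real_self, RExpr.eval, NExpr.eval]
  refine Det.seq (det_scanAllCmd h₅ hnZ hHZ hLZ hL (σ := 1)
    (fun m => by simp [RExpr.eval, NExpr.eval]) e₅ (by omega) (by omega) (by omega) (by omega)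
    (by omega)) fun m₆ ha₆ hlo => ?_
  have h₆ := h₅.of_agree ha₆ (by decide) (by decide) (by decide)
  refine (det_scanAllCmd h₆ hnZ hHZ hLZ hL (σ := -1)
    (fun m => by simp [RExpr.eval, NExpr.eval]) ((congrFun (congrFun (congrFun
      (ha₆.real 6 (by decide)) _) _) _).trans e₅) (by omega) (by omega) (by omega) (by omega)
    (by omega)).weaken fun m₇ ha₇ hhi => ?_
  have e13 : m₇.nat 13 = m₆.nat 13 := ha₇.nat 13 (by decide)
  have e14 : m₇.nat 14 = m₆.nat 14 := ha₇.nat 14 (by decide)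
  exact ⟨_, fun i => (m₆.nat 13 i 0 0, m₆.nat 14 i 0 0), _,
    MLSD.IsLeastMultiplier.isCritical M hL h₄ hlo.best hhi.best,
    (h₆.of_agree ha₇ (by decide) (by decide) (by decide)).input,
    fun i => by rw [e13, e14], fun i => rfl,
    by rw [ha₇.real 10 (by decide)]; exact hlo.sum, hhi.sum⟩

/-- The law of the sampled interval of an arm is that of a coin flip between two items. -/
theorem intervalLaw_eq {lam : ℝ} {lo hi : Fin n → ℕ × ℕ} (h : M.IsCritical L lam lo hi)
    (i : Fin n) : M.intervalLaw h.isFeasible i =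
      (coin ((k - ∑ i, playRate (lo i)) / (∑ i, playRate (hi i) - ∑ i, playRate (lo i)))).map
        fun v => toInterval (if 0 < v then hi i else lo i) := by
  have hl := fun i => (h.lo_best i).mem
  have hh := fun i => (h.hi_best i).mem
  have hθ : max 0 (min 1 ((k - ∑ i, playRate (lo i)) /
      (∑ i, playRate (hi i) - ∑ i, playRate (lo i)))) = MLSD.criticalWeight k lo hi := rfl
  have h0 : 0 ≤ MLSD.criticalWeight k lo hi := mixWeight_nonneg _ _ _
  have h1 : MLSD.criticalWeight k lo hi ≤ 1 := mixWeight_le_one _ _ _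
  rw [coin, PMF.map_comp]
  ext a
  rw [PMF.map_apply, tsum_fintype, Fintype.sum_bool]
  simp only [PMF.ofFintype_apply, Function.comp, if_true, hθ]
  rw [MLSD.intervalLaw, PMF.ofFinset_apply]
  have key : M.intervalWeight (-L) (MLSD.mixture (MLSD.criticalWeight k lo hi) lo hi) i a =
      (1 - MLSD.criticalWeight k lo hi) * (if a = toInterval (lo i) then 1 else 0)
        + MLSD.criticalWeight k lo hi * (if a = toInterval (hi i) then 1 else 0) := by
    cases a with
    | none =>
      rw [MLSD.intervalWeight, MLSD.sum_mixture hl hh (fun I => (I.1 : ℝ) - I.2) i]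
      simp only [MLSD.perRound_length, eq_comm (a := (none : Option (ℤ × ℤ)))]
      split_ifs <;> ring
    | some I =>
      simp only [MLSD.intervalWeight, eq_comm (a := some I)]
      split_ifs with hI h2 h3 h3 h2 h3 h3
      all_goals try (exact absurd (M.toInterval_mem_box (hl i) (by assumption)) hI)
      all_goals try (exact absurd (M.toInterval_mem_box (hh i) (by assumption)) hI)
      all_goals
        try
          have hpos : (I.1 : ℝ) - I.2 ≠ 0 := by
            simp only [MLSD.box, Finset.mem_product, Finset.mem_Icc] at hI
            have : ((I.1 - I.2 : ℤ) : ℝ) ≠ 0 := by exact_mod_cast (by omega)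
            simpa using this
        first
          | (simp only [MLSD.mixture, h2, h3, if_true, if_false]; field_simp)
          | simp
  rw [key]
  simp only [Bool.false_eq_true, if_true, if_false, zero_lt_one, lt_irrefl]
  split_ifs <;> simp [← ENNReal.ofReal_add, h0, h1]

theorem uniformBelow_support {N : ℕ} (hN : 0 < N) : ∀ r ∈ (uniformBelow N).support, r < N := by
  intro r hr
  rw [uniformBelow, dif_pos hN] at hr
  exact Finset.mem_range.1 ((PMF.mem_support_uniformOfFinset_iff _ _).1 hr)

/-- The law of interval and offset of an arm, in terms of the coin and the draw of the program. -/
theorem armLaw_eq {lam : ℝ} {lo hi : Fin n → ℕ × ℕ} (h : M.IsCritical L lam lo hi)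
    (i : Fin n) : M.armLaw h.isFeasible i =
      (coin ((k - ∑ i, playRate (lo i)) / (∑ i, playRate (hi i) - ∑ i, playRate (lo i)))).bind
        fun v => (uniformBelow ((if 0 < v then hi i else lo i).1 + (if 0 < v then hi i else lo i).2
          + 1)).map fun r => (toInterval (if 0 < v then hi i else lo i)).map fun I => (I, r) := by
  rw [MLSD.armLaw, intervalLaw_eq h, PMF.bind_map]
  refine congrArg _ (funext fun v => ?_)
  simp only [Function.comp]
  generalize (if 0 < v then hi i else lo i) = p
  cases hp : toInterval p with
  | none => exact (PMF.map_const _ _).symm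
  | some I =>
    simp only [toInterval] at hp
    split_ifs at hp with h0
    simp only [Option.some.injEq] at hp
    subst hp
    simp only [Option.map_some]
    congr 2

/-- A counting loop with random body.  If the `i`-th iteration produces an observation of law
`law i` and keeps the earlier observations, then the observations are independent. -/
theorem runs_forUp {α : Type} {a N : ℕ} {e : NExpr} {c : Cmd} (hN : N ≤ Z)
    (obs : Mem → ℕ → α) (law : ℕ → PMF α) (Good : ℕ → Mem → Prop)
    (hobs : ∀ m v, obs (m.setVar a v) = obs m)
    (hGood : ∀ t m, Good t m → m.nat a 0 0 0 = t ∧ e.eval m = N)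
    (hbody : ∀ t < N, ∀ m, Good t m → ∃ μ, RunsB (c.cost Z) c m μ ∧
      μ.map (fun m' => obs m' t) = law t ∧ ∀ m' ∈ μ.support, m'.nat a 0 0 0 = t ∧
        Good (t + 1) (m'.setVar a (t + 1)) ∧ ∀ s < t, obs m' s = obs m s)
    (h0 : Good 0 (m.setVar a 0)) :
    ∃ μ, RunsB ((forUp a e c).cost Z) (forUp a e c) m μ ∧
      μ.map (fun m' (i : Fin N) => obs m' i) = independent N (fun i => law i) ∧
      ∀ m' ∈ μ.support, Good N m' := by
  set inc : Cmd := nassign a (.add (nv a) (.const 1)) with hinc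
  -- The last `j` iterations; the observation of the first of them is split off.
  have key : ∀ j t, t + j = N → ∀ m, Good t m → ∃ μ,
      RunsB (1 + j * (1 + (Cmd.seq c inc).cost Z)) (.loop (.nlt (nv a) e) (.seq c inc)) m μ ∧
      μ.map (fun m' (i : Fin j) => obs m' (t + i)) = independent j (fun i => law (t + i)) ∧
      ∀ m' ∈ μ.support, Good N m' ∧ ∀ s < t, obs m' s = obs m s := by
    intro j
    induction j with
    | zero =>
      intro t ht m hm
      obtain ⟨h1, h2⟩ := hGood t m hm
      refine ⟨PMF.pure m, ?_, ?_, ?_⟩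
      · simpa using RunsB.loop_false (by simp [Test.eval, NExpr.eval, h1, h2]; omega)
      · rw [PMF.pure_map]
        simp only [independent]
        congr 1
        exact funext fun i => i.elim0
      · intro m' hm'
        simp at hm'; subst hm'
        obtain rfl : t = N := by omega
        exact ⟨hm, fun _ _ => rfl⟩
    | succ j ih =>
      intro t ht m hm
      obtain ⟨h1, h2⟩ := hGood t m hm
      obtain ⟨μ, hr, hlaw, hsup⟩ := hbody t (by omega) m hm
      have hex : ∀ m₁, ∃ ν, m₁ ∈ μ.support →
          RunsB (1 + j * (1 + (Cmd.seq c inc).cost Z)) (.loop (.nlt (nv a) e) (.seq c inc))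
            (m₁.setVar a (t + 1)) ν ∧
          ν.map (fun m' (i : Fin j) => obs m' (t + 1 + i))
            = independent j (fun i => law (t + 1 + i)) ∧
          ∀ m' ∈ ν.support, Good N m' ∧ ∀ s < t + 1, obs m' s = obs m₁ s := by
        intro m₁
        by_cases hm₁ : m₁ ∈ μ.support
        · obtain ⟨ν, h3, h4, h5⟩ := ih (t + 1) (by omega) _ (hsup m₁ hm₁).2.1
          exact ⟨ν, fun _ => ⟨h3, h4, fun m' hm' => by simpa [hobs] using h5 m' hm'⟩⟩
        · exact ⟨PMF.pure m₁, fun h => absurd h hm₁⟩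
      choose ν hν using hex
      have hseq : RunsB ((Cmd.seq c inc).cost Z) (.seq c inc) m
          (μ.bind fun m₁ => PMF.pure (m₁.setVar a (t + 1))) := by
        refine RunsB.seq hr fun m₁ hm₁ => ?_
        have h4 := (hsup m₁ hm₁).1
        have h5 : m₁.setVar a (t + 1) = m₁.setNat a (.const 0) (.const 0) (.const 0)
            ((NExpr.add (nv a) (.const 1)).eval m₁) := by
          simp [Mem.setVar, NExpr.eval, h4]
        rw [h5]
        exact RunsB.of_step fun K => by simp [step, PMF.pure_map, hinc]
      have hloop : RunsB (1 + (Cmd.seq c inc).cost Z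
          + (1 + j * (1 + (Cmd.seq c inc).cost Z))) (.loop (.nlt (nv a) e) (.seq c inc)) m
          (μ.bind ν) := by
        intro K G N₀ hG N' hN'
        obtain ⟨N', rfl⟩ : ∃ N'', N' = N'' + 1 := ⟨N' - 1, by omega⟩
        have hb : (Test.nlt (nv a) e).eval m := by
          simp only [Test.eval, NExpr.eval] at h1 ⊢
          rw [h1, h2]; omega
        rw [runFor]
        simp only [step, hb, if_true, PMF.pure_bind]
        have := hseq (.loop (.nlt (nv a) e) (.seq c inc) :: K)
          (fun m' => runFor (N' + (1 + j * (1 + (Cmd.seq c inc).cost Z) + N₀))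
            (.loop (.nlt (nv a) e) (.seq c inc) :: K, m'))
          (1 + j * (1 + (Cmd.seq c inc).cost Z) + N₀) ?_ N' (by omega)
        · rw [this, PMF.bind_bind, PMF.bind_bind]
          refine PMF.bind_congr_support fun m₁ hm₁ => ?_
          rw [PMF.pure_bind]
          exact (hν m₁ hm₁).1 K G N₀ (fun m' hm' => hG m' (by
            rw [PMF.mem_support_bind_iff]; exact ⟨m₁, hm₁, hm'⟩)) _ (by omega)
        · intro m' hm' N'' hN''
          rw [PMF.mem_support_bind_iff] at hm'
          obtain ⟨m₁, hm₁, hm'⟩ := hm'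
          simp at hm'; subst hm'
          have hG' : ∀ m' ∈ (ν m₁).support, ∀ N, N₀ ≤ N → runFor N (K, m') = G m' :=
            fun m' hm' => hG m' (by rw [PMF.mem_support_bind_iff]; exact ⟨m₁, hm₁, hm'⟩)
          rw [(hν m₁ hm₁).1 K G N₀ hG' N'' hN'', (hν m₁ hm₁).1 K G N₀ hG' _ (by omega)]
      refine ⟨μ.bind ν, hloop.mono (by ring_nf; omega), ?_, ?_⟩
      · rw [PMF.map_bind]
        have hcongr : ∀ m₁ ∈ μ.support, (ν m₁).map (fun m' (i : Fin (j + 1)) => obs m' (t + i))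
            = (independent j (fun i => law (t + 1 + i))).map (Fin.cons (obs m₁ t)) := by
          intro m₁ hm₁
          obtain ⟨_, h4, h5⟩ := hν m₁ hm₁
          rw [← h4, PMF.map_comp]
          simp only [PMF.map]
          refine PMF.bind_congr_support fun m' hm' => ?_
          simp only [Function.comp]
          congr 1
          funext i
          refine Fin.cases ?_ (fun i => ?_) i
          · simpa using (h5 m' hm').2 t (by omega)
          · simp only [Fin.cons_succ, Fin.val_succ]
            congr 1; omega
        rw [PMF.bind_congr_support hcongr, independent]
        have hlaw' : law (t + ((0 : Fin (j + 1)) : ℕ)) = μ.map fun m' => obs m' t := by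
          rw [hlaw]; rfl
        rw [hlaw', PMF.bind_map]
        refine congrArg _ (funext fun m₁ => ?_)
        simp only [Function.comp, Fin.val_succ]
        congr 2
        funext i
        congr 1; omega
      · intro m' hm'
        rw [PMF.mem_support_bind_iff] at hm'
        obtain ⟨m₁, hm₁, hm'⟩ := hm'
        obtain ⟨h3, h4⟩ := (hν m₁ hm₁).2.2 m' hm'
        exact ⟨h3, fun s hs => (h4 s (by omega)).trans ((hsup m₁ hm₁).2.2 s hs)⟩
  obtain ⟨μ, h1, h2, h3⟩ := key N 0 (by omega) _ h0
  refine ⟨μ, ?_, by simpa using h2, fun m' hm' => (h3 m' hm').1⟩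
  have hset : RunsB 1 (nassign a (.const 0)) m (PMF.pure (m.setVar a 0)) :=
    RunsB.of_step fun K => by simp [step, PMF.pure_map, Mem.setVar, NExpr.eval]
  have := RunsB.seq (κ := fun _ => μ) hset (fun m' hm' => by
    simp at hm'; subst hm'; exact h1)
  rw [PMF.pure_bind] at this
  refine this.mono ?_
  simp only [forUp, Cmd.cost, hinc]
  gcongr

/-- The law of interval and offset of the arm with index `i`. -/
def indexLaw {lam : ℝ} {lo hi : Fin n → ℕ × ℕ} (h : M.IsCritical L lam lo hi) (i : ℕ) :
    PMF (Option ((ℤ × ℤ) × ℕ)) :=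
  if hi : i < n then M.armLaw h.isFeasible ⟨i, hi⟩ else PMF.pure none

/-- The sampled data of the arm with index `i` are within their bounds, and the position on the
cycle is the offset. -/
def IsSampled (M : MLSD n k) (i : ℕ) (m : Mem) : Prop :=
  m.nat 18 i 0 0 ≤ M.τmax.toNat ∧ m.nat 20 i 0 0 < m.nat 18 i 0 0 + m.nat 19 i 0 0 + 1 ∧
    m.nat 21 i 0 0 = m.nat 20 i 0 0

theorem runs_sampleArmCmd {lam : ℝ} {lo hi : Fin n → ℕ × ℕ} (h : M.IsCritical L lam lo hi)
    (hm : IsPrepared M ε lo hi m) {i : Fin n} (h3 : m.nat 3 0 0 0 = i) :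
    ∃ μ, RunsB (sampleArmCmd.cost Z) sampleArmCmd m μ ∧
      μ.map (fun m' => storedOutcome m' i) = M.armLaw h.isFeasible i ∧
      ∀ m' ∈ μ.support, Agree [17, 18, 19, 20, 21] [] m m' ∧ IsSampled M i m' ∧
        ∀ a, ∀ s ≠ (i : ℕ), a ≠ 17 → m'.nat a s 0 0 = m.nat a s 0 0 := by
  set p : ℝ := (k - ∑ i, playRate (lo i)) / (∑ i, playRate (hi i) - ∑ i, playRate (lo i)) with hp
  set sel : ℕ → ℕ × ℕ := fun v => if 0 < v then hi i else lo i with hsel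
  -- The memory after the interval has been stored, and the final memory.
  set m₁ : ℕ → Mem := fun v => ((m.setNat 17 (.const 0) (.const 0) (.const 0) v).setNat 18
    (.const i) (.const 0) (.const 0) (sel v).1).setNat 19 (.const i) (.const 0) (.const 0)
      (sel v).2 with hm₁
  set m₂ : ℕ → ℕ → Mem := fun v r => ((m₁ v).setNat 20 (.const i) (.const 0) (.const 0) r).setNat
    21 (.const i) (.const 0) (.const 0) r with hm₂
  have hsetNat : ∀ (m : Mem) a (e : NExpr) v, e.eval m = i →
      m.setNat a e (.const 0) (.const 0) v = m.setNat a (.const i) (.const 0) (.const 0) v := by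
    intro m a e v he
    simp [Mem.setNat, NExpr.eval, he]
  have hagree : ∀ v r, Agree [17, 18, 19, 20, 21] [] m (m₂ v r) := fun v r =>
    ((((agree_setNat _ _ _ _ _ _ (by simp)).trans (agree_setNat _ _ _ _ _ _ (by simp))).trans
      (agree_setNat _ _ _ _ _ _ (by simp))).trans (agree_setNat _ _ _ _ _ _ (by simp))).trans
      (agree_setNat _ _ _ _ _ _ (by simp))
  have e18 : ∀ v r, (m₂ v r).nat 18 i 0 0 = (sel v).1 := fun v r => by
    simp [hm₂, hm₁, Mem.setNat, writeEntry, NExpr.eval]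
  have e19 : ∀ v r, (m₂ v r).nat 19 i 0 0 = (sel v).2 := fun v r => by
    simp [hm₂, hm₁, Mem.setNat, writeEntry, NExpr.eval]
  have e20 : ∀ v r, (m₂ v r).nat 20 i 0 0 = r := fun v r => by
    simp [hm₂, hm₁, Mem.setNat, writeEntry, NExpr.eval]
  have e21 : ∀ v r, (m₂ v r).nat 21 i 0 0 = r := fun v r => by
    simp [hm₂, hm₁, Mem.setNat, writeEntry, NExpr.eval]
  have hflip : RunsB 1 (.flip 17 (.const 0) (.const 0) (.const 0)
      (.div (.sub (.cast inK) (rv 10)) (.sub (rv 11) (rv 10)))) m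
      ((coin p).map fun v => m.setNat 17 (.const 0) (.const 0) (.const 0) v) := by
    refine RunsB.of_step fun K => ?_
    have := hm.input.eval_inK
    have hv : (RExpr.div (.sub (.cast inK) (rv 10)) (.sub (rv 11) (rv 10))).eval m = p := by
      have e10 := hm.lo_sum
      have e11 := hm.hi_sum
      simp only [RExpr.eval, this]
      simp only [NExpr.eval, e10, e11, hp]
    simp only [step, hv, PMF.map_comp]
    rfl
  have hite : ∀ v, Det Z storeItemCmd
      (m.setNat 17 (.const 0) (.const 0) (.const 0) v) (fun m' => m' = m₁ v) := by
    intro v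
    have hh := hm.hi_eq i
    have hl := hm.lo_eq i
    refine Det.ite (fun hb => ?_) (fun hb => ?_) <;>
      simp [Test.eval, NExpr.eval, setNat_nat_self] at hb <;>
      refine Det.nset_seq (Det.nset ?_)
    · rw [hsetNat _ 18 _ _ (by simp [NExpr.eval, Mem.setNat, writeEntry, h3]),
        hsetNat _ 19 _ _ (by simp [NExpr.eval, Mem.setNat, writeEntry, h3])]
      simp only [hm₁, hsel, hb, if_true, ← hh]
      simp [NExpr.eval, Mem.setNat, writeEntry, h3]
    · rw [hsetNat _ 18 _ _ (by simp [NExpr.eval, Mem.setNat, writeEntry, h3]),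
        hsetNat _ 19 _ _ (by simp [NExpr.eval, Mem.setNat, writeEntry, h3])]
      simp only [hm₁, hsel, hb, lt_irrefl, if_false, ← hl]
      simp [NExpr.eval, Mem.setNat, writeEntry, h3]
  have hdraw : ∀ v, RunsB 3 drawOffsetCmd (m₁ v)
      ((uniformBelow ((sel v).1 + (sel v).2 + 1)).map fun r => m₂ v r) := by
    intro v
    have h3' : (m₁ v).nat 3 0 0 0 = i := by simp [hm₁, Mem.setNat, writeEntry, NExpr.eval, h3]
    have hdr : RunsB 1 (.draw 20 (nv 3) (.const 0) (.const 0)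
          (.add (.add (.get 18 (nv 3) (.const 0) (.const 0)) (.get 19 (nv 3) (.const 0) (.const 0)))
            (.const 1))) (m₁ v) ((uniformBelow ((sel v).1 + (sel v).2 + 1)).map fun r =>
              (m₁ v).setNat 20 (.const i) (.const 0) (.const 0) r) := by
      refine RunsB.of_step fun K => ?_
      have hv : (NExpr.add (.add (.get 18 (nv 3) (.const 0) (.const 0))
          (.get 19 (nv 3) (.const 0) (.const 0))) (.const 1)).eval (m₁ v)
            = (sel v).1 + (sel v).2 + 1 := by
        simp only [NExpr.eval, h3']
        simp [hm₁, Mem.setNat, writeEntry, NExpr.eval]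
      simp only [step, hv, PMF.map_comp]
      congr 1
      funext r
      simp only [Function.comp]
      rw [hsetNat _ 20 _ _ (by simp [NExpr.eval, h3'])]
    have hlaw : ((uniformBelow ((sel v).1 + (sel v).2 + 1)).map fun r => m₂ v r) =
        ((uniformBelow ((sel v).1 + (sel v).2 + 1)).map fun r =>
          (m₁ v).setNat 20 (.const i) (.const 0) (.const 0) r).bind fun m' =>
            PMF.pure (m'.setNat 21 (.const i) (.const 0) (.const 0) (m'.nat 20 i 0 0)) := by
      rw [PMF.bind_map]
      simp only [PMF.map]
      congr 1
      funext r
      simp [hm₂, Mem.setNat, writeEntry, NExpr.eval]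
    rw [hlaw]
    refine RunsB.seq (B₁ := 1) (B₂ := 1) hdr fun m' hm' => ?_
    rw [PMF.support_map] at hm'
    obtain ⟨r, _, rfl⟩ := hm'
    refine RunsB.of_step fun K => ?_
    simp only [step, PMF.pure_map]
    congr 2
    rw [hsetNat _ 21 _ _ (by simp [NExpr.eval, Mem.setNat, writeEntry, h3'])]
    simp [NExpr.eval, Mem.setNat, writeEntry, h3']
  have hrun : RunsB (sampleArmCmd.cost Z) sampleArmCmd m ((coin p).bind fun v =>
      (uniformBelow ((sel v).1 + (sel v).2 + 1)).map fun r => m₂ v r) := by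
    have hlaw : ((coin p).bind fun v =>
        (uniformBelow ((sel v).1 + (sel v).2 + 1)).map fun r => m₂ v r) =
        ((coin p).map fun v => m.setNat 17 (.const 0) (.const 0) (.const 0) v).bind fun m' =>
          (uniformBelow ((sel (m'.nat 17 0 0 0)).1 + (sel (m'.nat 17 0 0 0)).2 + 1)).map
            fun r => m₂ (m'.nat 17 0 0 0) r := by
      rw [PMF.bind_map]
      rfl
    rw [hlaw]
    refine RunsB.seq (B₁ := 1) (B₂ := 1 + storeItemCmd.cost Z + 3) hflip ?_
    · intro m' hm'
      rw [PMF.support_map] at hm'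
      obtain ⟨v, _, rfl⟩ := hm'
      obtain ⟨_, rfl, hr⟩ := hite v
      have := RunsB.seq (κ := fun _ =>
        (uniformBelow ((sel v).1 + (sel v).2 + 1)).map fun r => m₂ v r) hr (fun m' hm' => by
          simp at hm'; subst hm'; exact hdraw v)
      rw [PMF.pure_bind] at this
      simpa [setNat_nat_self, NExpr.eval] using this
  refine ⟨_, hrun, ?_, ?_⟩
  · rw [armLaw_eq h, PMF.map_bind]
    refine congrArg _ (funext fun v => ?_)
    rw [PMF.map_comp]
    refine congrArg (fun f => PMF.map f _) (funext fun r => ?_)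
    simp only [Function.comp, storedOutcome, e18, e19, e20]
    rfl
  · intro m' hm'
    rw [PMF.mem_support_bind_iff] at hm'
    obtain ⟨v, _, hm'⟩ := hm'
    rw [PMF.support_map] at hm'
    obtain ⟨r, hr, rfl⟩ := hm'
    refine ⟨hagree v r, ⟨?_, ?_, ?_⟩, ?_⟩
    · rw [e18]
      have hl := M.mem_items.1 (h.lo_best i).mem
      have hh := M.mem_items.1 (h.hi_best i).mem
      simp only [hsel]
      split_ifs <;> omega
    · rw [e18, e19, e20]
      exact uniformBelow_support (by omega) r hr
    · rw [e20, e21]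
    · intro a s hs ha
      simp [hm₂, hm₁, Mem.setNat, writeEntry, NExpr.eval, hs, ha]

/-- The initialization stores an outcome of the prescribed law. -/
theorem runs_initCmd (hm : HasInput M ε m) (hε : 0 < ε) (hnZ : n ≤ Z)
    (hHZ : M.τmax.toNat + 1 ≤ Z) (hLZ : ⌈1 / ε⌉₊ ≤ Z) :
    ∃ (lam : ℝ) (lo hi : Fin n → ℕ × ℕ) (h : M.IsCritical ⌈1 / ε⌉₊ lam lo hi) (μ : PMF Mem),
      RunsB (initCmd.cost Z) initCmd m μ ∧
      μ.map (fun m' (i : Fin n) => storedOutcome m' i) = M.outcomeLaw h.isFeasible ∧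
      ∀ m' ∈ μ.support, HasInput M ε m' ∧ ∀ i : Fin n, IsSampled M i m' := by
  obtain ⟨m₁, ⟨lam, lo, hi, h, hp⟩, hr₁⟩ := det_prepareCmd hm hε hnZ hHZ hLZ
  have hloop := runs_forUp (Z := Z) (m := m₁) (a := 3) (N := n) (e := inN)
    (c := sampleArmCmd) hnZ storedOutcome (indexLaw h)
    (fun t m => (m.nat 3 0 0 0 = t ∧ IsPrepared M ε lo hi m) ∧ ∀ i < t, IsSampled M i m)
    (fun m v => by
      funext i
      simp only [storedOutcome]
      rw [setVar_nat_of_ne _ (by decide), setVar_nat_of_ne _ (by decide),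
        setVar_nat_of_ne _ (by decide)])
    (fun t m ht => ⟨ht.1.1, ht.1.2.input.eval_inN⟩)
  refine Exists.elim (hloop ?_ ?_) ?_
  · rintro t ht m ⟨⟨h3, hpm⟩, hs⟩
    obtain ⟨μ, hr, hlaw, hsup⟩ := runs_sampleArmCmd (Z := Z) h hpm (i := ⟨t, ht⟩) h3
    refine ⟨μ, hr, by rw [hlaw, indexLaw, dif_pos ht], fun m' hm' => ?_⟩
    obtain ⟨hag, hsm, hother⟩ := hsup m' hm'
    have hkeep : ∀ i < t, IsSampled M i m' := by
      intro i hi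
      have hne : i ≠ t := by omega
      have := hs i hi
      unfold IsSampled at this ⊢
      rwa [hother 18 i hne (by decide), hother 19 i hne (by decide), hother 20 i hne (by decide),
        hother 21 i hne (by decide)]
    refine ⟨by rw [hag.nat 3 (by decide), h3], ⟨⟨by simp, ?_⟩, ?_⟩, ?_⟩
    · have hag' : Agree [3, 17, 18, 19, 20, 21] [] m (m'.setVar 3 (t + 1)) :=
        (hag.mono (by simp) (by simp)).trans (agree_setNat _ _ _ _ _ _ (by simp))
      refine ⟨hpm.input.of_agree hag' (by decide) (by decide) (by decide) (by decide), ?_, ?_, ?_,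
        ?_⟩
      · rw [hag'.nat 13 (by decide), hag'.nat 14 (by decide)]; exact hpm.lo_eq
      · rw [hag'.nat 15 (by decide), hag'.nat 16 (by decide)]; exact hpm.hi_eq
      · rw [hag'.real 10 (by decide)]; exact hpm.lo_sum
      · rw [hag'.real 11 (by decide)]; exact hpm.hi_sum
    · intro i hi
      unfold IsSampled
      rw [setVar_nat_of_ne _ (by decide), setVar_nat_of_ne _ (by decide),
        setVar_nat_of_ne _ (by decide), setVar_nat_of_ne _ (by decide)]
      rcases (show i < t ∨ i = t by omega) with h' | h'
      · exact hkeep i h'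
      · rw [h']; exact hsm
    · intro s hst
      simp only [storedOutcome]
      rw [hother 18 s (by simp; omega) (by decide), hother 19 s (by simp; omega) (by decide),
        hother 20 s (by simp; omega) (by decide)]
  · have hag' : Agree [3] [] m₁ (m₁.setVar 3 0) := agree_setNat _ _ _ _ _ _ (by simp)
    refine ⟨⟨by simp, hp.input.of_agree hag' (by decide) (by decide) (by decide) (by decide),
      ?_, ?_, ?_, ?_⟩, fun i hi => by omega⟩
    · rw [hag'.nat 13 (by decide), hag'.nat 14 (by decide)]; exact hp.lo_eq
    · rw [hag'.nat 15 (by decide), hag'.nat 16 (by decide)]; exact hp.hi_eq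
    · rw [hag'.real 10 (by decide)]; exact hp.lo_sum
    · rw [hag'.real 11 (by decide)]; exact hp.hi_sum
  · rintro μ ⟨hr, hlaw, hsup⟩
    refine ⟨lam, lo, hi, h, μ, ?_, ?_, ?_⟩
    · have := RunsB.seq (κ := fun _ => μ) hr₁ (fun m' hm' => by
        simp at hm'; subst hm'; exact hr)
      rw [PMF.pure_bind] at this
      exact this
    · rw [hlaw, MLSD.outcomeLaw]
      congr 1
      funext i
      simp [indexLaw]
    · intro m' hm'
      exact ⟨(hsup m' hm').1.2.input, fun i => (hsup m' hm').2 i i.2⟩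

end Sampling

/-! ### Positions on the cycle of a recurrent interval -/

theorem nextState_ne_zero (p : Prop) (τ : ℤ) : nextState p τ ≠ 0 := by
  unfold nextState; split_ifs <;> omega

/-- The state reached after `s` moves on the cycle `1, …, u, -1, -2, …`. -/
def cycleState (u s : ℕ) : ℤ := if s < u then s + 1 else -((s : ℤ) - u + 1)

theorem isPlay_cycleState {u j s : ℕ} (hs : s < u + j + 1) :
    isPlay u (-((j : ℤ) + 1)) (cycleState u s) ↔ u ≤ s + 1 ∧ s < u + j := by
  unfold isPlay cycleState
  split_ifs <;> omega

theorem intervalNext_cycleState {u j s : ℕ} (hu : u ≠ 0) (hs : s < u + j + 1) :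
    intervalNext u (-((j : ℤ) + 1)) (cycleState u s)
      = cycleState u (if s + 1 < u + j + 1 then s + 1 else 0) := by
  unfold intervalNext nextState
  rw [isPlay_cycleState hs]
  unfold cycleState
  split_ifs <;> push_cast <;> omega

theorem iterate_intervalNext {u j : ℕ} (hu : u ≠ 0) (s : ℕ) :
    (intervalNext u (-((j : ℤ) + 1)))^[s] 1 = cycleState u (s % (u + j + 1)) := by
  induction s with
  | zero => simp [cycleState, Nat.pos_of_ne_zero hu]
  | succ s ih =>
    have hlt := Nat.mod_lt s (show 0 < u + j + 1 by omega)
    rw [Function.iterate_succ_apply', ih, intervalNext_cycleState hu hlt]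
    congr 1
    rw [Nat.add_mod s 1, Nat.mod_eq_of_lt (show 1 < u + j + 1 by omega)]
    split_ifs with h
    · rw [Nat.mod_eq_of_lt h]
    · rw [show s % (u + j + 1) + 1 = u + j + 1 by omega, Nat.mod_self]

theorem virtualState_eq_iterate (I : ℤ × ℤ) (r t : ℕ) :
    virtualState I r t = (intervalNext I.1 I.2)^[t + r] 1 := by
  rw [virtualState, Function.iterate_add_apply]

theorem virtualState_succ (I : ℤ × ℤ) (r t : ℕ) :
    virtualState I r (t + 1) = intervalNext I.1 I.2 (virtualState I r t) := by
  rw [virtualState, Function.iterate_succ_apply']; rfl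

theorem virtualState_ne_zero (I : ℤ × ℤ) (r t : ℕ) : virtualState I r t ≠ 0 := by
  rw [virtualState_eq_iterate]
  cases h : t + r with
  | zero => simp
  | succ s => rw [Function.iterate_succ_apply']; exact nextState_ne_zero _ _

theorem MLSD.virtualPayoff_nonneg {n k : ℕ} (M : MLSD n k) (o : Outcome n) (t : ℕ) (i : Fin n) :
    0 ≤ M.virtualPayoff o t i := by
  unfold MLSD.virtualPayoff
  cases o i with
  | none => exact le_rfl
  | some a => exact M.payoff_nonneg i _ (virtualState_ne_zero _ _ _)

/-! ### Selection of the `k` best candidates by rank -/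

section Rank

variable {n : ℕ} (S : Finset (Fin n)) (w : Fin n → ℝ)

/-- Arm `j` precedes arm `i`: larger weight, ties being broken by the index. -/
def Precedes (j i : Fin n) : Prop := w i < w j ∨ (w i ≤ w j ∧ j < i)

open Classical in
/-- The members of `S` that precede `i`. -/
def preceding (i : Fin n) : Finset (Fin n) := S.filter fun j => Precedes w j i

open Classical in
/-- The members of `S` that are preceded by fewer than `k` members of `S`. -/
def topRanked (k : ℕ) : Finset (Fin n) := S.filter fun i => (preceding S w i).card < k

variable {S w}

theorem Precedes.trans {i j l : Fin n} (h : Precedes w l j) (h' : Precedes w j i) :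
    Precedes w l i := by
  rcases h with h | ⟨h, h2⟩ <;> rcases h' with h' | ⟨h', h2'⟩
  · left; linarith
  · left; linarith
  · left; linarith
  · right; exact ⟨h'.trans h, h2.trans h2'⟩

theorem Precedes.irrefl {i : Fin n} : ¬ Precedes w i i := by
  rintro (h | ⟨_, h⟩) <;> exact lt_irrefl _ h

theorem precedes_total {i j : Fin n} (h : i ≠ j) : Precedes w i j ∨ Precedes w j i := by
  rcases lt_trichotomy (w i) (w j) with h1 | h1 | h1
  · right; left; exact h1
  · rcases lt_or_gt_of_ne h with h2 | h2
    · left; right; exact ⟨h1.ge, h2⟩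
    · right; right; exact ⟨h1.le, h2⟩
  · left; left; exact h1

theorem card_preceding_lt {i j : Fin n} (hj : j ∈ S) (h : Precedes w j i) :
    (preceding S w j).card < (preceding S w i).card := by
  classical
  refine Finset.card_lt_card ⟨fun x hx => ?_, fun hsub => ?_⟩
  · simp only [preceding, Finset.mem_filter] at hx ⊢
    exact ⟨hx.1, hx.2.trans h⟩
  · have : j ∈ preceding S w j := hsub (by simp [preceding, hj, h])
    simp only [preceding, Finset.mem_filter] at this
    exact Precedes.irrefl this.2

theorem topRanked_subset (k : ℕ) : topRanked S w k ⊆ S := Finset.filter_subset _ _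

theorem card_topRanked_le (k : ℕ) : (topRanked S w k).card ≤ k := by
  classical
  have hinj : Set.InjOn (fun i => (preceding S w i).card) (topRanked S w k) := by
    intro i hi j hj hij
    rw [Finset.mem_coe] at hi hj
    by_contra hne
    rcases precedes_total (w := w) hne with h | h
    · exact (card_preceding_lt (topRanked_subset k hi) h).ne hij
    · exact (card_preceding_lt (topRanked_subset k hj) h).ne' hij
  have := Finset.card_le_card_of_injOn (t := Finset.range k) _ (fun i hi => by
    simpa [topRanked] using (Finset.mem_filter.1 hi).2) hinj
  rwa [Finset.card_range] at this

/-- If a member of `S` is left out, then `k` members are ranked. -/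
theorem le_card_topRanked {k : ℕ} {j : Fin n} (hj : j ∈ S) (hjk : j ∉ topRanked S w k) :
    k ≤ (topRanked S w k).card := by
  classical
  obtain ⟨j₀, hj₀, hmin⟩ := (S \ topRanked S w k).exists_min_image
    (fun i => (preceding S w i).card) ⟨j, by simp [hj, hjk]⟩
  rw [Finset.mem_sdiff] at hj₀
  have hk : k ≤ (preceding S w j₀).card := by
    by_contra hlt
    exact hj₀.2 (by simp [topRanked, hj₀.1, not_le.1 hlt])
  refine hk.trans (Finset.card_le_card fun x hx => ?_)
  simp only [preceding, Finset.mem_filter] at hx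
  by_contra hxR
  exact absurd (hmin x (by simp [hx.1, hxR])) (not_le.2 (card_preceding_lt hx.1 hx.2))

theorem le_of_mem_topRanked {k : ℕ} {i j : Fin n} (hi : i ∈ topRanked S w k) (hj : j ∈ S)
    (hjk : j ∉ topRanked S w k) : w j ≤ w i := by
  classical
  by_contra hlt
  have h1 := card_preceding_lt hj (Or.inl (not_le.1 hlt) : Precedes w j i)
  simp only [topRanked, Finset.mem_filter, not_and] at hi hjk
  exact hjk hj (h1.trans hi.2)

theorem sum_le_sum_topRanked (hw : ∀ i, 0 ≤ w i) {k : ℕ} {A : Finset (Fin n)} (hA : A ⊆ S)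
    (hk : A.card ≤ k) : ∑ i ∈ A, w i ≤ ∑ i ∈ topRanked S w k, w i := by
  classical
  set R := topRanked S w k with hR
  have h1 : ∑ i ∈ A \ R, w i ≤ ∑ i ∈ R \ A, w i := by
    rcases (A \ R).eq_empty_or_nonempty with h | h
    · rw [h, Finset.sum_empty]; exact Finset.sum_nonneg fun i _ => hw i
    · obtain ⟨j, hj, hmax⟩ := (A \ R).exists_max_image w h
      have hj' := Finset.mem_sdiff.1 hj
      have hcard : (A \ R).card ≤ (R \ A).card := by
        have h0 : k ≤ R.card := le_card_topRanked (hA hj'.1) hj'.2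
        have h2 := Finset.card_sdiff_add_card_inter A R
        have h3 := Finset.card_sdiff_add_card_inter R A
        rw [Finset.inter_comm] at h3
        omega
      calc ∑ i ∈ A \ R, w i ≤ (A \ R).card • w j := Finset.sum_le_card_nsmul _ _ _ hmax
        _ ≤ (R \ A).card • w j := by
          rw [nsmul_eq_mul, nsmul_eq_mul]
          exact mul_le_mul_of_nonneg_right (by exact_mod_cast hcard) (hw j)
        _ ≤ ∑ i ∈ R \ A, w i := Finset.card_nsmul_le_sum _ _ _ fun i hi =>
          le_of_mem_topRanked (Finset.mem_sdiff.1 hi).1 (hA hj'.1) hj'.2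
  rw [← Finset.sum_inter_add_sum_sdiff A R, ← Finset.sum_inter_add_sum_sdiff R A,
    Finset.inter_comm R A]
  linarith

end Rank

/-- The selection that breaks ties by the index. -/
def MLSD.rankSelection {n k : ℕ} (M : MLSD n k) (o : Outcome n) (t : ℕ) : Finset (Fin n) :=
  topRanked (candidates o t) (M.virtualPayoff o t) k

theorem MLSD.isSelection_rankSelection {n k : ℕ} (M : MLSD n k) :
    M.IsSelection M.rankSelection := fun o t _ =>
  ⟨topRanked_subset k, card_topRanked_le k, fun _ hS hk =>
    sum_le_sum_topRanked (M.virtualPayoff_nonneg o t) hS hk⟩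

/-! ### The program of a round -/

/-- Moves the arm in variable `3` along its cycle, and stores whether it is a candidate and the
payoff in its virtual state. -/
def moveArmCmd : Cmd :=
  .seq (.ite (.nlt (.add (.get 21 (nv 3) (.const 0) (.const 0)) (.const 1))
      (.add (.add (.get 18 (nv 3) (.const 0) (.const 0)) (.get 19 (nv 3) (.const 0) (.const 0)))
        (.const 1)))
    (.nset 21 (nv 3) (.const 0) (.const 0) (.add (.get 21 (nv 3) (.const 0) (.const 0)) (.const 1)))
    (.nset 21 (nv 3) (.const 0) (.const 0) (.const 0)))
  (.ite (.and (.nlt (.const 0) (.get 18 (nv 3) (.const 0) (.const 0)))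
      (.and (.not (.nlt (.add (.get 21 (nv 3) (.const 0) (.const 0)) (.const 1))
          (.get 18 (nv 3) (.const 0) (.const 0))))
        (.nlt (.get 21 (nv 3) (.const 0) (.const 0))
          (.add (.get 18 (nv 3) (.const 0) (.const 0)) (.get 19 (nv 3) (.const 0) (.const 0))))))
    (.seq (.nset 22 (nv 3) (.const 0) (.const 0) (.const 1))
      (.ite (.nlt (.get 21 (nv 3) (.const 0) (.const 0)) (.get 18 (nv 3) (.const 0) (.const 0)))
        (.rset 13 (nv 3) (.const 0) (.const 0)
          (posPayoff (nv 3) (.add (.get 21 (nv 3) (.const 0) (.const 0)) (.const 1))))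
        (.rset 13 (nv 3) (.const 0) (.const 0)
          (negPayoff (nv 3) (.add (.sub (.get 21 (nv 3) (.const 0) (.const 0))
            (.get 18 (nv 3) (.const 0) (.const 0))) (.const 1))))))
    (.nset 22 (nv 3) (.const 0) (.const 0) (.const 0)))

/-- Computes the rank of the arm in variable `3` among the candidates, and plays it if it is a
candidate of rank less than `k`. -/
def rankArmCmd : Cmd :=
  .seq (nassign 23 (.const 0))
    (.seq (forUp 24 inN (.ite (.and (.nlt (.const 0) (.get 22 (nv 24) (.const 0) (.const 0)))
        (Test.or
          (.rlt (.get 13 (nv 3) (.const 0) (.const 0)) (.get 13 (nv 24) (.const 0) (.const 0)))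
          (.and (.not (.rlt (.get 13 (nv 24) (.const 0) (.const 0))
            (.get 13 (nv 3) (.const 0) (.const 0)))) (.nlt (nv 24) (nv 3)))))
      (nassign 23 (.add (nv 23) (.const 1))) .skip))
    (.ite (.and (.nlt (.const 0) (.get 22 (nv 3) (.const 0) (.const 0))) (.nlt (nv 23) inK))
      (.nset 1 (nv 3) (.const 0) (.const 0) (.const 1))
      (.nset 1 (nv 3) (.const 0) (.const 0) (.const 0))))

/-- A round: all arms move and the candidates are marked, and then the best `k` are played. -/
def roundCmd : Cmd := .seq (forUp 3 inN moveArmCmd) (forUp 3 inN rankArmCmd)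

section Round

variable {n k : ℕ} {M : MLSD n k} {ε : ℝ} {Z : ℕ} {m : Mem}

/-- The data of arm `i` stored in `m` describe the outcome `a` after `t` rounds. -/
structure ArmState (M : MLSD n k) (a : Option ((ℤ × ℤ) × ℕ)) (i t : ℕ) (m : Mem) : Prop where
  outcome : storedOutcome m i = a
  le : m.nat 18 i 0 0 ≤ M.τmax.toNat
  pos : m.nat 21 i 0 0 = (m.nat 20 i 0 0 + t) % (m.nat 18 i 0 0 + m.nat 19 i 0 0 + 1)

/-- Arm `i` is marked as a candidate of round `t` exactly if it is one, and then its virtual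
payoff is stored. -/
structure Marked (M : MLSD n k) (o : Outcome n) (i : Fin n) (t : ℕ) (m : Mem) : Prop where
  mark : 0 < m.nat 22 i 0 0 ↔ i ∈ candidates o t
  payoff : i ∈ candidates o t → m.real 13 i 0 0 = M.virtualPayoff o t i

theorem ArmState.of_eq {a : Option ((ℤ × ℤ) × ℕ)} {i t : ℕ} (h : ArmState M a i t m) {m' : Mem}
    (h18 : m'.nat 18 i 0 0 = m.nat 18 i 0 0) (h19 : m'.nat 19 i 0 0 = m.nat 19 i 0 0)
    (h20 : m'.nat 20 i 0 0 = m.nat 20 i 0 0) (h21 : m'.nat 21 i 0 0 = m.nat 21 i 0 0) :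
    ArmState M a i t m' := by
  constructor
  · rw [← h.outcome, storedOutcome, storedOutcome, h18, h19, h20]
  · rw [h18]; exact h.le
  · rw [h18, h19, h20, h21]; exact h.pos

theorem det_moveArmCmd (hm : HasInput M ε m) {o : Outcome n} {t : ℕ} {i : Fin n}
    (h3 : m.nat 3 0 0 0 = i) (ha : ArmState M (o i) i t m) :
    Det Z moveArmCmd m fun m' => ArmState M (o i) i (t + 1) m' ∧ Marked M o i (t + 1) m' ∧
      ∀ s ≠ (i : ℕ), (∀ a, m'.nat a s 0 0 = m.nat a s 0 0) ∧
        m'.real 13 s 0 0 = m.real 13 s 0 0 := by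
  set u := m.nat 18 i 0 0 with hu
  set j := m.nat 19 i 0 0 with hj
  set r := m.nat 20 i 0 0 with hr
  set q := (r + (t + 1)) % (u + j + 1) with hq
  have hlt : (r + t) % (u + j + 1) < u + j + 1 := Nat.mod_lt _ (by omega)
  have hqlt : q < u + j + 1 := Nat.mod_lt _ (by omega)
  have hqeq : q =
      if (r + t) % (u + j + 1) + 1 < u + j + 1 then (r + t) % (u + j + 1) + 1 else 0 := by
    rw [hq, ← add_assoc, Nat.add_mod (r + t) 1]
    split_ifs with h
    · rw [Nat.mod_eq_of_lt (show 1 < u + j + 1 by omega), Nat.mod_eq_of_lt h]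
    · rcases Nat.eq_zero_or_pos (u + j) with h0 | h0
      · rw [h0]; omega
      · rw [Nat.mod_eq_of_lt (show 1 < u + j + 1 by omega),
          show (r + t) % (u + j + 1) + 1 = u + j + 1 by omega, Nat.mod_self]
  -- The memory after the move.
  have hmove : ∀ x, ((x = q) → Det Z (.nset 21 (nv 3) (.const 0) (.const 0) (.const x)) m
      fun m' => m'.nat 21 i 0 0 = q ∧ (∀ a, ∀ s : ℕ, (a = 21 → s ≠ i) →
        m'.nat a s 0 0 = m.nat a s 0 0) ∧ m'.real = m.real) := by
    intro x hx
    refine Det.nset ⟨?_, ?_, rfl⟩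
    · simp [setNat_nat_self, NExpr.eval, h3, hx]
    · intro a s h
      simp [Mem.setNat, writeEntry, NExpr.eval, h3]
      intro h1 h2; exact absurd h2 (h h1)
  have h1 : Det Z (.ite (.nlt (.add (.get 21 (nv 3) (.const 0) (.const 0)) (.const 1))
      (.add (.add (.get 18 (nv 3) (.const 0) (.const 0)) (.get 19 (nv 3) (.const 0) (.const 0)))
        (.const 1)))
    (.nset 21 (nv 3) (.const 0) (.const 0) (.add (.get 21 (nv 3) (.const 0) (.const 0)) (.const 1)))
    (.nset 21 (nv 3) (.const 0) (.const 0) (.const 0))) m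
      fun m' => m'.nat 21 i 0 0 = q ∧ (∀ a, ∀ s : ℕ, (a = 21 → s ≠ i) →
        m'.nat a s 0 0 = m.nat a s 0 0) ∧ m'.real = m.real := by
    refine Det.ite (fun hb => ?_) (fun hb => ?_) <;>
      simp only [Test.eval, NExpr.eval, h3, ha.pos, ← hu, ← hj, ← hr] at hb
    · rw [if_pos hb] at hqeq
      refine Det.nset ⟨?_, ?_, rfl⟩
      · simp [setNat_nat_self, NExpr.eval, h3, hqeq, ha.pos]
        rfl
      · intro a s h
        simp [Mem.setNat, writeEntry, NExpr.eval, h3]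
        intro h1 h2; exact absurd h2 (h h1)
    · rw [if_neg hb] at hqeq
      exact hmove 0 hqeq.symm
  refine Det.seq h1 fun m₁ hag₁ ⟨e21, eo, er⟩ => ?_
  have e18 : m₁.nat 18 i 0 0 = u := eo 18 i (by simp)
  have e19 : m₁.nat 19 i 0 0 = j := eo 19 i (by simp)
  have e20 : m₁.nat 20 i 0 0 = r := eo 20 i (by simp)
  have e3 : m₁.nat 3 0 0 0 = i := by rw [eo 3 0 (by simp), h3]
  have hm₁ : HasInput M ε m₁ := hm.of_agree hag₁ (by decide) (by decide) (by decide) (by decide)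
  have ha₁ : ArmState M (o i) i (t + 1) m₁ := by
    refine ⟨?_, ?_, ?_⟩
    · rw [← ha.outcome, storedOutcome, storedOutcome, e18, e19, e20]
    · rw [e18]; exact ha.le
    · rw [e18, e19, e20, e21]
  have hoi : o i = (toInterval (u, j)).map fun I => (I, r) := ha.outcome.symm
  have hcand : i ∈ candidates o (t + 1) ↔ u ≠ 0 ∧ u ≤ q + 1 ∧ q < u + j := by
    simp only [candidates, Finset.mem_filter, Finset.mem_univ, true_and, hoi, toInterval]
    split_ifs with h0
    · simp [h0]
    · simp only [Option.map_some, Option.some.injEq]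
      rw [← isPlay_cycleState hqlt, hq, ← iterate_intervalNext h0]
      constructor
      · rintro ⟨I, r', h', hp⟩
        obtain ⟨rfl, rfl⟩ := Prod.mk.injEq .. ▸ h'
        rw [virtualState_eq_iterate, Nat.add_comm (t + 1) r] at hp
        exact ⟨h0, hp⟩
      · rintro ⟨_, hp⟩
        refine ⟨_, r, rfl, ?_⟩
        rw [virtualState_eq_iterate, Nat.add_comm (t + 1) r]
        exact hp
  have hpay : u ≠ 0 → M.virtualPayoff o (t + 1) i = M.payoff i (cycleState u q) := by
    intro h0
    simp only [MLSD.virtualPayoff, hoi, toInterval, if_neg h0, Option.map_some]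
    rw [virtualState_eq_iterate, Nat.add_comm (t + 1) r, iterate_intervalNext h0]
  refine Det.ite (fun hb => ?_) (fun hb => ?_) <;>
    simp only [Test.eval, NExpr.eval, e3, e18, e19, e21] at hb
  · have hc : i ∈ candidates o (t + 1) := hcand.2 ⟨by omega, by omega, by omega⟩
    refine Det.nset_seq ?_
    set m₂ := m₁.setNat 22 _ _ _ _ with hm₂
    have hag₂ : Agree [22] [] m₁ m₂ := agree_setNat _ _ _ _ _ _ (by simp)
    have f22 : 0 < m₂.nat 22 i 0 0 := by simp [hm₂, setNat_nat_self, NExpr.eval, e3]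
    have f3 : m₂.nat 3 0 0 0 = i := by rw [hag₂.nat 3 (by decide), e3]
    have f21 : m₂.nat 21 i 0 0 = q := by rw [hag₂.nat 21 (by decide), e21]
    have f18 : m₂.nat 18 i 0 0 = u := by rw [hag₂.nat 18 (by decide), e18]
    have fo : ∀ s ≠ (i : ℕ), ∀ a, m₂.nat a s 0 0 = m.nat a s 0 0 := by
      intro s hs a
      rw [← eo a s (fun _ => hs)]
      simp [hm₂, Mem.setNat, writeEntry, NExpr.eval, e3, hs]
    have hin₂ := hm₁.of_agree hag₂ (by decide) (by decide) (by decide) (by decide)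
    have ha₂ : ArmState M (o i) i (t + 1) m₂ := ha₁.of_eq
      (by rw [hag₂.nat 18 (by decide)]) (by rw [hag₂.nat 19 (by decide)])
      (by rw [hag₂.nat 20 (by decide)]) (by rw [hag₂.nat 21 (by decide)])
    have fr : m₂.real = m.real := er
    clear_value m₂
    have hfin : ∀ e : RExpr, e.eval m₂ = M.payoff i (cycleState u q) →
        Det Z (.rset 13 (nv 3) (.const 0) (.const 0) e) m₂ fun m' =>
          ArmState M (o i) i (t + 1) m' ∧ Marked M o i (t + 1) m' ∧
            ∀ s ≠ (i : ℕ), (∀ a, m'.nat a s 0 0 = m.nat a s 0 0) ∧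
              m'.real 13 s 0 0 = m.real 13 s 0 0 := by
      intro e he
      refine Det.rset ⟨ha₂.of_eq rfl rfl rfl rfl, ⟨?_, fun _ => ?_⟩, fun s hs => ⟨fun a => ?_, ?_⟩⟩
      · simpa [hc] using f22
      · rw [hpay (by omega), ← he]
        simp [setReal_real_self, NExpr.eval, f3]
      · exact fo s hs a
      · simp [setReal_real_self, NExpr.eval, f3, hs, fr]
    refine Det.ite (fun hb' => hfin _ ?_) (fun hb' => hfin _ ?_) <;>
      simp only [Test.eval, NExpr.eval, f3, f18, f21] at hb'
    · rw [hin₂.eval_posPayoff (i := i) (u := q + 1) (by simp [NExpr.eval, f3])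
        (by simp [NExpr.eval, f3, f21]) (by omega) (by have := ha.le; omega)]
      simp [cycleState, hb']
    · rw [hin₂.eval_negPayoff (i := i) (j := q - u + 1) (by simp [NExpr.eval, f3])
        (by simp [NExpr.eval, f3, f21, f18]) (by omega)]
      simp only [cycleState, if_neg hb']
      congr 1
      omega
  · have hc : i ∉ candidates o (t + 1) := by
      rw [hcand]; omega
    refine Det.nset ⟨ha₁.of_eq ?_ ?_ ?_ ?_, ⟨?_, fun h => absurd h hc⟩,
      fun s hs => ⟨fun a => ?_, ?_⟩⟩
    · rw [setNat_nat_of_ne _ _ _ _ (by decide)]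
    · rw [setNat_nat_of_ne _ _ _ _ (by decide)]
    · rw [setNat_nat_of_ne _ _ _ _ (by decide)]
    · rw [setNat_nat_of_ne _ _ _ _ (by decide)]
    · simp [hc, setNat_nat_self, NExpr.eval, e3]
    · rw [← eo a s (fun _ => hs)]
      simp [Mem.setNat, writeEntry, NExpr.eval, e3, hs]
    · rw [setNat_real, er]

theorem det_rankArmCmd (hm : HasInput M ε m) (hnZ : n ≤ Z) {o : Outcome n} {t : ℕ} {i : Fin n}
    (h3 : m.nat 3 0 0 0 = i) (ha : ∀ j, Marked M o j t m) :
    Det Z rankArmCmd m fun m' => (m'.nat 1 i 0 0 ≠ 0 ↔ i ∈ M.rankSelection o t) ∧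
      ∀ s ≠ (i : ℕ), m'.nat 1 s 0 0 = m.nat 1 s 0 0 := by
  classical
  refine Det.nset_seq ?_
  set m₀ := m.setNat 23 _ _ _ _ with hm₀
  have hag : Agree [23] [] m m₀ := agree_setNat _ _ _ _ _ _ (by simp)
  have hm0 := hm.of_agree hag (by decide) (by decide) (by decide) (by decide)
  have z23 : m₀.nat 23 0 0 0 = 0 := by simp [hm₀, setNat_nat_self, NExpr.eval]
  clear_value m₀
  set w := M.virtualPayoff o t
  refine Det.seq (R := fun m' => i ∈ candidates o t →
      m'.nat 23 0 0 0 = (preceding (candidates o t) w i).card) ?_ fun m₁ ha₁ h23 => ?_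
  · refine Det.forUp (N := n) (fun s m' => i ∈ candidates o t → m'.nat 23 0 0 0 =
      ((preceding (candidates o t) w i).filter fun j : Fin n => (j : ℕ) < s).card) hnZ (by decide)
      (fun m' h => (hm0.of_agree h (by decide) (by decide) (by decide) (by decide)).eval_inN)
      ?_ ?_ ?_
    · intro _
      rw [setVar_nat_of_ne _ (by decide)]
      simpa using z23
    · intro s hs m₁ ha₁ hc₁ hI
      have e22 : m₁.nat 22 = m.nat 22 := by rw [ha₁.nat 22 (by decide), hag.nat 22 (by decide)]
      have e13 : m₁.real 13 = m.real 13 := by rw [ha₁.real 13 (by decide), hag.real 13 (by decide)]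
      have e3 : m₁.nat 3 0 0 0 = i := by
        rw [ha₁.nat 3 (by decide), hag.nat 3 (by decide), h3]
      have hsucc : (preceding (candidates o t) w i).filter (fun j : Fin n => (j : ℕ) < s + 1) =
          if (⟨s, hs⟩ : Fin n) ∈ preceding (candidates o t) w i then
            insert ⟨s, hs⟩ ((preceding (candidates o t) w i).filter fun j : Fin n => (j : ℕ) < s)
          else (preceding (candidates o t) w i).filter fun j : Fin n => (j : ℕ) < s := by
        ext x
        have hx : (x : ℕ) < s + 1 ↔ (x = ⟨s, hs⟩ ∨ (x : ℕ) < s) := by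
          rw [Fin.ext_iff]; simp only; omega
        split_ifs with h <;> simp only [Finset.mem_filter, Finset.mem_insert, hx]
        · constructor
          · tauto
          · rintro (rfl | h') <;> tauto
        · constructor
          · rintro ⟨h1, rfl | h2⟩ <;> tauto
          · tauto
      have hbtest : i ∈ candidates o t → ((Test.and
        (.nlt (.const 0) (.get 22 (nv 24) (.const 0) (.const 0)))
        (Test.or
          (.rlt (.get 13 (nv 3) (.const 0) (.const 0)) (.get 13 (nv 24) (.const 0) (.const 0)))
          (.and (.not (.rlt (.get 13 (nv 24) (.const 0) (.const 0))
            (.get 13 (nv 3) (.const 0) (.const 0)))) (.nlt (nv 24) (nv 3))))).eval m₁ ↔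
          (⟨s, hs⟩ : Fin n) ∈ preceding (candidates o t) w i) := by
        intro hi
        have hmk := (ha ⟨s, hs⟩).mark
        have hpi := (ha i).payoff hi
        simp only at hmk
        simp only [Test.eval, RExpr.eval, NExpr.eval, hc₁, e3, e22, e13, hmk, preceding,
          Finset.mem_filter, hpi]
        refine and_congr_right fun hsc => ?_
        have hps := (ha ⟨s, hs⟩).payoff hsc
        simp only at hps
        rw [hps]
        simp only [Precedes, Fin.lt_def, not_and_or, not_or, not_lt, not_le]
        rfl
      refine Det.ite (fun hb => Det.nset fun hi => ?_) (fun hb => Det.skip fun hi => ?_)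
      · rw [hsucc, if_pos ((hbtest hi).1 hb), Finset.card_insert_of_notMem (by simp), ← hI hi,
          setVar_nat_of_ne _ (by decide)]
        simp [setNat_nat_self, NExpr.eval]
      · rw [hsucc, if_neg (fun h => hb ((hbtest hi).2 h)), ← hI hi,
          setVar_nat_of_ne _ (by decide)]
    · intro m' _ h hi
      rw [h hi, Finset.filter_true_of_mem]
      exact fun x _ => x.2
  · have e22 : m₁.nat 22 = m.nat 22 := by rw [ha₁.nat 22 (by decide), hag.nat 22 (by decide)]
    have e1 : m₁.nat 1 = m.nat 1 := by rw [ha₁.nat 1 (by decide), hag.nat 1 (by decide)]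
    have e3 : m₁.nat 3 0 0 0 = i := by
      rw [ha₁.nat 3 (by decide), hag.nat 3 (by decide), h3]
    have hin₁ := hm0.of_agree ha₁ (by decide) (by decide) (by decide) (by decide)
    have hk := hin₁.eval_inK
    have hsel : i ∈ M.rankSelection o t ↔ i ∈ candidates o t ∧
        (preceding (candidates o t) w i).card < k := by
      simp [MLSD.rankSelection, topRanked, w]
    have hmk := (ha i).mark
    refine Det.ite (fun hb => Det.nset ⟨?_, fun s hs => ?_⟩)
      (fun hb => Det.nset ⟨?_, fun s hs => ?_⟩)
    all_goals
      first
        | (simp only [setNat_nat_self, NExpr.eval, e3, hs, false_and, if_false, e1])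
        | skip
    all_goals
      simp only [Test.eval] at hb
      rw [hk] at hb
      simp only [NExpr.eval, e22, e3, hmk] at hb
      simp only [setNat_nat_self, NExpr.eval, e3, hsel]
      by_cases hi : i ∈ candidates o t
      · rw [h23 hi] at hb
        simpa [hi] using hb
      · simp [hi] at hb ⊢

/-- The memory after `t` rounds, if the initialization resulted in the outcome `o`. -/
structure RoundState (M : MLSD n k) (ε : ℝ) (o : Outcome n) (t : ℕ) (m : Mem) : Prop where
  input : HasInput M ε m
  arm : ∀ i : Fin n, ArmState M (o i) i t m

theorem det_roundCmd {o : Outcome n} {t : ℕ} (hm : RoundState M ε o t m) (hnZ : n ≤ Z) :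
    Det Z roundCmd m fun m' =>
      RoundState M ε o (t + 1) m' ∧ playedSet n m' = M.rankSelection o (t + 1) := by
  refine Det.seq (R := fun m' => ∀ i : Fin n, ArmState M (o i) i (t + 1) m' ∧
    Marked M o i (t + 1) m') ?_ fun m₁ ha₁ h₁ => ?_
  · refine Det.forUp (N := n) (fun s m' => ∀ i : Fin n,
      ((i : ℕ) < s → ArmState M (o i) i (t + 1) m' ∧ Marked M o i (t + 1) m') ∧
      (s ≤ i → ArmState M (o i) i t m')) hnZ (by decide)
      (fun m' h => (hm.input.of_agree h (by decide) (by decide) (by decide) (by decide)).eval_inN)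
      ?_ ?_ ?_
    · intro i
      refine ⟨fun h => by omega, fun _ => (hm.arm i).of_eq ?_ ?_ ?_ ?_⟩ <;>
        rw [setVar_nat_of_ne _ (by decide)]
    · intro s hs m₁ ha₁ hc₁ hI
      have hin := hm.input.of_agree ha₁ (by decide) (by decide) (by decide) (by decide)
      refine (det_moveArmCmd hin (i := ⟨s, hs⟩) hc₁ ((hI ⟨s, hs⟩).2 le_rfl)).weaken
        fun m₂ ha₂ ⟨h1, h2, h3⟩ i => ?_
      have hvar : ∀ a ≠ 3, (m₂.setVar 3 (s + 1)).nat a = m₂.nat a := fun a ha =>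
        setVar_nat_of_ne _ ha
      refine ⟨fun hi => ?_, fun hi => ?_⟩
      · rcases (show (i : ℕ) < s ∨ (i : ℕ) = s by omega) with h | h
        · obtain ⟨g1, g2⟩ := (hI i).1 h
          obtain ⟨g3, g4⟩ := h3 i (by simp only; omega)
          refine ⟨g1.of_eq ?_ ?_ ?_ ?_, ⟨?_, fun hc => ?_⟩⟩
          · rw [hvar _ (by decide), g3]
          · rw [hvar _ (by decide), g3]
          · rw [hvar _ (by decide), g3]
          · rw [hvar _ (by decide), g3]
          · rw [hvar _ (by decide), g3]; exact g2.mark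
          · rw [setVar_real, g4]; exact g2.payoff hc
        · obtain rfl : i = ⟨s, hs⟩ := Fin.ext h
          refine ⟨h1.of_eq ?_ ?_ ?_ ?_, ⟨?_, fun hc => ?_⟩⟩
          · rw [hvar _ (by decide)]
          · rw [hvar _ (by decide)]
          · rw [hvar _ (by decide)]
          · rw [hvar _ (by decide)]
          · rw [hvar _ (by decide)]; exact h2.mark
          · rw [setVar_real]; exact h2.payoff hc
      · obtain ⟨g3, g4⟩ := h3 i (by simp only; omega)
        refine ((hI i).2 (by omega)).of_eq ?_ ?_ ?_ ?_ <;> rw [hvar _ (by decide), g3]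
    · intro m' _ h i
      exact (h i).1 i.2
  · have hin₁ := hm.input.of_agree ha₁ (by decide) (by decide) (by decide) (by decide)
    refine Det.forUp (N := n) (fun s m' => ∀ i : Fin n, (i : ℕ) < s →
      (m'.nat 1 i 0 0 ≠ 0 ↔ i ∈ M.rankSelection o (t + 1))) hnZ (by decide)
      (fun m' h => (hin₁.of_agree h (by decide) (by decide) (by decide) (by decide)).eval_inN)
      ?_ ?_ ?_
    · intro i hi; omega
    · intro s hs m₂ ha₂ hc₂ hI
      have hin := hin₁.of_agree ha₂ (by decide) (by decide) (by decide) (by decide)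
      refine (det_rankArmCmd hin hnZ (i := ⟨s, hs⟩) (o := o) (t := t + 1) hc₂ fun j => ?_).weaken
        fun m₃ _ ⟨h2, h3⟩ i hi => ?_
      · refine ⟨?_, fun hc => ?_⟩
        · rw [ha₂.nat 22 (by decide)]; exact (h₁ j).2.mark
        · rw [ha₂.real 13 (by decide)]; exact (h₁ j).2.payoff hc
      · rw [setVar_nat_of_ne _ (by decide)]
        rcases (show (i : ℕ) < s ∨ (i : ℕ) = s by omega) with h | h
        · rw [h3 i (by simp only; omega)]
          exact hI i h
        · obtain rfl : i = ⟨s, hs⟩ := Fin.ext h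
          exact h2
    · intro m₂ ha₂ h
      refine ⟨⟨hin₁.of_agree ha₂ (by decide) (by decide) (by decide) (by decide), fun i => ?_⟩, ?_⟩
      · refine (h₁ i).1.of_eq ?_ ?_ ?_ ?_ <;> rw [ha₂.nat _ (by decide)]
      · ext i
        simp only [playedSet, Finset.mem_filter, Finset.mem_univ, true_and]
        exact h i i.2

/-- The program that implements the algorithm. -/
def lpProgram : OnlineProgram := ⟨initCmd, roundCmd⟩

theorem exec_round {o : Outcome n} {t : ℕ} (hm : RoundState M ε o t m) (hnZ : n ≤ Z) {B : ℕ}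
    (hB : roundCmd.cost Z ≤ B) : ∃ m', exec B roundCmd m = PMF.pure m' ∧
      RoundState M ε o (t + 1) m' ∧ playedSet n m' = M.rankSelection o (t + 1) :=
  let ⟨m', h, hr⟩ := det_roundCmd (Z := Z) hm hnZ
  ⟨m', hr.exec hB, h⟩

theorem roundsLaw_eq {o : Outcome n} (hnZ : n ≤ Z) {B : ℕ} (hB : roundCmd.cost Z ≤ B) (T : ℕ) :
    ∀ t m, RoundState M ε o t m → lpProgram.roundsLaw B n T m =
      PMF.pure fun s : Fin T => M.rankSelection o (t + s + 1) := by
  induction T with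
  | zero =>
    intro t m _
    simp only [OnlineProgram.roundsLaw]
    congr 1
    exact funext fun i => i.elim0
  | succ T ih =>
    intro t m hm
    obtain ⟨m', he, hm', hp⟩ := exec_round hm hnZ hB
    simp only [OnlineProgram.roundsLaw]
    rw [show lpProgram.round = roundCmd from rfl, he, PMF.pure_bind, ih (t + 1) m' hm',
      PMF.pure_map, hp]
    congr 1
    funext s
    refine Fin.cases ?_ (fun s => ?_) s
    · simp
    · simp only [Fin.cons_succ, Fin.val_succ]
      congr 1; omega

/-- The program runs in polynomial time and implements the algorithm.  The number of iterations of
every loop is at most `n + τmax + 1 + ⌈1 / ε⌉`, so `Cmd.cost_le` gives the polynomial. -/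
theorem lpProgram_implements : ∃ c d : ℕ, ∀ (n k : ℕ) (M : MLSD n k) (ε : ℝ), 0 < ε → ε < 1 →
    ∃ B : ℕ, (B : ℝ) ≤ c * (n + M.τmax + 1 / ε) ^ d ∧ lpProgram.RunsWithin B (M.input ε) ∧
      ∃ (x : Fin n → ℤ × ℤ → ℝ) (hx : M.IsOptimal (-⌈1 / ε⌉) x)
        (sel : Outcome n → ℕ → Finset (Fin n)), M.IsSelection sel ∧
        ∀ T : ℕ, lpProgram.playLaw B n T (M.input ε) = M.algorithmLaw hx.1 sel T := by
  obtain ⟨A, d, hA⟩ := Cmd.cost_le (.seq initCmd roundCmd)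
  refine ⟨A * 2 ^ d, d, fun n k M ε hε hε1 => ?_⟩
  have hk := M.k_lt
  have hτ := M.τmax_pos
  have hinv : 1 < 1 / ε := by rw [lt_div_iff₀ hε]; linarith
  have hL : 1 ≤ ⌈1 / ε⌉₊ := Nat.one_le_ceil_iff.2 (by positivity)
  set Z : ℕ := n + M.τmax.toNat + 1 + ⌈1 / ε⌉₊ with hZ
  have hcost := hA Z (by omega)
  set B : ℕ := (Cmd.seq initCmd roundCmd).cost Z with hB
  have hBi : initCmd.cost Z ≤ B := by simp only [hB, Cmd.cost]; omega
  have hBr : roundCmd.cost Z ≤ B := by simp only [hB, Cmd.cost]; omega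
  have hceil : (-⌈1 / ε⌉ : ℤ) = -((⌈1 / ε⌉₊ : ℕ) : ℤ) := by
    rw [Int.natCast_ceil_eq_ceil (by positivity)]
  have hin : HasInput M ε (M.input ε) := ⟨rfl, rfl, rfl, rfl⟩
  obtain ⟨lam, lo, hi, h, μ, hr, hlaw, hsup⟩ := runs_initCmd (Z := Z) hin hε (by omega) (by omega)
    (by omega)
  have hstate : ∀ m ∈ μ.support, RoundState M ε (fun i : Fin n => storedOutcome m i) 0 m := by
    intro m hm
    obtain ⟨h1, h2⟩ := hsup m hm
    refine ⟨h1, fun i => ⟨rfl, (h2 i).1, ?_⟩⟩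
    rw [(h2 i).2.2, add_zero, Nat.mod_eq_of_lt (h2 i).2.1]
  have hinit : exec B lpProgram.init (M.input ε) = μ := hr.exec hBi
  refine ⟨B, ?_, ⟨hr.haltsWithin hBi, ?_⟩, ?_⟩
  · have hn1 : (1 : ℝ) ≤ n := by exact_mod_cast (show 1 ≤ n by omega)
    have hτ1 : (1 : ℝ) ≤ M.τmax := by exact_mod_cast hτ
    have hτ2 : ((M.τmax.toNat : ℕ) : ℝ) = M.τmax := by
      have : ((M.τmax.toNat : ℤ) : ℝ) = M.τmax := by rw [Int.toNat_of_nonneg hτ.le]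
      exact_mod_cast this
    have hZ' : (Z : ℝ) ≤ 2 * (n + M.τmax + 1 / ε) := by
      have := Nat.ceil_lt_add_one (show 0 ≤ 1 / ε by positivity)
      rw [hZ]; push_cast; rw [hτ2]; linarith
    calc (B : ℝ) ≤ A * (Z : ℝ) ^ d := by exact_mod_cast hcost
      _ ≤ A * (2 * (n + M.τmax + 1 / ε)) ^ d := by gcongr
      _ = _ := by rw [mul_pow]; push_cast; ring
  · have hmem : ∀ t, ∀ m ∈ (lpProgram.memAfter B (M.input ε) t).support,
        ∃ o, RoundState M ε o t m := by
      intro t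
      induction t with
      | zero =>
        intro m hm
        rw [OnlineProgram.memAfter, hinit] at hm
        exact ⟨_, hstate m hm⟩
      | succ t ih =>
        intro m hm
        rw [OnlineProgram.memAfter, PMF.mem_support_bind_iff] at hm
        obtain ⟨m₁, hm₁, hm⟩ := hm
        obtain ⟨o, ho⟩ := ih m₁ hm₁
        obtain ⟨m', he, hm', _⟩ := exec_round ho (Z := Z) (by omega) hBr
        rw [show lpProgram.round = roundCmd from rfl, he] at hm
        simp at hm
        exact ⟨o, hm ▸ hm'⟩
    intro t m hm
    obtain ⟨o, ho⟩ := hmem t m hm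
    obtain ⟨m', _, hr'⟩ := det_roundCmd (Z := Z) ho (by omega)
    exact hr'.haltsWithin hBr
  · rw [hceil]
    refine ⟨_, h.isOptimal hL, M.rankSelection, M.isSelection_rankSelection, fun T => ?_⟩
    rw [OnlineProgram.playLaw, hinit, MLSD.algorithmLaw, ← hlaw, PMF.map_comp, PMF.map]
    refine PMF.bind_congr_support fun m hm => ?_
    rw [roundsLaw_eq (Z := Z) (by omega) hBr T 0 m (hstate m hm)]
    simp only [Function.comp]
    congr 1
    funext s
    congr 1
    omega

end Round

/-! ### The linear program bounds the optimum -/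

namespace MLSD

variable {n k : ℕ} (M : MLSD n k)

theorem negSum_nonneg (i : Fin n) (j : ℕ) : 0 ≤ M.negSum i j :=
  Finset.sum_nonneg fun s _ => M.payoff_nonneg i _ (by omega)

theorem aggregated_nonneg (i : Fin n) {u : ℤ} (hu : u ≠ 0) (j : ℕ) :
    0 ≤ M.aggregated i u (-((j : ℤ) + 1)) := by
  rw [aggregated_eq]
  exact add_nonneg (M.payoff_nonneg i u hu) (M.negSum_nonneg i j)

theorem payoff_le_of_le (i : Fin n) {τ σ : ℤ} (hτ : τ ≠ 0) (hσ : σ ≠ 0) (h : τ ≤ σ) :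
    M.payoff i τ ≤ M.payoff i σ := by
  rcases h.eq_or_lt with rfl | h
  · exact le_rfl
  · exact M.payoff_mono i τ σ hτ hσ h

/-- A dual solution of the linear program bounds the payoff of every recurrent interval, up to the
factor `1 - ε`.  The plays of `I(u, l)` beyond the first `L` ones are charged to fractional copies
of `I(1, -L)`, which has `L` plays in `L + 1` rounds. -/
theorem aggregated_le_dual {L : ℕ} {ε lam : ℝ} (hε : 0 < ε) (hL : 1 / ε ≤ L) (hlam : 0 ≤ lam)
    {i : Fin n} {g : ℝ} (hg : 0 ≤ g)
    (hdual : ∀ I ∈ M.box (-L), M.aggregated i I.1 I.2 ≤ lam * -(I.2 : ℝ) + g * ((I.1 : ℝ) - I.2))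
    {u : ℕ} (hu : 1 ≤ u) (j : ℕ) :
    (1 - ε) * M.aggregated i u (-((j : ℤ) + 1)) ≤ lam * (j + 1) + g * (u + (j + 1)) := by
  have hL1 : 1 ≤ L := by
    by_contra h
    have : L = 0 := by omega
    rw [this] at hL
    have : 0 < 1 / ε := by positivity
    simp at hL
    linarith
  have hnn : ∀ j : ℕ, 0 ≤ M.aggregated i u (-((j : ℤ) + 1)) := fun j =>
    M.aggregated_nonneg i (by omega) j
  -- Waiting beyond `τmax` does not pay.
  have hshort : ∀ (v : ℕ), 1 ≤ v → ∀ j < L,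
      M.aggregated i v (-((j : ℤ) + 1)) ≤ lam * (j + 1) + g * (v + (j + 1)) := by
    intro v hv j hj
    rcases le_or_gt (v : ℤ) M.τmax with h | h
    · have := hdual (v, -((j : ℤ) + 1)) (by
        simp only [box, Finset.mem_product, Finset.mem_Icc]; omega)
      push_cast at this
      linarith
    · have := hdual (M.τmax, -((j : ℤ) + 1)) (by
        have := M.τmax_pos
        simp only [box, Finset.mem_product, Finset.mem_Icc]; omega)
      have hle : (M.τmax : ℝ) ≤ v := by exact_mod_cast h.le
      have heq : M.aggregated i v (-((j : ℤ) + 1)) = M.aggregated i M.τmax (-((j : ℤ) + 1)) := by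
        rw [aggregated, aggregated, M.saturation_max i _ h]
      push_cast at this
      rw [heq]
      nlinarith
  rcases lt_or_ge j L with hj | hj
  · have := hshort u hu j hj
    have := hnn j
    nlinarith
  · obtain ⟨N, rfl⟩ : ∃ N, L = N + 1 := ⟨L - 1, by omega⟩
    obtain ⟨R, rfl⟩ : ∃ R, j = N + R := ⟨j - N, by omega⟩
    set b := M.payoff i (-((N : ℤ) + 1)) with hb
    have hb0 : 0 ≤ b := M.payoff_nonneg i _ (by omega)
    have h1 : M.aggregated i u (-(((N + R : ℕ) : ℤ) + 1))
        ≤ M.aggregated i u (-((N : ℤ) + 1)) + R * b := by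
      rw [aggregated_eq, aggregated_eq, negSum, Finset.sum_range_add, ← negSum]
      have : ∑ x ∈ Finset.range R, M.payoff i (-(((N + x : ℕ) : ℤ) + 1))
          ≤ ∑ x ∈ Finset.range R, b := Finset.sum_le_sum fun x _ =>
        M.payoff_le_of_le i (by omega) (by omega) (by omega)
      simp only [Finset.sum_const, Finset.card_range, nsmul_eq_mul] at this
      linarith
    have h2 : (N + 1) * b ≤ M.aggregated i (1 : ℕ) (-((N : ℤ) + 1)) := by
      rw [aggregated_eq, negSum]
      have h3 : ∑ x ∈ Finset.range N, b ≤ ∑ x ∈ Finset.range N, M.payoff i (-((x : ℤ) + 1)) :=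
        Finset.sum_le_sum fun x hx => M.payoff_le_of_le i (by omega) (by omega) (by
          simp at hx; omega)
      have h4 : b ≤ M.payoff i (1 : ℕ) := M.payoff_le_of_le i (by omega) (by omega) (by
        push_cast; omega)
      simp only [Finset.sum_const, Finset.card_range, nsmul_eq_mul] at h3
      linarith
    have h5 := hshort u hu N (by omega)
    have h6 := hshort 1 le_rfl N (by omega)
    push_cast at h5 h6 hL ⊢
    have hεL : 1 ≤ ε * (N + 1) := by
      rw [div_le_iff₀ hε] at hL; linarith
    set D : ℝ := (R : ℝ) / (N + 2) with hD
    have hD0 : 0 ≤ D := by positivity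
    have hDR : D * (N + 2) = R := by
      rw [hD]; field_simp
    have h7 : (1 - ε) * (R * b) ≤ D * ((N + 1) * b) := by
      have : (1 - ε) * (N + 2) ≤ N + 1 := by nlinarith
      have h8 : 0 ≤ D * b := mul_nonneg hD0 hb0
      calc (1 - ε) * (R * b) = (1 - ε) * (N + 2) * (D * b) := by rw [← hDR]; ring
        _ ≤ (N + 1) * (D * b) := mul_le_mul_of_nonneg_right this h8
        _ = _ := by ring
    have h9 : D * ((N + 1) * b) ≤ D * (lam * (N + 1) + g * (1 + (N + 1))) :=
      mul_le_mul_of_nonneg_left (by push_cast at h2; linarith) hD0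
    have h10 : D * (lam * (N + 1) + g * (1 + (N + 1))) ≤ lam * R + g * R := by
      have : D * (N + 1) ≤ R := by nlinarith
      have h11 := mul_le_mul_of_nonneg_left this hlam
      have : D * (g * (1 + (N + 1))) = g * R := by rw [← hDR]; ring
      nlinarith
    have h12 : (1 - ε) * M.aggregated i u (-((N : ℤ) + 1)) ≤ M.aggregated i u (-((N : ℤ) + 1)) := by
      have := hnn N
      nlinarith
    rcases le_or_gt 0 (1 - ε) with h13 | h13
    · have := mul_le_mul_of_nonneg_left h1 h13
      push_cast at this
      nlinarith
    · have := hnn (N + R)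
      push_cast at this
      have h14 : (1 - ε) * M.aggregated i u (-((N : ℤ) + R + 1)) ≤ 0 :=
        mul_nonpos_of_nonpos_of_nonneg h13.le this
      refine h14.trans ?_
      positivity

section Schedule

variable {T : ℕ} (A : Schedule n T)

/-- Arm `i` is played at round `t + 1`. -/
def Plays (i : Fin n) (t : ℕ) : Prop := ∃ h : t < T, i ∈ A ⟨t, h⟩

open Classical in
/-- The payoff collected from arm `i` in the first `t` rounds. -/
def collected (i : Fin n) (t : ℕ) : ℝ :=
  ∑ s ∈ Finset.range t, if Plays A i s then M.payoff i (armState A i s) else 0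

open Classical in
/-- The number of plays of arm `i` in the first `t` rounds. -/
def playCount (i : Fin n) (t : ℕ) : ℝ :=
  ∑ s ∈ Finset.range t, if Plays A i s then 1 else 0

theorem total_eq_sum_collected : M.total A = ∑ i, M.collected A i T := by
  classical
  unfold total collected
  simp only [Finset.sum_range]
  rw [Finset.sum_comm]
  refine Finset.sum_congr rfl fun t _ => ?_
  rw [← Finset.sum_filter]
  refine Finset.sum_congr ?_ fun _ _ => rfl
  ext i
  simp [Plays]

theorem sum_playCount_le (hA : ∀ t, (A t).card ≤ k) : ∑ i, playCount A i T ≤ k * T := by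
  classical
  unfold playCount
  simp only [Finset.sum_range]
  rw [Finset.sum_comm]
  have : ∀ t : Fin T, ∑ i, (if Plays A i t then (1 : ℝ) else 0) ≤ k := by
    intro t
    rw [← Finset.sum_filter, Finset.sum_const, nsmul_eq_mul, mul_one]
    have : (Finset.univ.filter fun i => Plays A i t) = A t := by ext i; simp [Plays]
    rw [this]
    exact_mod_cast hA t
  calc _ ≤ ∑ _t : Fin T, (k : ℝ) := Finset.sum_le_sum fun t _ => this t
    _ = _ := by simp [mul_comm]

/-- Invariant of a trajectory: in a state `a > 0` all cycles completed so far are charged to the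
dual solution; in a state `-(j + 1)` the cycle that is going on, of the interval
`I(u, -(j + 1))`, is excluded. -/
def Charged (ε lam g : ℝ) (i : Fin n) (t : ℕ) : Prop :=
  (∃ a : ℕ, 1 ≤ a ∧ armState A i t = a ∧
    (1 - ε) * M.collected A i t ≤ lam * playCount A i t + g * (t + 1 - a)) ∨
  (∃ u j : ℕ, 1 ≤ u ∧ armState A i t = -((j : ℤ) + 1) ∧
    (1 - ε) * (M.collected A i t - M.aggregated i u (-((j : ℤ) + 1)))
      ≤ lam * (playCount A i t - (j + 1)) + g * (t + 1 - u - (j + 1)))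

theorem collected_le_dual {ε lam g : ℝ} {i : Fin n} (hg : 0 ≤ g)
    (hcycle : ∀ u j : ℕ, 1 ≤ u → (1 - ε) * M.aggregated i u (-((j : ℤ) + 1))
      ≤ lam * (j + 1) + g * (u + (j + 1))) (t : ℕ) :
    (1 - ε) * M.collected A i t ≤ lam * playCount A i t + g * (t + 1) := by
  classical
  have key : M.Charged A ε lam g i t := by
    induction t with
    | zero => exact Or.inl ⟨1, le_rfl, rfl, by simp [collected, playCount]⟩
    | succ t ih =>
      have hst : armState A i (t + 1) = nextState (Plays A i t) (armState A i t) := rfl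
      have hc : M.collected A i (t + 1) = M.collected A i t
          + if Plays A i t then M.payoff i (armState A i t) else 0 := Finset.sum_range_succ _ _
      have hp : playCount A i (t + 1) = playCount A i t + if Plays A i t then 1 else 0 :=
        Finset.sum_range_succ _ _
      rcases ih with ⟨a, ha, hs, hle⟩ | ⟨u, j, hu, hs, hle⟩
      · by_cases hpl : Plays A i t
        · refine Or.inr ⟨a, 0, ha, ?_, ?_⟩
          · rw [hst, hs, nextState, if_pos hpl, if_neg (by omega)]; simp
          · rw [hc, hp, if_pos hpl, if_pos hpl, hs, aggregated_eq]
            simp only [negSum, Finset.range_zero, Finset.sum_empty]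
            push_cast
            have e1 : M.collected A i t + M.payoff i a - (M.payoff i a + 0)
                = M.collected A i t := by ring
            rw [e1]
            linarith
        · refine Or.inl ⟨a + 1, by omega, ?_, ?_⟩
          · rw [hst, hs, nextState, if_neg hpl, if_neg (by omega)]; push_cast; ring
          · rw [hc, hp, if_neg hpl, if_neg hpl]
            push_cast
            linarith
      · by_cases hpl : Plays A i t
        · refine Or.inr ⟨u, j + 1, hu, ?_, ?_⟩
          · rw [hst, hs, nextState, if_pos hpl, if_pos (by omega)]; push_cast; ring
          · rw [hc, hp, if_pos hpl, if_pos hpl, hs]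
            have e1 : M.aggregated i u (-(((j + 1 : ℕ) : ℤ) + 1))
                = M.aggregated i u (-((j : ℤ) + 1)) + M.payoff i (-((j : ℤ) + 1)) := by
              rw [aggregated_eq, aggregated_eq, negSum, Finset.sum_range_succ, ← negSum]; ring
            rw [e1]
            push_cast
            have e2 : M.collected A i t + M.payoff i (-((j : ℤ) + 1))
                - (M.aggregated i u (-((j : ℤ) + 1)) + M.payoff i (-((j : ℤ) + 1)))
                = M.collected A i t - M.aggregated i u (-((j : ℤ) + 1)) := by ring
            rw [e2]
            linarith
        · refine Or.inl ⟨1, le_rfl, ?_, ?_⟩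
          · rw [hst, hs, nextState, if_neg hpl, if_pos (by omega)]; simp
          · rw [hc, hp, if_neg hpl, if_neg hpl]
            have := hcycle u j hu
            push_cast
            linarith
  rcases key with ⟨a, ha, _, hle⟩ | ⟨u, j, hu, _, hle⟩
  · have : (1 : ℝ) ≤ a := by exact_mod_cast ha
    nlinarith
  · have := hcycle u j hu
    linarith

end Schedule

theorem sum_toReal_eq_one {α : Type} [Fintype α] (μ : PMF α) : ∑ a, (μ a).toReal = 1 := by
  rw [← ENNReal.toReal_sum fun a _ => PMF.apply_ne_top μ a]
  have := μ.tsum_coe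
  rw [tsum_fintype] at this
  simp [this]

/-- Upper bound for the optimum by a dual solution of the linear program. -/
theorem OPT_le_dual {L : ℕ} {ε lam : ℝ} (hε : 0 < ε) (hε1 : ε < 1) (hL : 1 / ε ≤ L)
    (hlam : 0 ≤ lam) {g : Fin n → ℝ} (hg : ∀ i, 0 ≤ g i)
    (hdual : ∀ i, ∀ I ∈ M.box (-L),
      M.aggregated i I.1 I.2 ≤ lam * -(I.2 : ℝ) + g i * ((I.1 : ℝ) - I.2)) (T : ℕ) :
    (1 - ε) * M.OPT T ≤ (T + 1) * (k * lam + ∑ i, g i) := by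
  have h1 : ∀ A : Schedule n T, (∀ t, (A t).card ≤ k) →
      (1 - ε) * M.total A ≤ (T + 1) * (k * lam + ∑ i, g i) := by
    intro A hA
    have h2 := fun i => M.collected_le_dual A (hg i) (fun u j hu =>
      M.aggregated_le_dual hε hL hlam (hg i) (hdual i) hu j) T
    have h3 := Finset.sum_le_sum fun i (_ : i ∈ Finset.univ) => h2 i
    rw [← Finset.mul_sum, ← total_eq_sum_collected, Finset.sum_add_distrib, ← Finset.mul_sum,
      ← Finset.sum_mul] at h3
    have h4 := mul_le_mul_of_nonneg_left (sum_playCount_le A hA) hlam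
    have h5 : 0 ≤ k * lam := by positivity
    nlinarith
  have hpos : 0 < 1 - ε := by linarith
  rw [mul_comm, ← le_div_iff₀ hpos]
  have : Nonempty {μ : PMF (Schedule n T) // ∀ A ∈ μ.support, ∀ t, (A t).card ≤ k} :=
    ⟨⟨PMF.pure fun _ => ∅, by intro A hA t; simp at hA; subst hA; simp⟩⟩
  refine ciSup_le fun μ => ?_
  rw [le_div_iff₀ hpos, mul_comm, expectedTotal, Finset.mul_sum]
  calc ∑ A, (1 - ε) * ((μ.1 A).toReal * M.total A)
      ≤ ∑ A, (μ.1 A).toReal * ((T + 1) * (k * lam + ∑ i, g i)) := by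
        refine Finset.sum_le_sum fun A _ => ?_
        by_cases hA : A ∈ μ.1.support
        · have := mul_le_mul_of_nonneg_left (h1 A (μ.2 A hA))
            (ENNReal.toReal_nonneg (a := μ.1 A))
          linarith
        · have : μ.1 A = 0 := by simpa [PMF.mem_support_iff] using hA
          simp [this]
    _ = _ := by rw [← Finset.sum_mul, sum_toReal_eq_one, one_mul]

end MLSD

/-! ### Truncated Poisson variables -/

/-- The probability that a Poisson variable of mean `x` equals `m`. -/
def poissonTerm (m : ℕ) (x : ℝ) : ℝ := Real.exp (-x) * x ^ m / m.factorial

/-- The probability that a Poisson variable of mean `x` is less than `j`. -/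
def poissonLt (j : ℕ) (x : ℝ) : ℝ := ∑ m ∈ Finset.range j, poissonTerm m x

/-- The expectation of `min j X` for a Poisson variable `X` of mean `x`, as a sum of tail
probabilities. -/
def poissonMin (j : ℕ) (x : ℝ) : ℝ := ∑ i ∈ Finset.range j, (1 - poissonLt (i + 1) x)

theorem poissonLt_succ (j : ℕ) (x : ℝ) : poissonLt (j + 1) x = poissonLt j x + poissonTerm j x :=
  Finset.sum_range_succ _ _

theorem poissonMin_succ (j : ℕ) (x : ℝ) :
    poissonMin (j + 1) x = poissonMin j x + (1 - poissonLt (j + 1) x) := Finset.sum_range_succ _ _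

theorem poissonTerm_nonneg (m : ℕ) {x : ℝ} (hx : 0 ≤ x) : 0 ≤ poissonTerm m x := by
  unfold poissonTerm; positivity

theorem poissonLt_le_one (j : ℕ) {x : ℝ} (hx : 0 ≤ x) : poissonLt j x ≤ 1 := by
  have h := Real.sum_le_exp_of_nonneg hx j
  have : poissonLt j x = Real.exp (-x) * ∑ i ∈ Finset.range j, x ^ i / (i.factorial : ℝ) := by
    rw [Finset.mul_sum]
    exact Finset.sum_congr rfl fun m _ => by unfold poissonTerm; ring
  rw [this]
  calc _ ≤ Real.exp (-x) * Real.exp x := by gcongr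
    _ = 1 := by rw [← Real.exp_add]; simp

theorem poissonMin_nonneg (j : ℕ) {x : ℝ} (hx : 0 ≤ x) : 0 ≤ poissonMin j x :=
  Finset.sum_nonneg fun _ _ => sub_nonneg.2 (poissonLt_le_one _ hx)

theorem succ_mul_poissonTerm (m : ℕ) (x : ℝ) :
    ((m : ℝ) + 1) * poissonTerm (m + 1) x = x * poissonTerm m x := by
  unfold poissonTerm
  rw [Nat.factorial_succ]
  have : (m.factorial : ℝ) ≠ 0 := by positivity
  have : (m : ℝ) + 1 ≠ 0 := by positivity
  push_cast
  field_simp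
  ring

theorem hasDerivAt_poissonTerm_zero (x : ℝ) :
    HasDerivAt (poissonTerm 0) (-poissonTerm 0 x) x := by
  have h : HasDerivAt (fun x : ℝ => Real.exp (-x)) (Real.exp (-x) * (-1)) x :=
    (Real.hasDerivAt_exp _).comp x (hasDerivAt_neg x)
  have e : poissonTerm 0 = fun x : ℝ => Real.exp (-x) := by funext y; simp [poissonTerm]
  rw [e]
  simpa using h

theorem hasDerivAt_poissonTerm_succ (m : ℕ) (x : ℝ) :
    HasDerivAt (poissonTerm (m + 1)) (poissonTerm m x - poissonTerm (m + 1) x) x := by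
  have h : HasDerivAt (fun x : ℝ => Real.exp (-x)) (Real.exp (-x) * (-1)) x :=
    (Real.hasDerivAt_exp _).comp x (hasDerivAt_neg x)
  have h2 := ((h.mul (hasDerivAt_pow (m + 1) x)).div_const ((m + 1).factorial : ℝ))
  refine h2.congr_deriv ?_
  unfold poissonTerm
  rw [Nat.factorial_succ]
  have : (m.factorial : ℝ) ≠ 0 := by positivity
  have : (m : ℝ) + 1 ≠ 0 := by positivity
  push_cast
  field_simp
  ring

theorem hasDerivAt_poissonLt_succ (j : ℕ) (x : ℝ) :
    HasDerivAt (poissonLt (j + 1)) (-poissonTerm j x) x := by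
  induction j with
  | zero =>
    have : poissonLt (0 + 1) = poissonTerm 0 := by funext y; simp [poissonLt]
    rw [this]
    exact hasDerivAt_poissonTerm_zero x
  | succ j ih =>
    have : poissonLt (j + 1 + 1) = poissonLt (j + 1) + poissonTerm (j + 1) := by
      funext y; exact poissonLt_succ _ _
    rw [this]
    refine (ih.add (hasDerivAt_poissonTerm_succ j x)).congr_deriv ?_
    ring

theorem hasDerivAt_poissonMin (j : ℕ) (x : ℝ) :
    HasDerivAt (poissonMin j) (poissonLt j x) x := by
  induction j with
  | zero =>
    have : poissonMin 0 = fun _ => 0 := by funext y; simp [poissonMin]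
    rw [this]
    simpa [poissonLt] using hasDerivAt_const x (0 : ℝ)
  | succ j ih =>
    have : poissonMin (j + 1) = poissonMin j + fun y => 1 - poissonLt (j + 1) y := by
      funext y; exact poissonMin_succ _ _
    rw [this]
    refine (ih.add ((hasDerivAt_poissonLt_succ j x).const_sub 1)).congr_deriv ?_
    rw [poissonLt_succ]
    ring

theorem poissonLt_anti (j : ℕ) {x y : ℝ} (hx : 0 ≤ x) (hxy : x ≤ y) :
    poissonLt j y ≤ poissonLt j x := by
  cases j with
  | zero => simp [poissonLt]
  | succ j =>
    have : AntitoneOn (poissonLt (j + 1)) (Set.Ici 0) := by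
      refine antitoneOn_of_deriv_nonpos (convex_Ici 0)
        (fun z _ => (hasDerivAt_poissonLt_succ j z).continuousAt.continuousWithinAt)
        (fun z _ => (hasDerivAt_poissonLt_succ j z).differentiableAt.differentiableWithinAt) ?_
      intro z hz
      rw [interior_Ici] at hz
      rw [(hasDerivAt_poissonLt_succ j z).deriv]
      have := poissonTerm_nonneg j (le_of_lt hz)
      linarith
    exact this hx (hx.trans hxy) hxy

/-- The function `poissonMin j` is concave: it lies below its tangents. -/
theorem poissonMin_le_tangent (j : ℕ) {x y : ℝ} (hx : 0 ≤ x) (hy : 0 ≤ y) :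
    poissonMin j y ≤ poissonMin j x + (y - x) * poissonLt j x := by
  rcases lt_trichotomy x y with h | h | h
  · obtain ⟨z, hz, he⟩ := exists_hasDerivAt_eq_slope (poissonMin j) (poissonLt j) h
      (fun z _ => (hasDerivAt_poissonMin j z).continuousAt.continuousWithinAt)
      (fun z _ => hasDerivAt_poissonMin j z)
    have h1 := poissonLt_anti j hx hz.1.le
    rw [he, div_le_iff₀ (by linarith)] at h1
    linarith
  · simp [h]
  · obtain ⟨z, hz, he⟩ := exists_hasDerivAt_eq_slope (poissonMin j) (poissonLt j) h
      (fun z _ => (hasDerivAt_poissonMin j z).continuousAt.continuousWithinAt)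
      (fun z _ => hasDerivAt_poissonMin j z)
    have h1 := poissonLt_anti j (hy.trans hz.1.le) hz.2.le
    rw [he, le_div_iff₀ (by linarith)] at h1
    linarith

theorem poissonMin_zero_right (j : ℕ) : poissonMin j 0 = 0 := by
  refine Finset.sum_eq_zero fun i _ => ?_
  rw [poissonLt, Finset.sum_range_succ']
  simp [poissonTerm]

/-- Closed form of the truncated expectation. -/
theorem poissonMin_eq (j : ℕ) (x : ℝ) :
    poissonMin j x = j * (1 - poissonLt j x) + x * poissonLt j x - j * poissonTerm j x := by
  induction j with
  | zero => simp [poissonMin, poissonLt]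
  | succ j ih =>
    have := succ_mul_poissonTerm j x
    rw [poissonMin_succ, ih, poissonLt_succ]
    push_cast
    linear_combination this

/-- The factor `1 - k ^ k / (e ^ k * k!)`. -/
def gapFactor (k : ℕ) : ℝ := 1 - (k : ℝ) ^ k / (Real.exp 1 ^ k * (k.factorial : ℝ))

theorem poissonMin_self (k : ℕ) : poissonMin k k = k * gapFactor k := by
  rw [poissonMin_eq, gapFactor, poissonTerm, Real.exp_neg, ← Real.exp_nat_mul, mul_one]
  have : Real.exp (k : ℝ) ≠ 0 := (Real.exp_pos _).ne'
  have : (k.factorial : ℝ) ≠ 0 := by positivity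
  field_simp
  ring

theorem gapFactor_zero : gapFactor 0 = 0 := by simp [gapFactor]

theorem gapFactor_le_one (k : ℕ) : gapFactor k ≤ 1 := by
  unfold gapFactor
  have : 0 ≤ (k : ℝ) ^ k / (Real.exp 1 ^ k * (k.factorial : ℝ)) := by positivity
  linarith

theorem gapFactor_nonneg (k : ℕ) : 0 ≤ gapFactor k := by
  rcases Nat.eq_zero_or_pos k with rfl | h
  · exact gapFactor_zero.ge
  · have h1 := poissonMin_nonneg k (Nat.cast_nonneg (α := ℝ) k)
    rw [poissonMin_self] at h1
    have h2 : (0 : ℝ) < k := by exact_mod_cast h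
    exact nonneg_of_mul_nonneg_right h1 h2

/-- By concavity, the ratio of the truncated to the full expectation is smallest at mean `k`. -/
theorem gapFactor_mul_le (k : ℕ) {x : ℝ} (hx : 0 ≤ x) (hxk : x ≤ k) :
    gapFactor k * x ≤ poissonMin k x := by
  rcases Nat.eq_zero_or_pos k with rfl | h
  · rw [gapFactor_zero, zero_mul]; exact poissonMin_nonneg _ hx
  · have hk : (0 : ℝ) < k := by exact_mod_cast h
    have h1 := poissonMin_le_tangent k hx hk.le
    have h2 := poissonMin_le_tangent k hx le_rfl
    rw [poissonMin_zero_right] at h2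
    rw [poissonMin_self] at h1
    have h3 : k * (gapFactor k * x) ≤ k * poissonMin k x := by
      nlinarith
    exact le_of_mul_le_mul_left h3 hk

/-! ### Expectations -/

/-- The expectation of a function with values in `[0, ∞]`. -/
def expect {α : Type} (μ : PMF α) (f : α → ℝ≥0∞) : ℝ≥0∞ := ∑' a, μ a * f a

section Expect

variable {α β : Type}

theorem expect_pure (a : α) (f : α → ℝ≥0∞) : expect (PMF.pure a) f = f a := by
  rw [expect, tsum_eq_single a]
  · simp
  · intro b hb; simp [hb]

theorem expect_bind (μ : PMF α) (κ : α → PMF β) (f : β → ℝ≥0∞) :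
    expect (μ.bind κ) f = expect μ fun a => expect (κ a) f := by
  simp only [expect, PMF.bind_apply, ← ENNReal.tsum_mul_right, ← ENNReal.tsum_mul_left]
  rw [ENNReal.tsum_comm]
  simp only [mul_assoc]

theorem expect_map (μ : PMF α) (g : α → β) (f : β → ℝ≥0∞) :
    expect (μ.map g) f = expect μ fun a => f (g a) := by
  rw [PMF.map, expect_bind]
  simp only [Function.comp, expect_pure]

theorem expect_mono (μ : PMF α) {f g : α → ℝ≥0∞} (h : ∀ a ∈ μ.support, f a ≤ g a) :
    expect μ f ≤ expect μ g := by
  refine ENNReal.tsum_le_tsum fun a => ?_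
  by_cases ha : a ∈ μ.support
  · exact mul_le_mul_right (h a ha) _
  · have : μ a = 0 := by simpa [PMF.mem_support_iff] using ha
    simp [this]

theorem expect_const (μ : PMF α) (c : ℝ≥0∞) : expect μ (fun _ => c) = c := by
  rw [expect, ENNReal.tsum_mul_right, μ.tsum_coe, one_mul]

theorem expect_add (μ : PMF α) (f g : α → ℝ≥0∞) :
    expect μ (fun a => f a + g a) = expect μ f + expect μ g := by
  simp only [expect, mul_add, ENNReal.tsum_add]

theorem expect_mul_const (μ : PMF α) (f : α → ℝ≥0∞) (c : ℝ≥0∞) :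
    expect μ (fun a => f a * c) = expect μ f * c := by
  simp only [expect, ← mul_assoc, ENNReal.tsum_mul_right]

theorem expect_sum {ι : Type} (s : Finset ι) (μ : PMF α) (f : ι → α → ℝ≥0∞) :
    expect μ (fun a => ∑ i ∈ s, f i a) = ∑ i ∈ s, expect μ (f i) := by
  classical
  induction s using Finset.induction_on with
  | empty => simp [expect]
  | insert i s hi ih => simp only [Finset.sum_insert hi, expect_add, ih]

/-- The probability of an event. -/
def prob (μ : PMF α) (S : Set α) : ℝ≥0∞ := expect μ (S.indicator fun _ => 1)

theorem prob_add_compl (μ : PMF α) (S : Set α) : prob μ S + prob μ Sᶜ = 1 := by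
  classical
  rw [prob, prob, ← expect_add]
  have : (fun a => S.indicator (fun _ => (1 : ℝ≥0∞)) a + Sᶜ.indicator (fun _ => 1) a)
      = fun _ => 1 := by
    funext a
    by_cases h : a ∈ S <;> simp [h]
  rw [this, expect_const]

theorem prob_le_one (μ : PMF α) (S : Set α) : prob μ S ≤ 1 := by
  rw [← prob_add_compl μ S]; exact le_self_add

theorem expect_independent_succ {n : ℕ} (μ : Fin (n + 1) → PMF α)
    (f : (Fin (n + 1) → α) → ℝ≥0∞) : expect (independent (n + 1) μ) f =
      expect (μ 0) fun a => expect (independent n fun i => μ i.succ) fun o =>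
        f (Fin.cons a o) := by
  rw [independent, expect_bind]
  simp only [expect_map]

open Classical in
/-- The number of coordinates of `o` that lie in the given sets. -/
def hits {n : ℕ} (S : Fin n → Set α) (o : Fin n → α) : ℕ :=
  (Finset.univ.filter fun i => o i ∈ S i).card

theorem hits_cons {n : ℕ} (S : Fin (n + 1) → Set α) (a : α) (o : Fin n → α) [Decidable (a ∈ S 0)] :
    hits S (Fin.cons a o) = (if a ∈ S 0 then 1 else 0) + hits (fun i => S i.succ) o := by
  classical
  simp only [hits, Finset.card_filter, Fin.sum_univ_succ, Fin.cons_zero, Fin.cons_succ]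

/-- Among the sums of independent indicators with a given mean, the expectation of `min j` is at
least that of a Poisson variable.  Adding one indicator of mean `p` to the sum increases the mean
by `p` and the expectation by at least the value `p * poissonLt j` that the tangent of the concave
function `poissonMin j` predicts. -/
theorem poissonMin_le_expect {n : ℕ} (μ : Fin n → PMF α) (S : Fin n → Set α) (j : ℕ) :
    ENNReal.ofReal (poissonMin j (∑ i, (prob (μ i) (S i)).toReal)) ≤
      expect (independent n μ) fun o => ((min j (hits S o) : ℕ) : ℝ≥0∞) := by
  classical
  induction n generalizing j with
  | zero => simp [poissonMin_zero_right]
  | succ n ih =>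
    cases j with
    | zero => simp [poissonMin]
    | succ j =>
      rw [expect_independent_succ, Fin.sum_univ_succ]
      set s := ∑ i : Fin n, (prob (μ i.succ) (S i.succ)).toReal with hs
      have hs0 : 0 ≤ s := Finset.sum_nonneg fun i _ => ENNReal.toReal_nonneg
      have hstep : ∀ a, (S 0).indicator (fun _ => (1 : ℝ≥0∞)) a
            * (1 + ENNReal.ofReal (poissonMin j s))
          + (S 0)ᶜ.indicator (fun _ => (1 : ℝ≥0∞)) a * ENNReal.ofReal (poissonMin (j + 1) s) ≤
          expect (independent n fun i => μ i.succ) fun o =>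
            ((min (j + 1) (hits S (Fin.cons a o : Fin (n + 1) → α)) : ℕ) : ℝ≥0∞) := by
        intro a
        by_cases ha : a ∈ S 0
        · simp only [hits_cons, ha, if_true, Set.indicator_of_mem, one_mul, Set.mem_compl_iff,
            not_true_eq_false, not_false_eq_true, Set.indicator_of_notMem, zero_mul, add_zero]
          have : ∀ o : Fin n → α, ((min (j + 1) (1 + hits (fun i => S i.succ) o) : ℕ) : ℝ≥0∞) =
              1 + ((min j (hits (fun i => S i.succ) o) : ℕ) : ℝ≥0∞) := by
            intro o
            rw [show min (j + 1) (1 + hits (fun i => S i.succ) o)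
              = 1 + min j (hits (fun i => S i.succ) o) by omega]
            push_cast; rfl
          simp only [this]
          rw [expect_add, expect_const]
          gcongr
          exact ih (fun i => μ i.succ) (fun i => S i.succ) j
        · simp only [hits_cons, ha, if_false, Set.indicator_of_notMem, not_false_eq_true,
            zero_mul, zero_add, Set.mem_compl_iff, Set.indicator_of_mem, one_mul]
          exact ih (fun i => μ i.succ) (fun i => S i.succ) (j + 1)
      refine le_trans ?_ (expect_mono _ fun a _ => hstep a)
      rw [expect_add, expect_mul_const, expect_mul_const]
      change _ ≤ prob (μ 0) (S 0) * _ + prob (μ 0) (S 0)ᶜ * _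
      have hfin : ∀ S', prob (μ 0) S' ≠ ∞ := fun S' => ne_top_of_le_ne_top ENNReal.one_ne_top
        (prob_le_one _ _)
      set p := (prob (μ 0) (S 0)).toReal with hp
      have hp0 : 0 ≤ p := ENNReal.toReal_nonneg
      have hsum : p + (prob (μ 0) (S 0)ᶜ).toReal = 1 := by
        rw [hp, ← ENNReal.toReal_add (hfin _) (hfin _), prob_add_compl]; simp
      have hq0 : 0 ≤ (prob (μ 0) (S 0)ᶜ).toReal := ENNReal.toReal_nonneg
      rw [← ENNReal.ofReal_toReal (hfin (S 0)), ← ENNReal.ofReal_toReal (hfin (S 0)ᶜ),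
        ← ENNReal.ofReal_one, ← ENNReal.ofReal_add zero_le_one (poissonMin_nonneg j hs0),
        ← ENNReal.ofReal_mul ENNReal.toReal_nonneg, ← ENNReal.ofReal_mul ENNReal.toReal_nonneg,
        ← ENNReal.ofReal_add (mul_nonneg ENNReal.toReal_nonneg
          (add_nonneg zero_le_one (poissonMin_nonneg j hs0)))
          (mul_nonneg ENNReal.toReal_nonneg (poissonMin_nonneg _ hs0))]
      refine ENNReal.ofReal_le_ofReal ?_
      have htan := poissonMin_le_tangent (j + 1) hs0 (add_nonneg hp0 hs0)
      have h1 := poissonMin_succ j s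
      have hq : (prob (μ 0) (S 0)ᶜ).toReal = 1 - p := by linarith
      rw [hq]
      refine htan.trans (le_of_eq ?_)
      rw [h1]
      ring

end Expect

/-! ### Correlation gap of the best `k` of independent weights -/

/-- The indicator of `θ < w`. -/
def level (w θ : ℝ) : ℝ≥0∞ := (Set.Iio w).indicator (fun _ => 1) θ

theorem measurable_level (w : ℝ) : Measurable (level w) :=
  measurable_const.indicator measurableSet_Iio

theorem lintegral_level {w : ℝ} (h : w ≤ 1) :
    ∫⁻ θ in Set.Ico 0 1, level w θ = ENNReal.ofReal w := by
  unfold level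
  rw [MeasureTheory.lintegral_indicator_const measurableSet_Iio,
    MeasureTheory.Measure.restrict_apply measurableSet_Iio]
  have : Set.Iio w ∩ Set.Ico 0 1 = Set.Ico 0 w := by
    ext θ
    simp only [Set.mem_inter_iff, Set.mem_Iio, Set.mem_Ico]
    constructor
    · rintro ⟨h1, h2, -⟩; exact ⟨h2, h1⟩
    · rintro ⟨h1, h2⟩; exact ⟨h2, h1, by linarith⟩
  rw [this, Real.volume_Ico]
  simp

theorem measurable_expect {α : Type} [Countable α] (μ : PMF α) {f : α → ℝ → ℝ≥0∞}
    (hf : ∀ a, Measurable (f a)) : Measurable fun θ => expect μ fun a => f a θ :=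
  Measurable.tsum fun a => (hf a).const_mul _

/-- Expectation and integral can be interchanged. -/
theorem lintegral_expect {α : Type} [Countable α] (μ : PMF α) {f : α → ℝ → ℝ≥0∞}
    (hf : ∀ a, Measurable (f a)) (s : Set ℝ) :
    ∫⁻ θ in s, expect μ (fun a => f a θ) = expect μ fun a => ∫⁻ θ in s, f a θ := by
  unfold expect
  rw [MeasureTheory.lintegral_tsum fun a => ((hf a).const_mul _).aemeasurable]
  exact tsum_congr fun a => MeasureTheory.lintegral_const_mul _ (hf a)

/-- Above every level, the `k` best members of `S` are as numerous as possible. -/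
theorem min_card_level_le {n : ℕ} (w : Fin n → ℝ) (k : ℕ) (θ : ℝ) :
    ((min k (Finset.univ.filter fun i : Fin n => θ < w i).card : ℕ) : ℝ≥0∞) ≤
      ∑ i ∈ topRanked Finset.univ w k, level (w i) θ := by
  classical
  have hcard : ∑ i ∈ topRanked Finset.univ w k, level (w i) θ =
      (((topRanked Finset.univ w k).filter fun i : Fin n => θ < w i).card : ℝ≥0∞) := by
    rw [Finset.card_filter, Nat.cast_sum]
    refine Finset.sum_congr rfl fun i _ => ?_
    by_cases h : θ < w i <;> simp [level, h]
  rw [hcard]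
  norm_cast
  by_cases h : ∃ j, θ < w j ∧ j ∉ topRanked Finset.univ w k
  · obtain ⟨j, hj, hjk⟩ := h
    refine (min_le_left _ _).trans ((le_card_topRanked (Finset.mem_univ j) hjk).trans ?_)
    refine Finset.card_le_card fun i hi => Finset.mem_filter.2 ⟨hi, ?_⟩
    exact hj.trans_le (le_of_mem_topRanked hi (Finset.mem_univ j) hjk)
  · push Not at h
    refine (min_le_right _ _).trans (Finset.card_le_card fun i hi => ?_)
    have := (Finset.mem_filter.1 hi).2
    exact Finset.mem_filter.2 ⟨h i this, this⟩

/-- For independent weights in `[0, 1]`, of which at most `k` are positive on average, the best `k`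
keep the fraction `gapFactor k` of the expected sum.  The weights are cut into levels, and every
level is a sum of independent indicators of mean at most `k`. -/
theorem gapFactor_mul_le_expect {α : Type} [Countable α] {n : ℕ} (μ : Fin n → PMF α)
    (w : Fin n → α → ℝ) (h1 : ∀ i a, w i a ≤ 1) (k : ℕ)
    (hk : ∑ i, prob (μ i) {a | 0 < w i a} ≤ k) :
    ENNReal.ofReal (gapFactor k) * ∑ i, expect (μ i) (fun a => ENNReal.ofReal (w i a)) ≤
      expect (independent n μ) fun o => ∑ i ∈ topRanked Finset.univ (fun i => w i (o i)) k,
        ENNReal.ofReal (w i (o i)) := by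
  classical
  have hfin : ∀ i S, prob (μ i) S ≠ ∞ := fun i S => ne_top_of_le_ne_top ENNReal.one_ne_top
    (prob_le_one _ _)
  have hpt : ∀ θ ∈ Set.Ico (0 : ℝ) 1,
      ENNReal.ofReal (gapFactor k) * ∑ i, expect (μ i) (fun a => level (w i a) θ) ≤
      expect (independent n μ) fun o => ∑ i ∈ topRanked Finset.univ (fun i => w i (o i)) k,
        level (w i (o i)) θ := by
    intro θ hθ
    have hprob : ∀ i, expect (μ i) (fun a => level (w i a) θ) = prob (μ i) {a | θ < w i a} := by
      intro i
      refine congrArg _ (funext fun a => ?_)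
      by_cases h : θ < w i a <;> simp [level, h]
    have hle : ∀ i, prob (μ i) {a | θ < w i a} ≤ prob (μ i) {a | 0 < w i a} := fun i =>
      expect_mono _ fun a _ => Set.indicator_le_indicator_of_subset
        (fun a (ha : θ < w i a) => hθ.1.trans_lt ha) (fun _ => zero_le) a
    simp only [hprob]
    have hx : ∑ i, (prob (μ i) {a | θ < w i a}).toReal ≤ k := by
      rw [← ENNReal.toReal_sum fun i _ => hfin i _]
      exact ENNReal.toReal_le_of_le_ofReal (Nat.cast_nonneg k) (by
        rw [ENNReal.ofReal_natCast]
        exact (Finset.sum_le_sum fun i _ => hle i).trans hk)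
    have hx0 : 0 ≤ ∑ i, (prob (μ i) {a | θ < w i a}).toReal :=
      Finset.sum_nonneg fun i _ => ENNReal.toReal_nonneg
    calc ENNReal.ofReal (gapFactor k) * ∑ i, prob (μ i) {a | θ < w i a}
        = ENNReal.ofReal (gapFactor k * ∑ i, (prob (μ i) {a | θ < w i a}).toReal) := by
          rw [ENNReal.ofReal_mul (gapFactor_nonneg k),
            ENNReal.ofReal_sum_of_nonneg fun i _ => ENNReal.toReal_nonneg]
          simp only [ENNReal.ofReal_toReal (hfin _ _)]
      _ ≤ _ := ENNReal.ofReal_le_ofReal (gapFactor_mul_le k hx0 hx)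
      _ ≤ _ := poissonMin_le_expect μ (fun i => {a | θ < w i a}) k
      _ ≤ _ := expect_mono _ fun o _ => by
          have := min_card_level_le (fun i => w i (o i)) k θ
          convert this using 3
          unfold hits
          congr 1
  have hlev : ∀ i, ∀ a : α, Measurable (level (w i a)) := fun i a => measurable_level _
  calc ENNReal.ofReal (gapFactor k) * ∑ i, expect (μ i) (fun a => ENNReal.ofReal (w i a))
      = ∫⁻ θ in Set.Ico (0 : ℝ) 1, ENNReal.ofReal (gapFactor k)
          * ∑ i, expect (μ i) (fun a => level (w i a) θ) := by
        rw [MeasureTheory.lintegral_const_mul _ (Finset.measurable_sum _ fun i _ =>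
          measurable_expect _ (hlev i)), MeasureTheory.lintegral_finsetSum _ fun i _ =>
          measurable_expect _ (hlev i)]
        simp only [lintegral_expect _ (hlev _), lintegral_level (h1 _ _)]
    _ ≤ _ := MeasureTheory.setLIntegral_mono' measurableSet_Ico hpt
    _ = _ := by
        rw [lintegral_expect _ fun o => Finset.measurable_sum _ fun i _ => hlev i (o i)]
        refine congrArg _ (funext fun o => ?_)
        rw [MeasureTheory.lintegral_finsetSum _ fun i _ => hlev i (o i)]
        simp only [lintegral_level (h1 _ _)]

/-! ### Stationarity of the virtual states -/

/-- What a process on the states `τ` that pays `p τ` for a play yields at round `t`, if `a` was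
sampled. -/
def virtualYield (p : ℤ → ℝ) (t : ℕ) : Option ((ℤ × ℤ) × ℕ) → ℝ
  | none => 0
  | some (I, r) => by
      classical exact if isPlay I.1 I.2 (virtualState I r t) then p (virtualState I r t) else 0

theorem expect_uniformBelow {m : ℕ} (hm : 0 < m) (f : ℕ → ℝ≥0∞) :
    expect (uniformBelow m) f = (m : ℝ≥0∞)⁻¹ * ∑ r ∈ Finset.range m, f r := by
  rw [expect, uniformBelow, dif_pos hm, tsum_eq_sum (s := Finset.range m), Finset.mul_sum]
  · refine Finset.sum_congr rfl fun r hr => ?_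
    have := PMF.uniformOfFinset_apply_of_mem ⟨0, Finset.mem_range.2 hm⟩ hr
    rw [Finset.card_range] at this
    exact congrArg (· * f r) this
  · intro r hr
    have := PMF.uniformOfFinset_apply_of_notMem ⟨0, Finset.mem_range.2 hm⟩ hr
    exact (congrArg (· * f r) this).trans (zero_mul _)

theorem sum_range_add_mod {β : Type} [AddCommMonoid β] (f : ℕ → β) (m t : ℕ) :
    ∑ r ∈ Finset.range m, f ((t + r) % m) = ∑ s ∈ Finset.range m, f s := by
  induction t with
  | zero =>
    exact Finset.sum_congr rfl fun r hr => by
      rw [zero_add, Nat.mod_eq_of_lt (Finset.mem_range.1 hr)]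
  | succ t ih =>
    rw [← ih]
    cases m with
    | zero => rfl
    | succ m =>
      rw [Finset.sum_range_succ, Finset.sum_range_succ' (fun r => f ((t + r) % (m + 1)))]
      congr 1
      · exact Finset.sum_congr rfl fun r _ => by congr 2; ring
      · rw [show t + 1 + m = t + 0 + (m + 1) by ring, Nat.add_mod_right]

open Classical in
theorem sum_cycle (p : ℤ → ℝ) {u : ℕ} (hu : u ≠ 0) (j : ℕ) :
    (∑ s ∈ Finset.range (u + j + 1), if isPlay u (-((j : ℤ) + 1)) (cycleState u s)
      then p (cycleState u s) else 0) = p u + ∑ s ∈ Finset.range j, p (-((s : ℤ) + 1)) := by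
  obtain ⟨v, rfl⟩ : ∃ v, u = v + 1 := ⟨u - 1, by omega⟩
  have h1 : ∀ s ∈ Finset.range (v + 1 + j + 1),
      (if isPlay ((v + 1 : ℕ) : ℤ) (-((j : ℤ) + 1)) (cycleState (v + 1) s)
        then p (cycleState (v + 1) s) else 0)
      = if v + 1 ≤ s + 1 ∧ s < v + 1 + j then p (cycleState (v + 1) s) else 0 := fun s hs => by
    simp only [isPlay_cycleState (Finset.mem_range.1 hs)]
  have h2 : ∀ s ∈ Finset.range v,
      (if v + 1 ≤ s + 1 ∧ s < v + 1 + j then p (cycleState (v + 1) s) else 0) = 0 := fun s hs => by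
    have := Finset.mem_range.1 hs
    rw [if_neg (by omega)]
  have h3 : ∀ s ∈ Finset.range j, (if v + 1 ≤ v + 1 + s + 1 ∧ v + 1 + s < v + 1 + j then
      p (cycleState (v + 1) (v + 1 + s)) else 0) = p (-((s : ℤ) + 1)) := fun s hs => by
    have := Finset.mem_range.1 hs
    rw [if_pos (by omega), cycleState, if_neg (by omega)]
    congr 1
    push_cast
    ring
  have h4 : ¬ (v + 1 ≤ v + 1 + j + 1 ∧ v + 1 + j < v + 1 + j) := by omega
  have h5 : v + 1 ≤ v + 1 ∧ v < v + 1 + j := by omega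
  rw [Finset.sum_congr rfl h1, Finset.sum_range_succ _ (v + 1 + j), Finset.sum_range_add,
    Finset.sum_range_succ _ v, Finset.sum_congr rfl h2, Finset.sum_congr rfl h3, if_neg h4,
    if_pos h5, cycleState, if_pos (Nat.lt_succ_self v)]
  simp

/-- For a uniformly random offset, a recurrent interval yields in expectation the average over its
cycle, at every round. -/
theorem expect_virtualYield_some {p : ℤ → ℝ} (hp : ∀ τ, τ ≠ 0 → 0 ≤ p τ) {I : ℤ × ℤ}
    (h1 : 1 ≤ I.1) (h2 : I.2 ≤ -1) (t : ℕ) :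
    ENNReal.ofReal ((I.1 : ℝ) - I.2) * expect (uniformBelow (I.1 - I.2).toNat) (fun r =>
      ENNReal.ofReal (virtualYield p t (some (I, r)))) =
    ENNReal.ofReal (p I.1 + ∑ τ ∈ Finset.Icc (I.2 + 1) (-1), p τ) := by
  classical
  obtain ⟨u, l⟩ := I
  obtain ⟨u, rfl⟩ : ∃ v : ℕ, u = v := ⟨u.toNat, by simp at h1 ⊢; omega⟩
  obtain ⟨j, rfl⟩ : ∃ j : ℕ, l = -((j : ℤ) + 1) := ⟨(-l - 1).toNat, by simp at h2 ⊢; omega⟩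
  simp only at h1 h2 ⊢
  have hu : u ≠ 0 := by omega
  have hm : ((u : ℤ) - -((j : ℤ) + 1)).toNat = u + j + 1 := by omega
  have hmR : ((u : ℤ) : ℝ) - ((-((j : ℤ) + 1) : ℤ) : ℝ) = ((u + j + 1 : ℕ) : ℝ) := by
    push_cast; ring
  have hpos : 0 < u + j + 1 := by omega
  rw [hm, hmR, expect_uniformBelow hpos, ENNReal.ofReal_natCast, ← mul_assoc,
    ENNReal.mul_inv_cancel (by exact_mod_cast hpos.ne') (ENNReal.natCast_ne_top _), one_mul]
  have hy : ∀ r, virtualYield p t (some (((u : ℤ), -((j : ℤ) + 1)), r)) =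
      (fun s => if isPlay u (-((j : ℤ) + 1)) (cycleState u s) then p (cycleState u s) else 0)
        ((t + r) % (u + j + 1)) := by
    intro r
    simp only [virtualYield, virtualState_eq_iterate, iterate_intervalNext hu]
  have hnn : ∀ r, 0 ≤ virtualYield p t (some (((u : ℤ), -((j : ℤ) + 1)), r)) := by
    intro r
    unfold virtualYield
    simp only
    split_ifs
    · exact hp _ (virtualState_ne_zero _ _ _)
    · exact le_rfl
  rw [← ENNReal.ofReal_sum_of_nonneg fun r _ => hnn r]
  rw [Finset.sum_congr rfl fun r _ => hy r, sum_range_add_mod (fun s =>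
    if isPlay u (-((j : ℤ) + 1)) (cycleState u s) then p (cycleState u s) else 0), sum_cycle p hu,
    ← sum_Icc_neg]
  congr 4
  ring

namespace MLSD

variable {n k : ℕ} (M : MLSD n k)

/-- The expected yield of an arm at any round is the linear function of the solution of the linear
program in which the interval `I(u, l)` has the coefficient `p u + p (-1) + … + p (l + 1)`. -/
theorem expect_virtualYield {L : ℤ} {x : Fin n → ℤ × ℤ → ℝ} (h : M.IsFeasible L x) (i : Fin n)
    {p : ℤ → ℝ} (hp : ∀ τ, τ ≠ 0 → 0 ≤ p τ) (t : ℕ) :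
    expect (M.armLaw h i) (fun a => ENNReal.ofReal (virtualYield p t a)) =
      ENNReal.ofReal (∑ I ∈ M.box L, (p I.1 + ∑ τ ∈ Finset.Icc (I.2 + 1) (-1), p τ) * x i I) := by
  have hbox : ∀ I ∈ M.box L, 1 ≤ I.1 ∧ I.2 ≤ -1 := by
    intro I hI
    simp only [box, Finset.mem_product, Finset.mem_Icc] at hI
    omega
  have hnn : ∀ I ∈ M.box L, 0 ≤ p I.1 + ∑ τ ∈ Finset.Icc (I.2 + 1) (-1), p τ := by
    intro I hI
    have := hbox I hI
    refine add_nonneg (hp _ (by omega)) (Finset.sum_nonneg fun τ hτ => hp τ ?_)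
    simp at hτ; omega
  rw [armLaw, expect_bind, expect, tsum_eq_sum (s := Finset.insertNone (M.box L)),
    Finset.sum_insertNone, ENNReal.ofReal_sum_of_nonneg fun I hI =>
      mul_nonneg (hnn I hI) (h.nonneg i I hI)]
  · rw [expect_pure]
    simp only [virtualYield, ENNReal.ofReal_zero, mul_zero, zero_add]
    refine Finset.sum_congr rfl fun I hI => ?_
    have hb := hbox I hI
    have hx := h.nonneg i I hI
    have hlen : (0 : ℝ) ≤ (I.1 : ℝ) - I.2 := by
      have : I.2 ≤ I.1 := by omega
      exact sub_nonneg.2 (by exact_mod_cast this)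
    have hw : M.intervalLaw h i (some I) = ENNReal.ofReal (x i I) * ENNReal.ofReal
        ((I.1 : ℝ) - I.2) := by
      rw [intervalLaw, PMF.ofFinset_apply, intervalWeight, if_pos hI, mul_comm,
        ENNReal.ofReal_mul hx]
    rw [expect_map, hw, mul_assoc]
    have := expect_virtualYield_some hp hb.1 hb.2 t
    simp only [virtualYield] at this
    rw [this, ← ENNReal.ofReal_mul hx, mul_comm]
  · intro a ha
    have : M.intervalLaw h i a = 0 := by
      rw [intervalLaw, PMF.ofFinset_apply_of_notMem _ _ ha]
    rw [this, zero_mul]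

theorem virtualYield_le_one (i : Fin n) (t : ℕ) (a : Option ((ℤ × ℤ) × ℕ)) :
    virtualYield (M.payoff i) t a ≤ 1 := by
  cases a with
  | none => exact zero_le_one
  | some a =>
    unfold virtualYield
    simp only
    split_ifs
    · exact M.payoff_le_one i _ (virtualState_ne_zero _ _ _)
    · exact zero_le_one

theorem virtualYield_nonneg (i : Fin n) (t : ℕ) (a : Option ((ℤ × ℤ) × ℕ)) :
    0 ≤ virtualYield (M.payoff i) t a := by
  cases a with
  | none => exact le_rfl
  | some a =>
    unfold virtualYield
    simp only
    split_ifs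
    · exact M.payoff_nonneg i _ (virtualState_ne_zero _ _ _)
    · exact le_rfl

theorem virtualYield_eq (o : Outcome n) (t : ℕ) (i : Fin n) :
    virtualYield (M.payoff i) t (o i)
      = if i ∈ candidates o t then M.virtualPayoff o t i else 0 := by
  classical
  unfold virtualPayoff
  simp only [candidates, Finset.mem_filter, Finset.mem_univ, true_and]
  rcases o i with _ | ⟨I, r⟩
  · simp [virtualYield]
  · simp only [virtualYield, Option.some.injEq, Prod.mk.injEq]
    congr 1
    simp

/-- At every round, a selection yields the fraction `gapFactor k` of the value of the linear
program. -/
theorem gapFactor_mul_objective_le {L : ℤ} {x : Fin n → ℤ × ℤ → ℝ} (h : M.IsFeasible L x)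
    {sel : Outcome n → ℕ → Finset (Fin n)} (hsel : M.IsSelection sel) {t : ℕ} (ht : 1 ≤ t) :
    ENNReal.ofReal (gapFactor k * M.objective L x) ≤
      expect (M.outcomeLaw h) fun o => ENNReal.ofReal (∑ i ∈ sel o t, M.virtualPayoff o t i) := by
  classical
  have hbox : ∀ I ∈ M.box L, 1 ≤ I.1 ∧ I.2 ≤ -1 := by
    intro I hI
    simp only [box, Finset.mem_product, Finset.mem_Icc] at hI
    omega
  have hobj : ∑ i, expect (M.armLaw h i)
      (fun a => ENNReal.ofReal (virtualYield (M.payoff i) t a))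
      = ENNReal.ofReal (M.objective L x) := by
    simp only [M.expect_virtualYield h _ (M.payoff_nonneg _)]
    rw [← ENNReal.ofReal_sum_of_nonneg]
    · rfl
    · intro i _
      refine Finset.sum_nonneg fun I hI => mul_nonneg ?_ (h.nonneg i I hI)
      have := hbox I hI
      refine add_nonneg (M.payoff_nonneg i _ (by omega)) (Finset.sum_nonneg fun τ hτ =>
        M.payoff_nonneg i τ ?_)
      simp at hτ; omega
  have hplays : ∑ i, prob (M.armLaw h i) {a | 0 < virtualYield (M.payoff i) t a} ≤ k := by
    have h1 : ∀ i, prob (M.armLaw h i) {a | 0 < virtualYield (M.payoff i) t a} ≤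
        ENNReal.ofReal (∑ I ∈ M.box L, -(I.2 : ℝ) * x i I) := by
      intro i
      have h2 := M.expect_virtualYield h i (p := fun _ => 1) (fun _ _ => zero_le_one) t
      have h3 : ∑ I ∈ M.box L, (1 + ∑ τ ∈ Finset.Icc (I.2 + 1) (-1), (1 : ℝ)) * x i I
          = ∑ I ∈ M.box L, -(I.2 : ℝ) * x i I := by
        refine Finset.sum_congr rfl fun I hI => ?_
        have := hbox I hI
        have h4 : (((-1 + 1 - (I.2 + 1)).toNat : ℤ) : ℝ) = -I.2 - 1 := by
          rw [Int.toNat_of_nonneg (by omega)]; push_cast; ring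
        rw [Finset.sum_const, Int.card_Icc, nsmul_eq_mul, mul_one, ← Int.cast_natCast, h4]
        ring
      rw [← h3, ← h2]
      refine expect_mono _ fun a _ => ?_
      by_cases ha : 0 < virtualYield (M.payoff i) t a
      · rw [Set.indicator_of_mem (show a ∈ {a | 0 < virtualYield (M.payoff i) t a} from ha)]
        rcases a with _ | ⟨I, r⟩
        · exact absurd ha (lt_irrefl _)
        · unfold virtualYield at ha ⊢
          simp only at ha ⊢
          split_ifs at ha ⊢ with hpl
          · simp
          · exact absurd ha (lt_irrefl _)
      · rw [Set.indicator_of_notMem (show a ∉ {a | 0 < virtualYield (M.payoff i) t a} from ha)]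
        exact zero_le
    calc _ ≤ ∑ i, ENNReal.ofReal (∑ I ∈ M.box L, -(I.2 : ℝ) * x i I) :=
          Finset.sum_le_sum fun i _ => h1 i
      _ = ENNReal.ofReal (∑ i, ∑ I ∈ M.box L, -(I.2 : ℝ) * x i I) := by
          rw [ENNReal.ofReal_sum_of_nonneg]
          intro i _
          refine Finset.sum_nonneg fun I hI => mul_nonneg ?_ (h.nonneg i I hI)
          have : ((I.2 : ℤ) : ℝ) ≤ ((-1 : ℤ) : ℝ) := by exact_mod_cast (hbox I hI).2
          push_cast at this
          linarith
      _ ≤ ENNReal.ofReal k := ENNReal.ofReal_le_ofReal h.plays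
      _ = k := ENNReal.ofReal_natCast k
  have hgap := gapFactor_mul_le_expect (M.armLaw h) (fun i => virtualYield (M.payoff i) t)
    (fun i a => M.virtualYield_le_one i t a) k hplays
  rw [hobj, ← ENNReal.ofReal_mul (gapFactor_nonneg k)] at hgap
  refine hgap.trans (expect_mono _ fun o _ => ?_)
  rw [← ENNReal.ofReal_sum_of_nonneg fun i _ => M.virtualYield_nonneg i t _]
  refine ENNReal.ofReal_le_ofReal ?_
  simp only [M.virtualYield_eq]
  rw [← Finset.sum_filter]
  refine (hsel o t ht).2.2 _ (fun i hi => (Finset.mem_filter.1 hi).2) ?_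
  exact (Finset.card_filter_le _ _).trans (card_topRanked_le k)

end MLSD

/-! ### Actual and virtual states -/

theorem nextState_mono (P : Prop) {σ τ : ℤ} (h : σ ≤ τ) :
    nextState P σ ≤ nextState P τ := by
  unfold nextState; split_ifs <;> omega

theorem armState_ne_zero {n T : ℕ} (A : Schedule n T) (i : Fin n) (t : ℕ) :
    armState A i t ≠ 0 := by
  cases t with
  | zero => exact one_ne_zero
  | succ t => exact nextState_ne_zero _ _

namespace MLSD

variable {n k : ℕ} (M : MLSD n k)

section Coupling

variable {T : ℕ} (A : Schedule n T) (i : Fin n)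

/-- An arm that is played in a subset of the rounds prescribed by a trajectory `ν` collects at most
one unit less than what its plays yield in the states of `ν`.  Once `ν` has been negative, the
actual state is never below `ν`; before that, at most one play takes place, the one that turns `ν`
negative. -/
theorem virtual_le_collected {q : ℕ → Prop} {ν : ℕ → ℤ}
    (hν : ∀ t, ν (t + 1) = nextState (q t) (ν t)) (h0 : ∀ t, ν t ≠ 0)
    (hq : ∀ t, Plays A i t → q t) (t : ℕ) :
    (by classical exact ∑ s ∈ Finset.range t, if Plays A i s then M.payoff i (ν s) else 0)
      ≤ M.collected A i t + 1 := by
  classical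
  set V : ℕ → ℝ := fun t => ∑ s ∈ Finset.range t, if Plays A i s then M.payoff i (ν s) else 0
    with hV
  have key : (ν t ≤ armState A i t ∧ V t ≤ M.collected A i t + 1) ∨
      (0 < ν t ∧ 0 < armState A i t ∧ V t ≤ M.collected A i t) := by
    induction t with
    | zero =>
      rcases (h0 0).lt_or_gt with h | h
      · exact Or.inl ⟨by change ν 0 ≤ 1; omega, by simp [hV, collected]⟩
      · exact Or.inr ⟨h, one_pos, by simp [hV, collected]⟩
    | succ t ih =>
      have ha0 := armState_ne_zero A i t
      have hν0 := h0 t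
      have hst : armState A i (t + 1) = nextState (Plays A i t) (armState A i t) := rfl
      have hc : M.collected A i (t + 1) = M.collected A i t
          + if Plays A i t then M.payoff i (armState A i t) else 0 := Finset.sum_range_succ _ _
      have hv : V (t + 1) = V t + if Plays A i t then M.payoff i (ν t) else 0 :=
        Finset.sum_range_succ _ _
      rw [hst, hc, hv, hν]
      by_cases hp : Plays A i t
      · have hqt := hq t hp
        simp only [hp, if_true]
        refine Or.inl ?_
        rcases ih with ⟨h1, h2⟩ | ⟨h1, h2, h3⟩
        · have h4 := M.payoff_le_of_le i hν0 ha0 h1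
          refine ⟨?_, by linarith⟩
          have := nextState_mono True h1
          simpa [hp, hqt] using this
        · have h4 := M.payoff_le_one i (ν t) hν0
          have h5 := M.payoff_nonneg i _ ha0
          refine ⟨?_, by linarith⟩
          simp only [nextState, hqt, if_true]
          rw [if_neg (by omega), if_neg (by omega)]
      · simp only [hp, if_false, add_zero]
        by_cases hqt : q t
        · refine Or.inl ⟨?_, ?_⟩
          · simp only [nextState, hqt, if_true, if_false]
            split_ifs <;> omega
          · rcases ih with ⟨-, h2⟩ | ⟨-, -, h3⟩ <;> linarith
        · rcases ih with ⟨h1, h2⟩ | ⟨h1, h2, h3⟩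
          · refine Or.inl ⟨?_, h2⟩
            have := nextState_mono False h1
            simpa [hqt] using this
          · refine Or.inr ⟨?_, ?_, h3⟩
            · simp only [nextState, hqt, if_false]; split_ifs <;> omega
            · simp only [nextState, if_false]; split_ifs <;> omega
  rcases key with ⟨-, h⟩ | ⟨-, -, h⟩
  · exact h
  · exact h.trans (by linarith)

end Coupling

theorem total_nonneg {T : ℕ} (A : Schedule n T) : 0 ≤ M.total A :=
  Finset.sum_nonneg fun _ _ => Finset.sum_nonneg fun i _ =>
    M.payoff_nonneg i _ (armState_ne_zero A i _)

/-- Over all rounds, the payoff differs from the one in the virtual states by at most `1` for each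
arm. -/
theorem virtual_le_total {sel : Outcome n → ℕ → Finset (Fin n)} (hsel : M.IsSelection sel)
    (o : Outcome n) (T : ℕ) :
    ∑ t ∈ Finset.range T, ∑ i ∈ sel o (t + 1), M.virtualPayoff o (t + 1) i ≤
      M.total (fun t : Fin T => sel o ((t : ℕ) + 1)) + n := by
  classical
  set A : Schedule n T := fun t => sel o ((t : ℕ) + 1) with hA
  have hplays : ∀ i t, Plays A i t → i ∈ sel o (t + 1) := by
    rintro i t ⟨h, hi⟩; exact hi
  have harm : ∀ i, (∑ t ∈ Finset.range T, if Plays A i t then M.virtualPayoff o (t + 1) i else 0)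
      ≤ M.collected A i T + 1 := by
    intro i
    rcases hoi : o i with _ | ⟨I, r⟩
    · refine (Finset.sum_nonpos fun t _ => ?_).trans ?_
      · simp [virtualPayoff, hoi]
      · refine add_nonneg (Finset.sum_nonneg fun t _ => ?_) zero_le_one
        split_ifs
        · exact M.payoff_nonneg i _ (armState_ne_zero A i _)
        · exact le_rfl
    · have := M.virtual_le_collected A i
        (q := fun t => isPlay I.1 I.2 (virtualState I r (t + 1)))
        (ν := fun t => virtualState I r (t + 1)) (fun t => virtualState_succ I r (t + 1))
        (fun t => virtualState_ne_zero I r _) (fun t ht => by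
          have h1 := (hsel o (t + 1) (by omega)).1 (hplays i t ht)
          simp only [candidates, Finset.mem_filter, Finset.mem_univ, true_and, hoi,
            Option.some.injEq, Prod.mk.injEq] at h1
          obtain ⟨I', r', ⟨rfl, rfl⟩, h2⟩ := h1
          exact h2) T
      simpa only [virtualPayoff, hoi] using this
  have hsum := Finset.sum_le_sum fun i (_ : i ∈ Finset.univ) => harm i
  rw [Finset.sum_add_distrib, ← total_eq_sum_collected, Finset.sum_comm] at hsum
  simp only [Finset.sum_const, Finset.card_univ, Fintype.card_fin, nsmul_eq_mul, mul_one] at hsum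
  refine le_trans (le_of_eq (Finset.sum_congr rfl fun t ht => ?_)) hsum
  rw [← Finset.sum_filter]
  refine Finset.sum_congr ?_ fun _ _ => rfl
  ext i
  simp [Plays, hA, Finset.mem_range.1 ht]

theorem ofReal_expectedTotal {T : ℕ} (μ : PMF (Schedule n T)) :
    ENNReal.ofReal (M.expectedTotal μ) = expect μ fun A => ENNReal.ofReal (M.total A) := by
  rw [expectedTotal, ENNReal.ofReal_sum_of_nonneg fun A _ =>
    mul_nonneg ENNReal.toReal_nonneg (M.total_nonneg A), expect, tsum_fintype]
  refine Finset.sum_congr rfl fun A _ => ?_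
  rw [ENNReal.ofReal_mul ENNReal.toReal_nonneg, ENNReal.ofReal_toReal (μ.apply_ne_top A)]

/-- The guarantee of the algorithm in terms of the value of the linear program. -/
theorem gapFactor_mul_objective_le_expectedTotal {L : ℤ} {x : Fin n → ℤ × ℤ → ℝ}
    (h : M.IsFeasible L x) {sel : Outcome n → ℕ → Finset (Fin n)} (hsel : M.IsSelection sel)
    (T : ℕ) :
    T * (gapFactor k * M.objective L x) ≤ M.expectedTotal (M.algorithmLaw h sel T) + n := by
  have h0 : 0 ≤ M.expectedTotal (M.algorithmLaw h sel T) :=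
    Finset.sum_nonneg fun A _ => mul_nonneg ENNReal.toReal_nonneg (M.total_nonneg A)
  refine (ENNReal.ofReal_le_ofReal_iff (add_nonneg h0 (Nat.cast_nonneg n))).1 ?_
  calc ENNReal.ofReal (T * (gapFactor k * M.objective L x))
      = ∑ t ∈ Finset.range T, ENNReal.ofReal (gapFactor k * M.objective L x) := by
        rw [ENNReal.ofReal_mul (Nat.cast_nonneg T), ENNReal.ofReal_natCast]
        simp
    _ ≤ ∑ t ∈ Finset.range T, expect (M.outcomeLaw h) fun o =>
          ENNReal.ofReal (∑ i ∈ sel o (t + 1), M.virtualPayoff o (t + 1) i) :=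
        Finset.sum_le_sum fun t _ => M.gapFactor_mul_objective_le h hsel (by omega)
    _ = expect (M.outcomeLaw h) fun o => ENNReal.ofReal
          (∑ t ∈ Finset.range T, ∑ i ∈ sel o (t + 1), M.virtualPayoff o (t + 1) i) := by
        rw [← expect_sum]
        refine congrArg _ (funext fun o => ?_)
        rw [ENNReal.ofReal_sum_of_nonneg fun t _ =>
          Finset.sum_nonneg fun i _ => M.virtualPayoff_nonneg o _ i]
    _ ≤ expect (M.outcomeLaw h) fun o => ENNReal.ofReal
          (M.total (fun t : Fin T => sel o ((t : ℕ) + 1))) + n :=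
        expect_mono _ fun o _ => by
          have := ENNReal.ofReal_le_ofReal (M.virtual_le_total hsel o T)
          rwa [ENNReal.ofReal_add (M.total_nonneg _) (Nat.cast_nonneg n),
            ENNReal.ofReal_natCast] at this
    _ = _ := by
        rw [expect_add, expect_const, ENNReal.ofReal_add h0 (Nat.cast_nonneg n),
          ENNReal.ofReal_natCast, ofReal_expectedTotal, algorithmLaw, expect_map]

theorem objective_le {L : ℤ} {x : Fin n → ℤ × ℤ → ℝ} (h : M.IsFeasible L x) :
    M.objective L x ≤ k := by
  refine le_trans (Finset.sum_le_sum fun i _ => Finset.sum_le_sum fun I hI => ?_) h.plays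
  refine mul_le_mul_of_nonneg_right ?_ (h.nonneg i I hI)
  simp only [box, Finset.mem_product, Finset.mem_Icc] at hI
  exact_mod_cast M.aggregated_le i hI.1.1 hI.2.2

/-- The regret bound with the constant `2`: the `n` arms lose at most `1` each against the virtual
states, and the bound for the optimum counts one round more than `T`, worth at most `k`. -/
theorem regret_bound {ε : ℝ} (hε : 0 < ε) (hε1 : ε < 1) {x : Fin n → ℤ × ℤ → ℝ}
    (hx : M.IsOptimal (-⌈1 / ε⌉) x) {sel : Outcome n → ℕ → Finset (Fin n)}
    (hsel : M.IsSelection sel) (T : ℕ) :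
    (1 - ε) * gapFactor k * M.OPT T - 2 * (n + M.τmax * k)
      ≤ M.expectedTotal (M.algorithmLaw hx.1 sel T) := by
  have hceil : (⌈1 / ε⌉ : ℤ) = (⌈1 / ε⌉₊ : ℕ) := (Int.natCast_ceil_eq_ceil (by positivity)).symm
  set L := ⌈1 / ε⌉₊ with hLdef
  have hL1 : 1 ≤ L := Nat.ceil_pos.2 (by positivity)
  obtain ⟨lam, lo, hi, hcrit⟩ := M.exists_isCritical hL1
  have hOPT := M.OPT_le_dual hε hε1 (Nat.le_ceil _) hcrit.nonneg (hcrit.dual_nonneg hL1)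
    (fun i _ hI => hcrit.dual_feasible i hI) T
  have hobj : k * lam + ∑ i, (M.density i (lo i) - lam * playRate (lo i))
      ≤ M.objective (-⌈1 / ε⌉) x := by
    rw [← hcrit.objective_eq]
    have := hx.2
    rw [hceil] at this ⊢
    exact this _ hcrit.isFeasible
  have hk := M.objective_le hx.1
  have halg := M.gapFactor_mul_objective_le_expectedTotal hx.1 hsel T
  set V := M.objective (-⌈1 / ε⌉) x
  have h1 : gapFactor k * ((1 - ε) * M.OPT T) ≤ gapFactor k * ((T + 1) * V) :=
    mul_le_mul_of_nonneg_left (hOPT.trans (mul_le_mul_of_nonneg_left hobj (by positivity)))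
      (gapFactor_nonneg k)
  have h2 : gapFactor k * V ≤ k :=
    (mul_le_mul_of_nonneg_left hk (gapFactor_nonneg k)).trans
      (mul_le_of_le_one_left (Nat.cast_nonneg k) (gapFactor_le_one k))
  have h3 : (k : ℝ) ≤ M.τmax * k := le_mul_of_one_le_left (Nat.cast_nonneg k) (by
    exact_mod_cast M.τmax_pos)
  have h4 : (0 : ℝ) ≤ n := Nat.cast_nonneg n
  have h5 : (0 : ℝ) ≤ k := Nat.cast_nonneg k
  nlinarith

end MLSD

theorem theorem1 :
    ∃ (P : OnlineProgram) (c d : ℕ) (C : ℝ), ∀ (n k : ℕ) (M : MLSD n k) (ε : ℝ), 0 < ε → ε < 1 →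
      (∃ B : ℕ, (B : ℝ) ≤ c * (n + M.τmax + 1 / ε) ^ d ∧ P.RunsWithin B (M.input ε) ∧
        ∃ (x : Fin n → ℤ × ℤ → ℝ) (hx : M.IsOptimal (-⌈1 / ε⌉) x)
          (sel : Outcome n → ℕ → Finset (Fin n)), M.IsSelection sel ∧
          ∀ T : ℕ, P.playLaw B n T (M.input ε) = M.algorithmLaw hx.1 sel T) ∧
      (∀ (x : Fin n → ℤ × ℤ → ℝ) (hx : M.IsOptimal (-⌈1 / ε⌉) x)
          (sel : Outcome n → ℕ → Finset (Fin n)), M.IsSelection sel → ∀ T : ℕ,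
          (1 - ε) * (1 - (k : ℝ) ^ k / (Real.exp 1 ^ k * (k.factorial : ℝ))) * M.OPT T
              - C * (n + M.τmax * k)
            ≤ M.expectedTotal (M.algorithmLaw hx.1 sel T)) := by
  obtain ⟨c, d, hcd⟩ := lpProgram_implements
  exact ⟨lpProgram, c, d, 2, fun n k M ε hε hε1 => ⟨hcd n k M ε hε hε1,
    fun x hx sel hsel T => M.regret_bound hε hε1 hx hsel T⟩⟩

end
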